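/- **Setting.** Let $(\mathcal X,\mathcal B)$ be a measurable space, $X=\{X_n\}_{n\ge1}$ an $\mathcal X$-valued process, and $P$ a probability kernel from $\mathcal X$ to $\mathbb R$; let $F_x$ be the distribution function of $P(x,\cdot)$ and suppose that every $F_x$ has a finite mean. For $n\ge1$ let $\{\xi_n^x\}_{x\in\mathcal X}$ be families of real random variables, mutually independent in $n$, independent of the process $X$, and such that $\xi_n^x$ has distribution function $F_x$ (each family being a jointly measurable random function of $x$). Put $S_0=0$, $S_n=\sum_{i=1}^n\xi_i^{X_i}$, $M=\sup_{n\ge0}S_n$, and $\mu(y)=\min\{n\ge1: S_n>y\}$. Write $\overline H=1-H$ for the tail of a distribution function $H$, and let $H^s$ be given by $\overline{H}^s(y)=\min\bigl(1,\int_y^\infty\overline H(t)\,dt\bigr)$. A distribution $H$ on $[0,\infty)$ is subexponential if $\overline H(y)>0$ for all $y$ and $\overline{H}^{*2}(y)/\overline H(y)\to2$ as $y\to\infty$; a distribution on $\mathbb R$ is subexponential if its positive part (the law of $\max(Z,0)$) is. Suppose that there are a distribution function $F$ on $[0,\infty)$ with finite mean, a measurable function $c:\mathcal X\to[0,\infty)$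 and a constant $L<\infty$ such that $$\lim_{y\to\infty}\frac{\overline F_x(y)}{\overline F(y)}=c(x)\quad\text{for all }x,\qquad \overline F_x(y)\le L\,\overline F(y)\quad\text{for all }x\text{ and all }y\ge0 .$$ The process $X$ is regenerative if there are integer-valued random variables $0\le T_0<T_1<\cdots$ a.s. such that, with $\tau_0=T_0$ and $\tau_n=T_n-T_{n-1}$ $(n\ge1)$, the cycles $Z_0=\{\tau_0;X_1,\dots,X_{T_0}\}$ and $Z_n=\{\tau_n;X_{T_{n-1}+1},\dots,X_{T_n}\}$ $(n\ge1)$ are mutually independent for $n\ge0$ and identically distributed for $n\ge1$. Write $\tau=\tau_1$. If $\mathbf E\tau<\infty$, let $\pi$ be the probability measure $$\pi(B)=\frac1{\mathbf E\tau}\,\mathbf E\Bigl(\sum_{i=T_0+1}^{T_1}\mathbf 1(X_i\in B)\Bigr),\qquad B\in\mathcal B,$$ and put $C(B)=\int_B c(x)\,\pi(dx)$. **Theorem 4.** Assume that $X$ is regenerative with $\mathbf E\tau<\infty$, that $\int_{\mathcal X}\mathbf E|\xi_1^x|\,\pi(dx)<\infty$ and $\int_{\mathcal X}\mathbf E\xi_1^x\,\pi(dx)=-a$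 for some $a>0$, and that $F^s$ is subexponential. Assume also that there is a family $\{G_x\}_{x\in\mathcal X}$ of distribution functions on $\mathbb R$, with $G_x(y)$ measurable in $x$ for every $y$, such that $$\overline F_x(y)\le\overline G_x(y)\qquad\text{for all }x\text{ and all }y,$$ and, for each $x$, $G_x(y)=\mathbf P(\zeta-b^x\le y)$ for all $y$, where $\zeta$ and $b^x$ are independent random variables, the distribution of $\zeta$ does not depend on $x$, $b^x\ge0$ a.s., $$\limsup_{y\to\infty}\frac{\mathbf P(\zeta>y)}{\overline F(y)}<\infty,\qquad\text{and}\qquad \mathbf E_\pi b^X\equiv\int_{\mathcal X}\mathbf E b^x\,\pi(dx)>\mathbf E\zeta .$$ Assume further that, for some $b>\mathbf E\zeta$, $$\mathbf P(b\tau_0>y)=o(\overline{F}^s(y))\quad\text{and}\quad \mathbf P(b\tau>y)=o(\overline F(y))\qquad\text{as }y\to\infty .$$ Then, for every $B\in\mathcal B$, $$\lim_{y\to\infty}\frac{\mathbf P(M>y,\;X_{\mu(y)}\in B)}{\overline{F}^s(y)}=\frac{C(B)}{a}.$$ -/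

import Mathlib

open MeasureTheory ProbabilityTheory Filter Topology Set
open scoped ENNReal

namespace ModulatedWalk

noncomputable section

/-! ### Heavy tails -/

/-- The tail `t ↦ H((t, ∞))` of a law `H` on `ℝ`. -/
def tail (H : Measure ℝ) (t : ℝ) : ℝ := H.real (Ioi t)

/-- The second tail `min (1, ∫_y^∞ H((t, ∞)) dt)` of a law `H` on `ℝ`. The integral is taken in
`[0, ∞]`; it is finite when `H` has a finite mean. -/
def secondTail (H : Measure ℝ) (y : ℝ) : ℝ :=
  (min 1 (∫⁻ t in Ioi y, H (Ioi t))).toReal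

theorem antitone_lintegral_tail (H : Measure ℝ) :
    Antitone fun y : ℝ => ∫⁻ t in Ioi y, H (Ioi t) :=
  fun _ _ h => lintegral_mono_set (Ioi_subset_Ioi h)

theorem antitone_secondTail (H : Measure ℝ) : Antitone (secondTail H) := by
  intro x y h
  exact ENNReal.toReal_mono (ne_top_of_le_ne_top ENNReal.one_ne_top (min_le_left _ _))
    (min_le_min_left _ (antitone_lintegral_tail H h))

theorem tendsto_lintegral_tail (H : Measure ℝ) (x : ℝ) :
    Tendsto (fun y : ℝ => ∫⁻ t in Ioi y, H (Ioi t)) (𝓝[>] x)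
      (𝓝 (∫⁻ t in Ioi x, H (Ioi t))) := by
  have hanti := antitone_lintegral_tail H
  have h1 := hanti.tendsto_nhdsGT x
  convert h1 using 2
  apply le_antisymm
  · have hU : (⋃ n : ℕ, Ioi (x + 1 / ((n : ℝ) + 1))) = Ioi x := by
      ext z
      simp only [mem_iUnion, mem_Ioi]
      constructor
      · rintro ⟨n, hn⟩
        have : (0 : ℝ) < 1 / ((n : ℝ) + 1) := by positivity
        linarith
      · intro hz
        obtain ⟨n, hn⟩ := exists_nat_one_div_lt (sub_pos.2 hz)
        exact ⟨n, by linarith⟩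
    have hmono : Monotone fun n : ℕ => Ioi (x + 1 / ((n : ℝ) + 1)) := by
      intro m n h
      apply Ioi_subset_Ioi
      have := Nat.one_div_le_one_div (α := ℝ) h
      linarith
    rw [← hU, setLIntegral_iUnion_of_directed _ hmono.directed_le]
    refine iSup_le fun n => le_sSup ⟨x + 1 / ((n : ℝ) + 1), ?_, rfl⟩
    have : (0 : ℝ) < 1 / ((n : ℝ) + 1) := by positivity
    rw [hU]
    exact lt_add_of_pos_right x this
  · apply sSup_le
    rintro _ ⟨y, hy, rfl⟩
    exact hanti (le_of_lt hy)

theorem continuousWithinAt_secondTail (H : Measure ℝ) (x : ℝ) :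
    ContinuousWithinAt (secondTail H) (Ici x) x := by
  rw [← continuousWithinAt_Ioi_iff_Ici]
  have h := (tendsto_const_nhds (x := (1 : ℝ≥0∞))).min (tendsto_lintegral_tail H x)
  exact (ENNReal.tendsto_toReal
    (ne_top_of_le_ne_top ENNReal.one_ne_top (min_le_left _ _))).comp h

/-- The distribution function `y ↦ 1 - min (1, ∫_y^∞ H((t, ∞)) dt)` of the second-tail
(integrated-tail) distribution of `H`. -/
def secondTailDF (H : Measure ℝ) : StieltjesFunction ℝ where
  toFun y := 1 - secondTail H y
  mono' _ _ h := sub_le_sub_left (antitone_secondTail H h) 1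
  right_continuous' x := continuousWithinAt_const.sub (continuousWithinAt_secondTail H x)

/-- The second-tail distribution of `H`, as a law on `ℝ`. -/
def secondTailLaw (H : Measure ℝ) : Measure ℝ := (secondTailDF H).measure

/-- The law of `max (Z, 0)` when `Z` has law `H`. It is `H` itself if `H` lives on `[0, ∞)`. -/
def positivePart (H : Measure ℝ) : Measure ℝ := H.map fun t => max t 0

/-- Subexponentiality of a law on `ℝ`: all tails are positive and, for the positive part
of the law, the tail of the twofold convolution is asymptotically twice the tail. -/
def Subexponential (H : Measure ℝ) : Prop :=
  (∀ y, 0 < tail H y) ∧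
    Tendsto (fun y => tail (Measure.conv (positivePart H) (positivePart H)) y /
      tail (positivePart H) y) atTop (𝓝 2)

/-- The law of `Z - Y` for independent `Z` with law `ν` and `Y` with law `β`. -/
def differenceLaw (ν β : Measure ℝ) : Measure ℝ := (ν.prod β).map fun p => p.1 - p.2

/-! ### The modulated random walk

Sequences which the mathematics indexes by `n ≥ 1` are indexed by `ℕ`, with `X i` standing for
`X_{i+1}` and `ξ i` for the family `ξ_{i+1}`. -/

section Walk

variable {Ω 𝒳 : Type*} [MeasurableSpace Ω] [MeasurableSpace 𝒳]

/-- `ξ` consists of families `{ξ_n^x}_x` of random variables, where `ξ_n^x` has law `P x`, the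
families are mutually independent in `n`, and together they are independent of the process `X`.
The family number `n` is a random function `x ↦ ξ_n^x`, measurable jointly in `x` and in its own
source of randomness `𝒢 n`; it is these sources that are independent. (Independence of the
finite-dimensional distributions in `x` alone would say nothing about `ξ_n^{X_n}` when the state
space is uncountable.) -/
structure IsModulatedFamily (μ : Measure Ω) (X : ℕ → Ω → 𝒳) (P : Kernel 𝒳 ℝ)
    (ξ : ℕ → 𝒳 → Ω → ℝ) : Prop where
  law : ∀ n x, μ.map (ξ n x) = P x
  indep : ∃ 𝒢 : ℕ → MeasurableSpace Ω,
    (∀ n, 𝒢 n ≤ ‹MeasurableSpace Ω›) ∧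
    (∀ n, Measurable[(‹MeasurableSpace 𝒳›).prod (𝒢 n)] fun p : 𝒳 × Ω => ξ n p.1 p.2) ∧
    iIndep 𝒢 μ ∧
    Indep (⨆ n, 𝒢 n) (⨆ n, MeasurableSpace.comap (X n) ‹MeasurableSpace 𝒳›) μ

/-- The modulated random walk `S_n = ∑_{i=1}^n ξ_i^{X_i}`. -/
def walk (X : ℕ → Ω → 𝒳) (ξ : ℕ → 𝒳 → Ω → ℝ) (n : ℕ) (ω : Ω) : ℝ :=
  ∑ i ∈ Finset.range n, ξ i (X i ω) ω

/-- `M = sup_{n ≥ 0} S_n`, with values in `[0, ∞]`. -/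
def walkSup (X : ℕ → Ω → 𝒳) (ξ : ℕ → 𝒳 → Ω → ℝ) (ω : Ω) : EReal :=
  ⨆ n : ℕ, (walk X ξ n ω : EReal)

/-- `μ(y) = min {n ≥ 1 : S_n > y}`; the value `0` stands for `∞`, when there is no such `n`. -/
def passageTime (X : ℕ → Ω → 𝒳) (ξ : ℕ → 𝒳 → Ω → ℝ) (y : ℝ) (ω : Ω) : ℕ :=
  sInf {n : ℕ | 1 ≤ n ∧ y < walk X ξ n ω}

/-- The state `X_{μ(y)}` at the passage time (used only where `μ(y)` is finite). -/
def passageState (X : ℕ → Ω → 𝒳) (ξ : ℕ → 𝒳 → Ω → ℝ) (y : ℝ) (ω : Ω) : 𝒳 :=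
  X (passageTime X ξ y ω - 1) ω

/-! ### Regenerative processes -/

/-- The regeneration epoch at which cycle `n` starts: `0` for cycle `0`, `T_{n-1}` for `n ≥ 1`. -/
def cycleStart (T : ℕ → Ω → ℕ) : ℕ → Ω → ℕ
  | 0, _ => 0
  | n + 1, ω => T n ω

/-- The cycle lengths `τ_0 = T_0` and `τ_n = T_n - T_{n-1}`, `n ≥ 1`. -/
def cycleLength (T : ℕ → Ω → ℕ) (n : ℕ) (ω : Ω) : ℕ := T n ω - cycleStart T n ω

/-- The cycles `Z_0 = {τ_0; X_1, …, X_{T_0}}` and `Z_n = {τ_n; X_{T_{n-1}+1}, …, X_{T_n}}`, `n ≥ 1`,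
as random words over the state space, of random length. -/
def cycle (X : ℕ → Ω → 𝒳) (T : ℕ → Ω → ℕ) (n : ℕ) (ω : Ω) : Σ k : ℕ, (Fin k → 𝒳) :=
  ⟨cycleLength T n ω, fun i => X (cycleStart T n ω + i) ω⟩

/-- `X` is regenerative with regeneration epochs `0 ≤ T_0 < T_1 < …`. -/
structure IsRegenerative (μ : Measure Ω) (X : ℕ → Ω → 𝒳) (T : ℕ → Ω → ℕ) : Prop where
  measurable_process : ∀ n, Measurable (X n)
  measurable_epoch : ∀ n, Measurable (T n)
  strictMono : ∀ᵐ ω ∂μ, StrictMono fun n => T n ω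
  indep : iIndepFun (cycle X T) μ
  identDistrib : ∀ n, 1 ≤ n → IdentDistrib (cycle X T n) (cycle X T 1) μ μ

/-- The law `π(B) = E(∑_{i=T_0+1}^{T_1} 1(X_i ∈ B)) / E τ`, where `τ = τ_1`. -/
def cycleLaw (μ : Measure Ω) (X : ℕ → Ω → 𝒳) (T : ℕ → Ω → ℕ) : Measure 𝒳 :=
  (∫⁻ ω, (cycleLength T 1 ω : ℝ≥0∞) ∂μ)⁻¹ •
    μ.bind fun ω => ∑ i ∈ Finset.Ico (T 0 ω) (T 1 ω), Measure.dirac (X i ω)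

end Walk

end

end ModulatedWalk

open ModulatedWalk

/-! A heavy-tailed walk with negative drift reaches a high level `y` by a single big jump. Over a
cycle the walk loses `α = a E τ` on average, so at cycle `n` it sits near `-α n` and needs a jump
above `y + α n`. Summing over `n` gives `1 / α` times the integral over `t > y` of the expected
number of increments of one cycle that exceed `t`. By dominated convergence this number is
asymptotically `E τ ∫ c dπ` times `tail F t`; counting only jumps made from states in `B` replaces
the constant by `E τ C(B)`, and `E τ C(B) / α = C(B) / a`.

The lower bound is proved for every `B`, by exhibiting disjoint events "the first big jump occurs in
cycle `n`, in a state of `B`" (`exists_le_iUnion_firstJump`, `exists_passage_of_firstJump`,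
`eventually_le_coupledWalk`). The upper bound is needed only for the whole state space
(`eventually_coupledWalk_le`): subtracting from it the lower bound for the complement of `B` gives
the upper bound for `B`.

The upper bound rests on Veraverbeke's theorem for a walk observed along i.i.d. cycles
(`eventually_exceed_le`), proved by a renewal inequality at the first crossing of a line `A - h n`.
It requires the integrated tail of the maximum of the walk within one cycle. This is the heart of
the proof, and it has two stages.

For i.i.d. increments with the law of `ζ`, Veraverbeke's theorem is used in both directions. The
maximum of the walk with steps `ζ - b` is known; grouping its steps into cycles and applying the
lower bound to the grouped walk bounds the integrated tail of the cycle maximum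
(`eventually_integratedTail_cycleMax_le`). The assumption on `b τ` makes the cost of grouping
negligible.

Then the quantile coupling puts every increment with law `F_x` below a copy of `ζ`. The event that
one copy of `ζ` is large while the true increment is not lies in the difference of the two events
"the cycle maximum exceeds `t`" (`unifSeq_cycleMax_add_le`). Removing it from the bound for `ζ`
cancels the contribution of `ζ` and leaves the sharp bound for the true increments
(`eventually_integratedTail_cycleMax_kernel_le`). The initial cycle is negligible by
`eventually_cycleMax_le_of_length`.

The estimates are made for a coupled walk with independent uniform marks attached cycle by cycle;
conditioning on `X` shows that it has the law of the original walk (`measure_passage_eq`).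
Subexponentiality enters only through `HeavyTail`, mainly in the convolution estimate
`HeavyTail.lintegral_shift_le`. -/

namespace ModulatedWalk

/-! ### Consequences of subexponentiality -/

/-- The properties of a subexponential tail used below: positivity, long-tailedness, and the
negligibility of two simultaneous large summands. -/
structure HeavyTail (H : Measure ℝ) : Prop where
  pos : ∀ y, 0 < tail H y
  long : ∀ k, Tendsto (fun y => tail H (y - k) / tail H y) atTop (𝓝 1)
  both : ∀ ε, 0 < ε → ∃ B, 0 ≤ B ∧ ∀ᶠ y in atTop,
    (H.prod H).real {p : ℝ × ℝ | B < p.1 ∧ B < p.2 ∧ y < p.1 + p.2} ≤ ε * tail H y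

theorem tail_nonneg (H : Measure ℝ) (y : ℝ) : 0 ≤ tail H y := measureReal_nonneg

theorem antitone_tail (H : Measure ℝ) [IsFiniteMeasure H] : Antitone (tail H) :=
  fun _ _ h => measureReal_mono (Ioi_subset_Ioi h)

theorem ofReal_tail (H : Measure ℝ) [IsFiniteMeasure H] (y : ℝ) :
    ENNReal.ofReal (tail H y) = H (Ioi y) := ofReal_measureReal

theorem tendsto_measure_Ioi_atTop (H : Measure ℝ) [IsFiniteMeasure H] :
    Tendsto (fun y => H (Ioi y)) atTop (𝓝 0) := by
  have h := tendsto_measure_iInter_atTop (μ := H) (s := fun y : ℝ => Ioi y)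
    (fun _ => measurableSet_Ioi.nullMeasurableSet) (fun _ _ h => Ioi_subset_Ioi h)
    ⟨0, measure_ne_top _ _⟩
  have he : (⋂ y : ℝ, Ioi y) = ∅ := by
    ext z
    simp only [mem_iInter, mem_Ioi, mem_empty_iff_false, iff_false, not_forall, not_lt]
    exact ⟨z, le_rfl⟩
  rwa [he, measure_empty] at h

theorem tendsto_tail_atTop (H : Measure ℝ) [IsFiniteMeasure H] :
    Tendsto (tail H) atTop (𝓝 0) := by
  have := (ENNReal.tendsto_toReal ENNReal.zero_ne_top).comp (tendsto_measure_Ioi_atTop H)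
  rwa [ENNReal.toReal_zero] at this

section SubexponentialCriteria

variable {H : Measure ℝ} [IsProbabilityMeasure H]

theorem tail_conv_eq (y : ℝ) :
    tail (Measure.conv H H) y = (H.prod H).real {p : ℝ × ℝ | y < p.1 + p.2} := by
  unfold tail Measure.conv
  rw [map_measureReal_apply (by fun_prop) measurableSet_Ioi]
  rfl

theorem measureReal_Ioc (H : Measure ℝ) [IsProbabilityMeasure H] {a b : ℝ} (h : a ≤ b) :
    H.real (Ioc a b) = tail H a - tail H b := by
  have : Ioi a = Ioc a b ∪ Ioi b := (Ioc_union_Ioi_eq_Ioi h).symm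
  unfold tail
  rw [this, measureReal_union (by
    rw [Set.disjoint_left]; intro x hx hx'; exact absurd hx.2 (not_le.2 hx')) measurableSet_Ioi]
  ring

theorem measureReal_Iic_eq (H : Measure ℝ) [IsProbabilityMeasure H] (b : ℝ) :
    H.real (Iic b) = 1 - tail H b := by
  have := probReal_compl_eq_one_sub (μ := H) (measurableSet_Ioi (a := b))
  rwa [compl_Ioi] at this

theorem measureReal_Icc_zero {a : ℝ} (h0 : H (Iio 0) = 0) :
    H.real (Icc 0 a) = 1 - tail H a := by
  rw [← measureReal_Iic_eq]
  refine le_antisymm (measureReal_mono fun x hx => hx.2) ?_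
  have : Iic a ⊆ Iio 0 ∪ Icc 0 a := by
    intro x hx
    by_cases h : x < 0
    · exact Or.inl h
    · exact Or.inr ⟨not_lt.1 h, hx⟩
  refine (measureReal_mono this).trans ((measureReal_union_le _ _).trans ?_)
  rw [measureReal_def H (Iio 0), h0]
  simp

/-- Write `T = tail H`. For `k ≥ 0`, three disjoint rectangles inside `{s + t > y}` have total mass
`2 T(y) - T(k) T(y) + T(y - k) (T(k) - T(y))`. After division by `T(y)`, the limit `2` of the
convolution ratio leaves no room for `T(y - k) / T(y)` to stay above `1`. Negative `k` follows by
shifting `y` and inverting the ratio. -/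
theorem longTailed_of_conv (h0 : H (Iio 0) = 0) (hpos : ∀ y, 0 < tail H y)
    (h2 : Tendsto (fun y => tail (Measure.conv H H) y / tail H y) atTop (𝓝 2)) (k : ℝ) :
    Tendsto (fun y => tail H (y - k) / tail H y) atTop (𝓝 1) := by
  have hnonneg : ∀ k : ℝ, 0 ≤ k →
      Tendsto (fun y => tail H (y - k) / tail H y) atTop (𝓝 1) := by
    intro k hk
    have hkey : ∀ y, k ≤ y → tail H y + (tail H y * (1 - tail H k) +
        tail H (y - k) * (tail H k - tail H y)) ≤ tail (Measure.conv H H) y := by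
      intro y hy
      rw [tail_conv_eq]
      have hsub : ((Ici 0 ×ˢ Ioi y ∪ Ioi y ×ˢ Icc 0 k) ∪ Ioi (y - k) ×ˢ Ioc k y : Set (ℝ × ℝ)) ⊆
          {p : ℝ × ℝ | y < p.1 + p.2} := by
        rintro ⟨s, t⟩ h
        simp only [mem_union, mem_prod, mem_Ici, mem_Ioi, mem_Icc, mem_Ioc] at h
        simp only [mem_ofPred_eq]
        rcases h with (⟨h1, h2⟩ | ⟨h1, h2, h3⟩) | ⟨h1, h2, h3⟩ <;> linarith
      refine le_trans (le_of_eq ?_) (measureReal_mono hsub)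
      have hIci : H.real (Ici 0) = 1 := by
        have := probReal_compl_eq_one_sub (μ := H) (measurableSet_Iio (a := (0:ℝ)))
        rw [compl_Iio] at this
        rw [this, measureReal_def, h0]; simp
      rw [measureReal_union, measureReal_union, measureReal_prod_prod, measureReal_prod_prod,
        measureReal_prod_prod, measureReal_Icc_zero h0, measureReal_Ioc H hy, hIci]
      · unfold tail; ring
      · rw [Set.disjoint_left]
        rintro ⟨s, t⟩ h1 h2
        simp only [mem_prod, mem_Ioi, mem_Icc, mem_Ici] at h1 h2
        linarith [h1.2, h2.2.2]
      · exact measurableSet_Ioi.prod measurableSet_Icc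
      · rw [Set.disjoint_left]
        rintro ⟨s, t⟩ h1 h2
        simp only [mem_union, mem_prod, mem_Ioi, mem_Icc, mem_Ici, mem_Ioc] at h1 h2
        rcases h1 with h1 | h1
        · linarith [h1.2, h2.2.2]
        · linarith [h1.2.2, h2.2.1]
      · exact measurableSet_Ioi.prod measurableSet_Ioc
    have ht := tendsto_tail_atTop H
    have hden : Tendsto (fun y => tail H k - tail H y) atTop (𝓝 (tail H k)) := by
      simpa using tendsto_const_nhds.sub ht
    have hup : Tendsto (fun y => (tail (Measure.conv H H) y / tail H y - 1 - (1 - tail H k)) /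
        (tail H k - tail H y)) atTop (𝓝 1) := by
      have h3 := ((h2.sub_const 1).sub_const (1 - tail H k)).div hden (hpos k).ne'
      have h4 : (2 - 1 - (1 - tail H k)) / tail H k = 1 := by
        rw [div_eq_one_iff_eq (hpos k).ne']; ring
      rwa [h4] at h3
    refine tendsto_of_tendsto_of_tendsto_of_le_of_le' tendsto_const_nhds hup ?_ ?_
    · filter_upwards with y
      rw [le_div_iff₀ (hpos y), one_mul]
      exact antitone_tail H (by linarith)
    · filter_upwards [eventually_ge_atTop k, hden.eventually (lt_mem_nhds (hpos k))] with y hy hy2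
      rw [le_div_iff₀ hy2, div_mul_eq_mul_div, div_le_iff₀ (hpos y)]
      have h4 := hkey y hy
      have h5 : tail (Measure.conv H H) y / tail H y * tail H y = tail (Measure.conv H H) y :=
        div_mul_cancel₀ _ (hpos y).ne'
      nlinarith
  rcases le_total 0 k with hk | hk
  · exact hnonneg k hk
  · have h1 := (hnonneg (-k) (by linarith)).comp (tendsto_atTop_add_const_right atTop (-k) tendsto_id)
    have h2 := h1.inv₀ one_ne_zero
    rw [inv_one] at h2
    refine h2.congr fun y => ?_
    simp [Function.comp, sub_eq_add_neg]

/-- One summand in `[0, B]` and the other above `y` already use up `2 (1 - tail H B) tail H y` of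
the convolution tail. If `tail H B < ε / 4`, what is left for two large summands is at most `2 + ε /
2 - 2 (1 - ε / 4) = ε` times `tail H y`. -/
theorem both_large_of_conv (h0 : H (Iio 0) = 0) (hpos : ∀ y, 0 < tail H y)
    (h2 : Tendsto (fun y => tail (Measure.conv H H) y / tail H y) atTop (𝓝 2)) (ε : ℝ)
    (hε : 0 < ε) : ∃ B, 0 ≤ B ∧ ∀ᶠ y in atTop,
      (H.prod H).real {p : ℝ × ℝ | B < p.1 ∧ B < p.2 ∧ y < p.1 + p.2} ≤ ε * tail H y := by
  obtain ⟨B, hB, hB0⟩ := (((tendsto_tail_atTop H).eventually (gt_mem_nhds (by positivity :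
    (0:ℝ) < ε / 4))).and (eventually_ge_atTop 0)).exists
  refine ⟨B, hB0, ?_⟩
  filter_upwards [h2.eventually (gt_mem_nhds (by linarith : (2:ℝ) < 2 + ε / 2)),
    eventually_gt_atTop (2 * B)] with y hy hyB
  rw [div_lt_iff₀ (hpos y), tail_conv_eq] at hy
  have hI := measureReal_Icc_zero (a := B) h0
  set S := {p : ℝ × ℝ | B < p.1 ∧ B < p.2 ∧ y < p.1 + p.2}
  have hsub : (Icc 0 B ×ˢ Ioi y ∪ Ioi y ×ˢ Icc 0 B) ∪ S ⊆ {p : ℝ × ℝ | y < p.1 + p.2} := by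
    rintro ⟨s, t⟩ h
    simp only [mem_union, mem_prod, mem_Icc, mem_Ioi, S, mem_ofPred_eq] at h ⊢
    rcases h with (⟨h1, h2⟩ | ⟨h1, h2⟩) | ⟨h1, h2, h3⟩ <;> linarith
  have hS : MeasurableSet S := by
    refine (measurableSet_lt measurable_const measurable_fst).inter
      ((measurableSet_lt measurable_const measurable_snd).inter
      (measurableSet_lt measurable_const (measurable_fst.add measurable_snd)))
  have := measureReal_mono (μ := H.prod H) hsub
  rw [measureReal_union, measureReal_union, measureReal_prod_prod, measureReal_prod_prod, hI]
    at this
  · have hp := hpos y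
    have : H.real (Ioi y) = tail H y := rfl
    nlinarith
  · rw [Set.disjoint_left]
    rintro ⟨s, t⟩ h1 h2
    simp only [mem_prod, mem_Ioi, mem_Icc] at h1 h2
    linarith [h1.1, h1.2, h2.1, h2.2]
  · exact measurableSet_Ioi.prod measurableSet_Icc
  · rw [Set.disjoint_left]
    rintro ⟨s, t⟩ h1 h2
    simp only [mem_union, mem_prod, mem_Ioi, mem_Icc, S, mem_ofPred_eq] at h1 h2
    rcases h1 with h1 | h1
    · linarith [h1.1.2, h2.1]
    · linarith [h1.2.2, h2.2.1]
  · exact hS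

theorem heavyTail_of_conv (h0 : H (Iio 0) = 0) (hpos : ∀ y, 0 < tail H y)
    (h2 : Tendsto (fun y => tail (Measure.conv H H) y / tail H y) atTop (𝓝 2)) : HeavyTail H :=
  ⟨hpos, longTailed_of_conv h0 hpos h2, both_large_of_conv h0 hpos h2⟩

end SubexponentialCriteria

/-! ### Convolution estimates for heavy tails -/

section HeavyTailBounds

variable {H : Measure ℝ} [IsProbabilityMeasure H]

theorem HeavyTail.eventually_shift_le (hH : HeavyTail H) (k : ℝ) {r : ℝ} (hr : 1 < r) :
    ∀ᶠ y in atTop, tail H (y - k) ≤ r * tail H y := by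
  filter_upwards [(hH.long k).eventually (gt_mem_nhds hr)] with y hy
  exact ((div_lt_iff₀ (hH.pos y)).1 hy).le

theorem HeavyTail.eventually_le_shift (hH : HeavyTail H) (k : ℝ) {r : ℝ} (hr : r < 1) :
    ∀ᶠ y in atTop, r * tail H y ≤ tail H (y + k) := by
  filter_upwards [(hH.long (-k)).eventually (lt_mem_nhds hr)] with y hy
  rw [sub_neg_eq_add] at hy
  exact ((lt_div_iff₀ (hH.pos y)).1 hy).le

/-- A function that is eventually of order `tail H` and bounded is so on the half-line. -/
theorem HeavyTail.exists_bound (hH : HeavyTail H) {g : ℝ → ℝ} {K : ℝ}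
    (hg1 : ∀ t, g t ≤ K) {C : ℝ} (hg : ∀ᶠ y in atTop, g y ≤ C * tail H y) :
    ∃ C', 0 ≤ C' ∧ ∀ t, 0 ≤ t → g t ≤ C' * tail H t := by
  obtain ⟨y0, hy0⟩ := eventually_atTop.1 hg
  refine ⟨max (max C 0) (max K 0 / tail H y0), le_max_of_le_left (le_max_right _ _), ?_⟩
  intro t _
  rcases le_total y0 t with h | h
  · exact (hy0 t h).trans (mul_le_mul_of_nonneg_right
      (le_max_of_le_left (le_max_left _ _)) (tail_nonneg _ _))
  · calc g t ≤ max K 0 := (hg1 t).trans (le_max_left _ _)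
      _ = max K 0 / tail H y0 * tail H y0 := (div_mul_cancel₀ _ (hH.pos y0).ne').symm
      _ ≤ max K 0 / tail H y0 * tail H t := by
          have := antitone_tail H h
          have := (hH.pos y0).le
          gcongr
      _ ≤ _ := mul_le_mul_of_nonneg_right (le_max_right _ _) (tail_nonneg _ _)

/-- For a fixed second coordinate `t > B` the section of the set is the half-line above `max B (y -
t)`. So only the tail of `Λ` on `[0, ∞)` matters, and Fubini replaces `Λ` by `C` times `H`. -/
theorem prod_both_large_le (Λ : Measure ℝ) [IsFiniteMeasure Λ] {C B y : ℝ} (hC : 0 ≤ C)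
    (hB : 0 ≤ B) (hΛ : ∀ t, 0 ≤ t → Λ.real (Ioi t) ≤ C * tail H t) :
    (Λ.prod H) {p : ℝ × ℝ | B < p.1 ∧ B < p.2 ∧ y < p.1 + p.2} ≤
      ENNReal.ofReal C * (H.prod H) {p : ℝ × ℝ | B < p.1 ∧ B < p.2 ∧ y < p.1 + p.2} := by
  have hS : MeasurableSet {p : ℝ × ℝ | B < p.1 ∧ B < p.2 ∧ y < p.1 + p.2} := by
    refine (measurableSet_lt measurable_const measurable_fst).inter
      ((measurableSet_lt measurable_const measurable_snd).inter
      (measurableSet_lt measurable_const (measurable_fst.add measurable_snd)))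
  rw [Measure.prod_apply_symm hS, Measure.prod_apply_symm hS,
    ← lintegral_const_mul _ (measurable_measure_prodMk_right hS)]
  refine lintegral_mono fun t => ?_
  by_cases ht : B < t
  · have : (fun s => (s, t)) ⁻¹' {p : ℝ × ℝ | B < p.1 ∧ B < p.2 ∧ y < p.1 + p.2} =
        Ioi (max B (y - t)) := by
      ext s
      simp only [mem_preimage, mem_ofPred_eq, mem_Ioi, max_lt_iff]
      constructor
      · rintro ⟨h1, _, h3⟩; exact ⟨h1, by linarith⟩
      · rintro ⟨h1, h3⟩; exact ⟨h1, ht, by linarith⟩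
    simp only [this]
    rw [← ofReal_tail H, ← ENNReal.ofReal_mul hC, ← ofReal_measureReal (μ := Λ)]
    exact ENNReal.ofReal_le_ofReal (hΛ _ (le_max_of_le_left hB))
  · have : (fun s => (s, t)) ⁻¹' {p : ℝ × ℝ | B < p.1 ∧ B < p.2 ∧ y < p.1 + p.2} = ∅ := by
      ext s
      simp only [mem_preimage, mem_ofPred_eq, mem_empty_iff_false, iff_false]
      rintro ⟨_, h2, _⟩; exact ht h2
    simp only [this, measure_empty, zero_le]

/-- The convolution estimate: apart from the contribution of one large summand, the convolution
of two tails of order `tail H` is negligible. -/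
theorem HeavyTail.lintegral_shift_le (hH : HeavyTail H) {ε : ℝ} (hε : 0 < ε) :
    ∃ B, 0 ≤ B ∧ ∃ y₀, ∀ (Λ : Measure ℝ) [IsFiniteMeasure Λ] (f : ℝ → ℝ) (C R : ℝ), 0 ≤ C →
      0 ≤ R → Antitone f → (∀ t, f t ≤ 1) → (∀ t, 0 ≤ t → Λ.real (Ioi t) ≤ C * tail H t) →
      (∀ t, 0 ≤ f t) →
      (∀ t, 0 ≤ t → f t ≤ R * tail H t) → ∀ y, y₀ ≤ y →
      ∫⁻ s, ENNReal.ofReal (f (y - s)) ∂Λ ≤ ENNReal.ofReal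
        (Λ.real (Ioi (y - B)) + Λ.real univ * f (y - B) + ε * C * R * tail H y) := by
  obtain ⟨B, hB, hev⟩ := hH.both ε hε
  obtain ⟨y₀, hy₀⟩ := eventually_atTop.1 hev
  -- `B` and `y₀` depend on `ε` alone. This uniformity permits an induction in which `f` varies and
  -- `R` is chosen after `y₀`.
  refine ⟨B, hB, y₀, ?_⟩
  intro Λ _ f C R hC hR hf hf1 hΛ hf0 hfR y hy
  set S := {p : ℝ × ℝ | B < p.1 ∧ B < p.2 ∧ y < p.1 + p.2} with hSdef
  have hS : MeasurableSet S := by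
    refine (measurableSet_lt measurable_const measurable_fst).inter
      ((measurableSet_lt measurable_const measurable_snd).inter
      (measurableSet_lt measurable_const (measurable_fst.add measurable_snd)))
  -- Three ranges: for `s > y - B` use `f ≤ 1`; for `s ≤ B` use monotonicity; in between `s` and `y
  -- - s` are both at least `B`, and the bound on `f (y - s)` is `R` times the `H`-mass of a
  -- half-line inside the section of `S`.
  have hpt : ∀ s, ENNReal.ofReal (f (y - s)) ≤ (Ioi (y - B)).indicator 1 s +
      (ENNReal.ofReal (f (y - B)) + ENNReal.ofReal R * H (Prod.mk s ⁻¹' S)) := by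
    intro s
    by_cases h1 : y - B < s
    · calc ENNReal.ofReal (f (y - s)) ≤ 1 := by
            rw [← ENNReal.ofReal_one]; exact ENNReal.ofReal_le_ofReal (hf1 _)
        _ = (Ioi (y - B)).indicator 1 s := by simp [indicator, h1]
        _ ≤ _ := le_self_add
    · refine le_trans ?_ le_add_self
      by_cases h2 : s ≤ B
      · exact le_trans (ENNReal.ofReal_le_ofReal (hf (by linarith))) le_self_add
      · refine le_trans ?_ le_add_self
        have : Ioi (y - s) ⊆ Prod.mk s ⁻¹' S := by
          intro t ht
          rw [mem_Ioi] at ht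
          exact ⟨not_le.1 h2, by linarith, by simp only; linarith⟩
        calc ENNReal.ofReal (f (y - s)) ≤ ENNReal.ofReal (R * tail H (y - s)) :=
              ENNReal.ofReal_le_ofReal (hfR _ (by linarith))
          _ = ENNReal.ofReal R * H (Ioi (y - s)) := by rw [ENNReal.ofReal_mul hR, ofReal_tail]
          _ ≤ _ := by gcongr
  have hm : Measurable fun s => H (Prod.mk s ⁻¹' S) := measurable_measure_prodMk_left hS
  calc ∫⁻ s, ENNReal.ofReal (f (y - s)) ∂Λ
      ≤ ∫⁻ s, ((Ioi (y - B)).indicator 1 s +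
      (ENNReal.ofReal (f (y - B)) + ENNReal.ofReal R * H (Prod.mk s ⁻¹' S))) ∂Λ :=
        lintegral_mono hpt
    _ = Λ (Ioi (y - B)) + (ENNReal.ofReal (f (y - B)) * Λ univ +
          ENNReal.ofReal R * (Λ.prod H) S) := by
        rw [lintegral_add_left (measurable_one.indicator measurableSet_Ioi),
          lintegral_indicator_one measurableSet_Ioi, lintegral_add_left measurable_const,
          lintegral_const, lintegral_const_mul _ hm, ← Measure.prod_apply hS]
    _ ≤ Λ (Ioi (y - B)) + (ENNReal.ofReal (f (y - B)) * Λ univ +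
          ENNReal.ofReal R * (ENNReal.ofReal C * ENNReal.ofReal (ε * tail H y))) := by
        gcongr
        refine (prod_both_large_le Λ hC hB hΛ).trans ?_
        gcongr
        rw [← ofReal_measureReal (μ := H.prod H)]
        exact ENNReal.ofReal_le_ofReal (hy₀ y hy)
    _ = _ := by
        have := hf0 (y - B)
        have h3 := tail_nonneg H y
        rw [← ofReal_measureReal (μ := Λ) (s := Ioi (y - B)),
          ← ofReal_measureReal (μ := Λ) (s := univ), ← ENNReal.ofReal_mul hC,
          ← ENNReal.ofReal_mul hR, ← ENNReal.ofReal_mul this, ← ENNReal.ofReal_add,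
          ← ENNReal.ofReal_add]
        · congr 1; ring
        all_goals positivity

end HeavyTailBounds

/-! ### The second tail as a heavy-tailed law -/

section SecondTail

/-- The integrated tail `∫_y^∞ H((t, ∞)) dt`. -/
noncomputable def integratedTail (H : Measure ℝ) (y : ℝ) : ℝ≥0∞ := ∫⁻ t in Ioi y, H (Ioi t)

theorem measurable_measure_Ioi (H : Measure ℝ) : Measurable fun t : ℝ => H (Ioi t) :=
  Antitone.measurable fun _ _ h => measure_mono (Ioi_subset_Ioi h)

/-- Layer cake: both sides are the mass of `{y < t < s}` under `H(ds) ⊗ dt`. -/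
theorem lintegral_ofReal_sub_eq (H : Measure ℝ) [SFinite H] (y : ℝ) :
    ∫⁻ s, ENNReal.ofReal (s - y) ∂H = integratedTail H y := by
  have hS : MeasurableSet {p : ℝ × ℝ | y < p.2 ∧ p.2 < p.1} :=
    (measurableSet_lt measurable_const measurable_snd).inter
      (measurableSet_lt measurable_snd measurable_fst)
  have h1 := Measure.prod_apply (μ := H) (ν := volume) hS
  have h2 := Measure.prod_apply_symm (μ := H) (ν := volume) hS
  rw [h1] at h2
  calc ∫⁻ s, ENNReal.ofReal (s - y) ∂H
      = ∫⁻ s, volume (Prod.mk s ⁻¹' {p : ℝ × ℝ | y < p.2 ∧ p.2 < p.1}) ∂H := by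
        refine lintegral_congr fun s => ?_
        have : Prod.mk s ⁻¹' {p : ℝ × ℝ | y < p.2 ∧ p.2 < p.1} = Ioo y s := by
          ext t; simp
        rw [this, Real.volume_Ioo]
    _ = _ := h2
    _ = integratedTail H y := by
        unfold integratedTail
        rw [← lintegral_indicator measurableSet_Ioi]
        refine lintegral_congr fun t => ?_
        by_cases ht : y < t
        · rw [indicator_of_mem (by exact ht)]
          congr 1
          ext s; simp [ht]
        · rw [indicator_of_notMem (by exact ht)]
          convert measure_empty (μ := H)
          ext s; simp [ht]

theorem integratedTail_lt_top (H : Measure ℝ) [IsFiniteMeasure H]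
    (h : Integrable (fun t : ℝ => t) H) (y : ℝ) : integratedTail H y < ∞ := by
  rw [← lintegral_ofReal_sub_eq]
  exact (h.sub (integrable_const y)).lintegral_lt_top

theorem integratedTail_add (H : Measure ℝ) {x y : ℝ} (h : x ≤ y) :
    integratedTail H x = (∫⁻ t in Ioc x y, H (Ioi t)) + integratedTail H y := by
  unfold integratedTail
  rw [← Ioc_union_Ioi_eq_Ioi h, lintegral_union measurableSet_Ioi]
  rw [Set.disjoint_left]; intro z hz hz'; exact absurd hz.2 (not_le.2 hz')

theorem tendsto_setLIntegral_Ioi_atTop {g : ℝ → ℝ≥0∞} {y₀ : ℝ}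
    (hfin : ∫⁻ t in Ioi y₀, g t < ∞) :
    Tendsto (fun y => ∫⁻ t in Ioi y, g t) atTop (𝓝 0) := by
  have hfin' : (volume.withDensity g) (Ioi y₀) ≠ ∞ := by
    rw [withDensity_apply _ measurableSet_Ioi]; exact hfin.ne
  have h := tendsto_measure_iInter_atTop (μ := volume.withDensity g) (s := fun y : ℝ => Ioi y)
    (fun _ => measurableSet_Ioi.nullMeasurableSet) (fun _ _ h => Ioi_subset_Ioi h) ⟨y₀, hfin'⟩
  have he : (⋂ y : ℝ, Ioi y) = ∅ := by
    ext z
    simp only [mem_iInter, mem_Ioi, mem_empty_iff_false, iff_false, not_forall, not_lt]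
    exact ⟨z, le_rfl⟩
  rw [he, measure_empty] at h
  refine h.congr fun y => ?_
  simp only [Function.comp]
  rw [withDensity_apply _ measurableSet_Ioi]

theorem tendsto_integratedTail (H : Measure ℝ) [IsFiniteMeasure H]
    (h : Integrable (fun t : ℝ => t) H) : Tendsto (integratedTail H) atTop (𝓝 0) :=
  tendsto_setLIntegral_Ioi_atTop (integratedTail_lt_top H h 0)

variable {F : Measure ℝ} [IsProbabilityMeasure F]

theorem secondTail_nonneg (F : Measure ℝ) (y : ℝ) : 0 ≤ secondTail F y := ENNReal.toReal_nonneg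

theorem eventually_ofReal_secondTail (hF : Integrable (fun t : ℝ => t) F) :
    ∀ᶠ y in atTop, ENNReal.ofReal (secondTail F y) = integratedTail F y := by
  filter_upwards [(tendsto_integratedTail F hF).eventually (gt_mem_nhds zero_lt_one)] with y hy
  change ENNReal.ofReal (min 1 (integratedTail F y)).toReal = _
  rw [min_eq_right hy.le, ENNReal.ofReal_toReal (hy.trans ENNReal.one_lt_top).ne]

theorem tendsto_secondTail_atTop (hF : Integrable (fun t : ℝ => t) F) :
    Tendsto (secondTail F) atTop (𝓝 0) := by
  have h := (ENNReal.tendsto_toReal ENNReal.zero_ne_top).comp (tendsto_integratedTail F hF)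
  rw [ENNReal.toReal_zero] at h
  refine h.congr' ?_
  filter_upwards [eventually_ofReal_secondTail hF] with y hy
  simp only [Function.comp]
  rw [← hy, ENNReal.toReal_ofReal]
  exact ENNReal.toReal_nonneg

/-- Left of the origin the tail of `F` equals `1`, so a unit interval there saturates the minimum.
This makes the second-tail distribution function vanish near `-∞`. -/
theorem secondTail_eq_one_of_neg (hF0 : F (Iio 0) = 0) {y : ℝ} (hy : y ≤ -1) :
    secondTail F y = 1 := by
  have h1 : 1 ≤ integratedTail F y := by
    calc (1 : ℝ≥0∞) = volume (Ico (-1 : ℝ) 0) := by rw [Real.volume_Ico]; norm_num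
      _ = ∫⁻ _ in Ico (-1 : ℝ) 0, 1 := by simp
      _ = ∫⁻ _ in Ioo (-1 : ℝ) 0, 1 := by
        simp
      _ ≤ ∫⁻ t in Ioo (-1 : ℝ) 0, F (Ioi t) := by
        refine setLIntegral_mono' measurableSet_Ioo fun t ht => ?_
        have : (Ioi t)ᶜ ⊆ Iio 0 := by
          intro x hx
          simp only [mem_compl_iff, mem_Ioi, not_lt] at hx
          exact lt_of_le_of_lt hx ht.2
        exact ((prob_compl_eq_zero_iff measurableSet_Ioi).1 (measure_mono_null this hF0)).ge
      _ ≤ _ := lintegral_mono_set fun t ht => lt_of_le_of_lt hy ht.1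
  change (min 1 (integratedTail F y)).toReal = 1
  rw [min_eq_left h1, ENNReal.toReal_one]

theorem isProbabilityMeasure_secondTailLaw (hF0 : F (Iio 0) = 0)
    (hF : Integrable (fun t : ℝ => t) F) : IsProbabilityMeasure (secondTailLaw F) := by
  refine StieltjesFunction.isProbabilityMeasure _ ?_ ?_
  · refine tendsto_const_nhds.congr' ?_
    filter_upwards [eventually_le_atBot (-1)] with y hy
    change (0 : ℝ) = 1 - secondTail F y
    rw [secondTail_eq_one_of_neg hF0 hy, sub_self]
  · have := (tendsto_secondTail_atTop hF).const_sub 1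
    rwa [sub_zero] at this

theorem tail_secondTailLaw (hF : Integrable (fun t : ℝ => t) F) (y : ℝ) :
    tail (secondTailLaw F) y = secondTail F y := by
  have h : Tendsto (secondTailDF F) atTop (𝓝 1) := by
    have := (tendsto_secondTail_atTop hF).const_sub 1
    rwa [sub_zero] at this
  unfold tail secondTailLaw
  rw [measureReal_def, StieltjesFunction.measure_Ioi _ h]
  change (ENNReal.ofReal (1 - (1 - secondTail F y))).toReal = _
  rw [sub_sub_cancel, ENNReal.toReal_ofReal]
  exact ENNReal.toReal_nonneg

theorem tail_positivePart (G : Measure ℝ) {y : ℝ} (hy : 0 ≤ y) :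
    tail (positivePart G) y = tail G y := by
  unfold tail positivePart
  rw [map_measureReal_apply (by fun_prop) measurableSet_Ioi]
  congr 1
  ext t
  simp [hy]

theorem positivePart_Iio (G : Measure ℝ) : positivePart G (Iio 0) = 0 := by
  unfold positivePart
  rw [Measure.map_apply (by fun_prop) measurableSet_Iio]
  convert measure_empty (μ := G)
  ext t
  simp

theorem tail_positivePart_pos {G : Measure ℝ} [IsProbabilityMeasure G] (h : ∀ y, 0 < tail G y)
    (y : ℝ) : 0 < tail (positivePart G) y := by
  have : IsProbabilityMeasure (positivePart G) :=
    Measure.isProbabilityMeasure_map (by fun_prop)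
  refine lt_of_lt_of_le (h (max y 0)) ?_
  rw [← tail_positivePart G (le_max_right y 0)]
  exact antitone_tail _ (le_max_left _ _)

/-- A subexponential second tail is the tail of a law on `[0, ∞)` with the `HeavyTail` properties,
and the tail itself is negligible with respect to it. -/
theorem exists_heavyTail (hF0 : F (Iio 0) = 0) (hF : Integrable (fun t : ℝ => t) F)
    (hFs : Subexponential (secondTailLaw F)) :
    ∃ H : Measure ℝ, IsProbabilityMeasure H ∧ HeavyTail H ∧
      (∀ y, 0 ≤ y → tail H y = secondTail F y) ∧ tail F =o[atTop] tail H := by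
  have := isProbabilityMeasure_secondTailLaw hF0 hF
  have hprob : IsProbabilityMeasure (positivePart (secondTailLaw F)) :=
    Measure.isProbabilityMeasure_map (by fun_prop)
  have hH : HeavyTail (positivePart (secondTailLaw F)) :=
    heavyTail_of_conv (positivePart_Iio _) (tail_positivePart_pos hFs.1) hFs.2
  have heq : ∀ y, 0 ≤ y → tail (positivePart (secondTailLaw F)) y = secondTail F y :=
    fun y hy => by rw [tail_positivePart _ hy, tail_secondTailLaw hF]
  refine ⟨positivePart (secondTailLaw F), hprob, hH, heq, ?_⟩
  rw [Asymptotics.isLittleO_iff]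
  intro ε hε
  filter_upwards [hH.eventually_shift_le 1 (by linarith : 1 < 1 + ε), eventually_ge_atTop 1,
    eventually_ofReal_secondTail hF, (tendsto_atTop_add_const_right atTop (-1)
      tendsto_id).eventually (eventually_ofReal_secondTail hF)] with y h1 h2 h3 h4
  simp only [id] at h4
  rw [Real.norm_of_nonneg (tail_nonneg _ _), Real.norm_of_nonneg (tail_nonneg _ _)]
  rw [heq y (by linarith), heq _ (by linarith)] at h1
  rw [heq y (by linarith)]
  -- The interval `(y - 1, y]` contributes at least `tail F y` to the integrated tail. Hence `tail F
  -- y` is at most an increment of the second tail over a unit interval, which long-tailedness makes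
  -- negligible.
  have h5 : ENNReal.ofReal (tail F y) + ENNReal.ofReal (secondTail F y) ≤
      ENNReal.ofReal (secondTail F (y - 1)) := by
    rw [h3, sub_eq_add_neg, h4, integratedTail_add F (by linarith : y + -1 ≤ y), ofReal_tail]
    gcongr
    calc F (Ioi y) = ∫⁻ _ in Ioc (y + -1) y, F (Ioi y) := by
          rw [setLIntegral_const, Real.volume_Ioc]; norm_num
      _ ≤ _ := setLIntegral_mono' measurableSet_Ioc
          fun t ht => measure_mono (Ioi_subset_Ioi ht.2)
  rw [← ENNReal.ofReal_add (tail_nonneg _ _) (secondTail_nonneg _ _),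
    ENNReal.ofReal_le_ofReal_iff (secondTail_nonneg _ _)] at h5
  linarith

end SecondTail

end ModulatedWalk

namespace ModulatedWalk

/-! ### Sums of a monotone function along a progression versus its integral -/

section SumIntegral

variable {g : ℝ → ℝ≥0∞} {h : ℝ}

theorem setLIntegral_Ioi_eq_tsum (g : ℝ → ℝ≥0∞) (hh : 0 < h) (y : ℝ) :
    ∫⁻ t in Ioi y, g t = ∑' n : ℕ, ∫⁻ t in Ioc (y + h * n) (y + h * (n + 1)), g t := by
  have hmono : Monotone fun n : ℕ => y + h * n := by
    intro a b hab
    have : (a : ℝ) ≤ b := by exact_mod_cast hab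
    have := mul_le_mul_of_nonneg_left this hh.le
    simp only
    linarith
  have hU : (⋃ n : ℕ, Ioc (y + h * n) (y + h * (n + 1))) = Ioi y := by
    ext t
    simp only [mem_iUnion, mem_Ioc, mem_Ioi]
    constructor
    · rintro ⟨n, hn, _⟩
      have : 0 ≤ h * n := by positivity
      linarith
    · intro ht
      have hpos : 0 < (t - y) / h := div_pos (by linarith) hh
      obtain ⟨n, hn⟩ : ∃ n : ℕ, ⌈(t - y) / h⌉₊ = n + 1 :=
        Nat.exists_eq_succ_of_ne_zero (Nat.ceil_pos.2 hpos).ne'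
      refine ⟨n, ?_, ?_⟩
      · have : (n : ℝ) < (t - y) / h := Nat.lt_ceil.1 (by omega)
        rw [lt_div_iff₀ hh] at this
        linarith
      · have : (t - y) / h ≤ ((n + 1 : ℕ) : ℝ) := Nat.ceil_le.1 hn.le
        rw [div_le_iff₀ hh] at this
        push_cast at this
        linarith
  rw [← hU, lintegral_iUnion (fun n => measurableSet_Ioc)]
  have := hmono.pairwise_disjoint_on_Ioc_succ
  simpa using this

/-- Comparison with a Riemann sum of mesh `h`. Every big-jump estimate below sums tails at levels `y
+ h n`, one for each cycle `n`; this bound and its converse turn such sums into `1 / h` times an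
integrated tail. -/
theorem tsum_shift_le_setLIntegral (hg : Antitone g) (hh : 0 < h) (y : ℝ) :
    ENNReal.ofReal h * ∑' n : ℕ, g (y + h + h * n) ≤ ∫⁻ t in Ioi y, g t := by
  rw [setLIntegral_Ioi_eq_tsum g hh, ← ENNReal.tsum_mul_left]
  refine ENNReal.tsum_le_tsum fun n => ?_
  calc ENNReal.ofReal h * g (y + h + h * n)
      = ∫⁻ _ in Ioc (y + h * n) (y + h * (n + 1)), g (y + h + h * n) := by
        rw [setLIntegral_const, Real.volume_Ioc, mul_comm]; congr 2; ring
    _ ≤ _ := setLIntegral_mono' measurableSet_Ioc fun t ht => hg (by linarith [ht.2])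

theorem setLIntegral_le_tsum (hg : Antitone g) (hh : 0 < h) (y : ℝ) :
    ∫⁻ t in Ioi y, g t ≤ ENNReal.ofReal h * ∑' n : ℕ, g (y + h * n) := by
  rw [setLIntegral_Ioi_eq_tsum g hh, ← ENNReal.tsum_mul_left]
  refine ENNReal.tsum_le_tsum fun n => ?_
  calc ∫⁻ t in Ioc (y + h * n) (y + h * (n + 1)), g t
      ≤ ∫⁻ _ in Ioc (y + h * n) (y + h * (n + 1)), g (y + h * n) :=
        setLIntegral_mono' measurableSet_Ioc fun t ht => hg (by linarith [ht.1])
    _ = _ := by rw [setLIntegral_const, Real.volume_Ioc, mul_comm]; congr 2; ring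

end SumIntegral

/-! ### Functions of disjoint blocks of an independent family -/

section Independence

variable {Ω ι E α β : Type*} [MeasurableSpace Ω] [MeasurableSpace E] [MeasurableSpace α]
  [MeasurableSpace β] {μ : Measure Ω}

theorem indepFun_restrict_of_disjoint {Z : ι → Ω → E} (hZ : iIndepFun Z μ)
    (hm : ∀ i, Measurable (Z i)) {S T : Set ι} (hST : Disjoint S T) :
    IndepFun (fun ω (i : S) => Z i ω) (fun ω (j : T) => Z j ω) μ := by
  rw [IndepFun_iff_Indep]
  have h := indep_iSup_of_disjoint (fun i => (hm i).comap_le) hZ.iIndep hST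
  refine indep_of_indep_of_le_left (indep_of_indep_of_le_right h ?_) ?_
  · rw [MeasurableSpace.pi, MeasurableSpace.comap_iSup]
    refine iSup_le fun j => ?_
    rw [MeasurableSpace.comap_comp]
    exact le_iSup₂_of_le (f := fun i (_ : i ∈ T) => MeasurableSpace.comap (Z i) _) j.1 j.2 le_rfl
  · rw [MeasurableSpace.pi, MeasurableSpace.comap_iSup]
    refine iSup_le fun j => ?_
    rw [MeasurableSpace.comap_comp]
    exact le_iSup₂_of_le (f := fun i (_ : i ∈ S) => MeasurableSpace.comap (Z i) _) j.1 j.2 le_rfl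

/-- Functions of disjoint blocks of an independent family are independent. -/
theorem indepFun_of_dependsOn [Nonempty E] {Z : ι → Ω → E} (hZ : iIndepFun Z μ)
    (hm : ∀ i, Measurable (Z i)) {S T : Set ι} (hST : Disjoint S T) {g : (ι → E) → α}
    {k : (ι → E) → β} (hg : Measurable g) (hk : Measurable k) (hgS : DependsOn g S)
    (hkT : DependsOn k T) :
    IndepFun (fun ω => g fun i => Z i ω) (fun ω => k fun i => Z i ω) μ := by
  classical
  obtain ⟨e⟩ := ‹Nonempty E›
  let ext (S : Set ι) (x : S → E) (i : ι) : E := if h : i ∈ S then x ⟨i, h⟩ else e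
  have hext : ∀ S, Measurable (ext S) := by
    intro S
    refine measurable_pi_iff.2 fun i => ?_
    by_cases h : i ∈ S
    · simpa only [ext, h, dite_true] using measurable_pi_apply _
    · simpa only [ext, h, dite_false] using measurable_const
  have h := (indepFun_restrict_of_disjoint hZ hm hST).comp (hg.comp (hext S)) (hk.comp (hext T))
  convert h using 1
  · ext ω
    exact hgS fun i hi => by simp [ext, hi]
  · ext ω
    exact hkT fun i hi => by simp [ext, hi]

end Independence

/-! ### Consequences of the strong law of large numbers -/

section StrongLaw

variable {Ω : Type*} [MeasurableSpace Ω] {μ : Measure Ω} [IsProbabilityMeasure μ]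

/-- The last term is the difference of two consecutive partial sums, and the two corresponding
averages have the same limit. -/
theorem tendsto_div_of_tendsto_avg {v : ℕ → ℝ} {c : ℝ}
    (h : Tendsto (fun n : ℕ => (∑ i ∈ Finset.range n, v i) / n) atTop (𝓝 c)) :
    Tendsto (fun n : ℕ => v n / n) atTop (𝓝 0) := by
  have h1 := h.comp (tendsto_add_atTop_nat 1)
  have h2 : Tendsto (fun n : ℕ => ((n : ℝ) + 1) / n) atTop (𝓝 1) := by
    have : Tendsto (fun n : ℕ => 1 + 1 / (n : ℝ)) atTop (𝓝 (1 + 0)) :=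
      tendsto_const_nhds.add tendsto_one_div_atTop_nhds_zero_nat
    rw [add_zero] at this
    refine this.congr' ?_
    filter_upwards [eventually_gt_atTop 0] with n hn
    have : (n : ℝ) ≠ 0 := by positivity
    field_simp
  have h3 := (h1.mul h2).sub h
  rw [mul_one, sub_self] at h3
  refine h3.congr' ?_
  filter_upwards [eventually_gt_atTop 0] with n hn
  have : (n : ℝ) ≠ 0 := by positivity
  have : (n : ℝ) + 1 ≠ 0 := by positivity
  simp only [Function.comp, Finset.sum_range_succ]
  push_cast
  field_simp
  ring

/-- Divided by `n`, the expression tends to `E ψ + h < 0`, because `V n / n` tends to `0`. It is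
therefore eventually nonpositive, hence bounded above. -/
theorem ae_exists_peak_bound {ψ V : ℕ → Ω → ℝ} (hψ : Integrable (ψ 0) μ) (hV : Integrable (V 0) μ)
    (hψi : Pairwise fun i j => IndepFun (ψ i) (ψ j) μ)
    (hVi : Pairwise fun i j => IndepFun (V i) (V j) μ)
    (hψd : ∀ i, IdentDistrib (ψ i) (ψ 0) μ μ) (hVd : ∀ i, IdentDistrib (V i) (V 0) μ μ)
    {h : ℝ} (hh : h < -∫ ω, ψ 0 ω ∂μ) :
    ∀ᵐ ω ∂μ, ∃ A : ℕ, ∀ n : ℕ, (∑ i ∈ Finset.range n, ψ i ω) + V n ω + h * n ≤ A := by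
  filter_upwards [strong_law_ae_real ψ hψ hψi hψd, strong_law_ae_real V hV hVi hVd] with ω h1 h2
  have h3 := (h1.add (tendsto_div_of_tendsto_avg h2)).add_const h
  have h4 : ∀ᶠ n : ℕ in atTop, (∑ i ∈ Finset.range n, ψ i ω) + V n ω + h * n ≤ 0 := by
    filter_upwards [h3.eventually (gt_mem_nhds (by linarith : μ[ψ 0] + 0 + h < 0)),
      eventually_gt_atTop 0] with n hn hn0
    have hn1 : (0 : ℝ) < n := by positivity
    have : (∑ i ∈ Finset.range n, ψ i ω) + V n ω + h * n =
      ((∑ i ∈ Finset.range n, ψ i ω) / n + V n ω / n + h) * n := by field_simp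
    rw [this]
    exact mul_nonpos_of_nonpos_of_nonneg hn.le hn1.le
  have hb : BddAbove (range fun n : ℕ => (∑ i ∈ Finset.range n, ψ i ω) + V n ω + h * n) :=
    (isBoundedUnder_of_eventually_le h4).bddAbove_range
  obtain ⟨b, hb⟩ := hb
  obtain ⟨A, hA⟩ := exists_nat_ge b
  exact ⟨A, fun n => (hb ⟨n, rfl⟩).trans hA⟩

theorem ae_exists_walk_lower_bound {ψ : ℕ → Ω → ℝ} (hψ : Integrable (ψ 0) μ)
    (hψi : Pairwise fun i j => IndepFun (ψ i) (ψ j) μ)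
    (hψd : ∀ i, IdentDistrib (ψ i) (ψ 0) μ μ) {h : ℝ} (hh : -∫ ω, ψ 0 ω ∂μ < h) :
    ∀ᵐ ω ∂μ, ∃ A : ℕ, ∀ n : ℕ, -(A : ℝ) ≤ (∑ i ∈ Finset.range n, ψ i ω) + h * n := by
  have h0 : ∀ᵐ ω ∂μ, ∃ A : ℕ, ∀ n : ℕ,
      (∑ i ∈ Finset.range n, (-ψ i ω)) + 0 + (-h) * n ≤ A := by
    refine ae_exists_peak_bound (ψ := fun i ω => -ψ i ω) (V := fun _ _ => 0) hψ.neg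
      (integrable_const _) ?_ ?_ ?_ ?_ ?_
    · exact fun i j hij => (hψi hij).comp measurable_neg measurable_neg
    · exact fun i j _ => indepFun_const_left _ _
    · exact fun i => (hψd i).comp measurable_neg
    · exact fun i => IdentDistrib.refl aemeasurable_const
    · rw [integral_neg]; linarith
  filter_upwards [h0] with ω ⟨A, hA⟩
  refine ⟨A, fun n => ?_⟩
  have := hA n
  rw [Finset.sum_neg_distrib] at this
  linarith

/-- If almost surely some level of an increasing family of events is reached, then the probability
of not having reached the level `A` tends to `0`. -/
theorem tendsto_measure_compl_of_ae_exists {G : ℕ → Set Ω} (hG : ∀ A, MeasurableSet (G A))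
    (hmono : Monotone G) (h : ∀ᵐ ω ∂μ, ∃ A, ω ∈ G A) :
    Tendsto (fun A => μ.real (G A)ᶜ) atTop (𝓝 0) := by
  have h1 := tendsto_measure_iInter_atTop (μ := μ) (s := fun A => (G A)ᶜ)
    (fun A => (hG A).compl.nullMeasurableSet) (fun _ _ h => compl_subset_compl.2 (hmono h))
    ⟨0, measure_ne_top _ _⟩
  have h2 : μ (⋂ A, (G A)ᶜ) = 0 := by
    rw [← compl_iUnion]
    refine measure_mono_null ?_ (ae_iff.1 h)
    intro ω hω
    simpa using hω
  rw [h2] at h1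
  have := (ENNReal.tendsto_toReal ENNReal.zero_ne_top).comp h1
  rwa [ENNReal.toReal_zero] at this

end StrongLaw

end ModulatedWalk

namespace ModulatedWalk

/-! ### The maximum of a random walk of cycles

An element `z` of `ℕ → ℝ × ℝ` lists the increments `(z n).1` of a walk over consecutive cycles,
and the maxima `(z n).2` of the walk within these cycles. -/

/-- The highest point of the walk within cycle `n`. -/
def peak (z : ℕ → ℝ × ℝ) (n : ℕ) : ℝ := (∑ i ∈ Finset.range n, (z i).1) + (z n).2

/-- The event that the walk exceeds `y` within the first `N` cycles. -/
def exceedBefore (N : ℕ) (y : ℝ) : Set (ℕ → ℝ × ℝ) := {z | y < 0 ∨ ∃ n < N, y < peak z n}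

/-- The event that the walk ever exceeds `y`. -/
def exceed (y : ℝ) : Set (ℕ → ℝ × ℝ) := {z | y < 0 ∨ ∃ n, y < peak z n}

/-- The event that the line `A - h n` is crossed for the first time in cycle `n`. -/
def firstCross (A h : ℝ) (n : ℕ) : Set (ℕ → ℝ × ℝ) :=
  {z | A - h * n < peak z n ∧ ∀ k < n, peak z k ≤ A - h * k}

theorem measurable_peak (n : ℕ) : Measurable fun z : ℕ → ℝ × ℝ => peak z n := by
  unfold peak
  fun_prop

theorem exceedBefore_eq (N : ℕ) (y : ℝ) :
    exceedBefore N y = {_z | y < 0} ∪ ⋃ n ∈ Finset.range N, {z | y < peak z n} := by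
  ext z; simp [exceedBefore]

theorem measurableSet_exceedBefore (N : ℕ) (y : ℝ) : MeasurableSet (exceedBefore N y) := by
  rw [exceedBefore_eq]
  exact (MeasurableSet.const _).union (Finset.measurableSet_biUnion _ fun n _ =>
    measurableSet_lt measurable_const (measurable_peak n))

theorem exceed_eq_iUnion (y : ℝ) : exceed y = ⋃ N, exceedBefore N y := by
  ext z
  simp only [exceed, exceedBefore, mem_ofPred_eq, mem_iUnion]
  constructor
  · rintro (h | ⟨n, hn⟩)
    · exact ⟨0, Or.inl h⟩
    · exact ⟨n + 1, Or.inr ⟨n, Nat.lt_succ_self n, hn⟩⟩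
  · rintro ⟨N, h | ⟨n, _, hn⟩⟩
    · exact Or.inl h
    · exact Or.inr ⟨n, hn⟩

theorem measurableSet_exceed (y : ℝ) : MeasurableSet (exceed y) := by
  rw [exceed_eq_iUnion]
  exact MeasurableSet.iUnion fun N => measurableSet_exceedBefore N y

theorem monotone_exceedBefore (y : ℝ) : Monotone fun N => exceedBefore N y := by
  rintro a b hab z (h | ⟨n, hn, h⟩)
  · exact Or.inl h
  · exact Or.inr ⟨n, hn.trans_le hab, h⟩

theorem antitone_exceedBefore (N : ℕ) : Antitone (exceedBefore N) := by
  rintro a b hab z (h | ⟨n, hn, h⟩)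
  · exact Or.inl (hab.trans_lt h)
  · exact Or.inr ⟨n, hn, hab.trans_lt h⟩

theorem antitone_exceed : Antitone exceed := by
  rintro a b hab z (h | ⟨n, h⟩)
  · exact Or.inl (hab.trans_lt h)
  · exact Or.inr ⟨n, hab.trans_lt h⟩

theorem measurableSet_firstCross (A h : ℝ) (n : ℕ) : MeasurableSet (firstCross A h n) := by
  have : firstCross A h n = {z | A - h * n < peak z n} ∩
      ⋂ k ∈ Finset.range n, {z | peak z k ≤ A - h * k} := by
    ext z; simp [firstCross]
  rw [this]
  exact (measurableSet_lt measurable_const (measurable_peak n)).inter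
    (Finset.measurableSet_biInter _ fun k _ => measurableSet_le (measurable_peak k)
      measurable_const)

theorem dependsOn_peak (n : ℕ) : DependsOn (fun z : ℕ → ℝ × ℝ => peak z n) (Iio (n + 1)) := by
  intro x y hxy
  simp only [peak]
  rw [hxy n (by simp)]
  congr 1
  refine Finset.sum_congr rfl fun i hi => ?_
  rw [hxy i (by simp at hi ⊢; omega)]

theorem firstCross_congr {A h : ℝ} {n : ℕ} {x y : ℕ → ℝ × ℝ}
    (hxy : ∀ i ∈ Iio (n + 1), x i = y i) : x ∈ firstCross A h n ↔ y ∈ firstCross A h n := by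
  have hp : ∀ k ≤ n, peak x k = peak y k := fun k hk =>
    dependsOn_peak k fun i hi => hxy i (by simp at hi ⊢; omega)
  simp only [firstCross, mem_ofPred_eq, hp n le_rfl]
  refine and_congr_right fun _ => forall₂_congr fun k hk => ?_
  rw [hp k hk.le]

theorem pairwise_disjoint_firstCross (A h : ℝ) :
    Pairwise fun m n => Disjoint (firstCross A h m) (firstCross A h n) := by
  intro m n hmn
  rw [Set.disjoint_left]
  rintro z ⟨h1, h2⟩ ⟨h3, h4⟩
  rcases lt_or_gt_of_ne hmn with hlt | hlt
  · exact absurd h1 (not_lt.2 (h4 m hlt))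
  · exact absurd h3 (not_lt.2 (h2 n hlt))

/-! ### First crossing of a line and the renewal inequality -/

section Renewal

variable (ρ : Measure (ℝ × ℝ)) [IsProbabilityMeasure ρ]

/-- The law of the sequence of cycles. -/
noncomputable def seqLaw : Measure (ℕ → ℝ × ℝ) := Measure.infinitePi fun _ => ρ

instance : IsProbabilityMeasure (seqLaw ρ) := by unfold seqLaw; infer_instance

theorem seqLaw_map_shift (n : ℕ) :
    (seqLaw ρ).map (fun z j => z (n + j)) = seqLaw ρ :=
  Measure.map_infinitePi_infinitePi_of_inj (P := fun _ => ρ) (add_right_injective n)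

theorem iIndepFun_seqLaw : iIndepFun (fun i (z : ℕ → ℝ × ℝ) => z i) (seqLaw ρ) :=
  iIndepFun_infinitePi (X := fun _ x => x) (fun _ => measurable_id)

/-- The law of the height at which the line `A - h n` is first crossed. -/
noncomputable def crossLaw (A h : ℝ) : Measure ℝ :=
  Measure.sum fun n => ((seqLaw ρ).restrict (firstCross A h n)).map fun z => peak z n

/-- The first crossing in cycle `n` and the peak there depend on the cycles up to `n` only. The
later cycles are independent of them and form a fresh copy of the whole sequence. -/
theorem lintegral_firstCross_shift (A h : ℝ) (n N : ℕ) (y : ℝ) :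
    seqLaw ρ (firstCross A h n ∩ {z | (fun j => z (n + 1 + j)) ∈ exceedBefore N (y - peak z n)}) =
      ∫⁻ z in firstCross A h n, seqLaw ρ (exceedBefore N (y - peak z n)) ∂(seqLaw ρ) := by
  classical
  -- The indicator of the crossing is carried as a second coordinate, so that a single use of
  -- independence treats both the event and the peak.
  let g : (ℕ → ℝ × ℝ) → ℝ × ℝ := fun z =>
    (peak z n, (firstCross A h n).indicator (fun _ => (1 : ℝ)) z)
  let k : (ℕ → ℝ × ℝ) → (ℕ → ℝ × ℝ) := fun z j => z (n + 1 + j)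
  have hg : Measurable g := (measurable_peak n).prodMk
    (measurable_const.indicator (measurableSet_firstCross A h n))
  have hk : Measurable k := by fun_prop
  have hgd : DependsOn g (Iio (n + 1)) := by
    intro x y hxy
    simp only [g, Prod.mk.injEq]
    refine ⟨dependsOn_peak n hxy, ?_⟩
    simp only [indicator, firstCross_congr hxy]
  have hkd : DependsOn k (Ici (n + 1)) := by
    intro x y hxy
    ext1 j
    exact hxy _ (by simp)
  have hind := indepFun_of_dependsOn (iIndepFun_seqLaw ρ) (fun i => measurable_pi_apply i)
    (S := Iio (n + 1)) (T := Ici (n + 1)) (by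
      rw [Set.disjoint_left]; intro i hi hi'; simp at hi hi'; omega) hg hk hgd hkd
  have hmap := (indepFun_iff_map_prod_eq_prod_map_map hg.aemeasurable hk.aemeasurable).1 hind
  rw [show (seqLaw ρ).map k = seqLaw ρ from seqLaw_map_shift ρ (n + 1)] at hmap
  let W : Set ((ℝ × ℝ) × (ℕ → ℝ × ℝ)) := {w | w.1.2 = 1 ∧
    (y - w.1.1 < 0 ∨ ∃ j < N, y - w.1.1 < peak w.2 j)}
  have hW : MeasurableSet W := by
    have m1 : Measurable fun w : (ℝ × ℝ) × (ℕ → ℝ × ℝ) => w.1.2 := by fun_prop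
    have m2 : Measurable fun w : (ℝ × ℝ) × (ℕ → ℝ × ℝ) => y - w.1.1 := by fun_prop
    have hE : MeasurableSet {w : (ℝ × ℝ) × (ℕ → ℝ × ℝ) | ∃ j < N, y - w.1.1 < peak w.2 j} := by
      have : {w : (ℝ × ℝ) × (ℕ → ℝ × ℝ) | ∃ j < N, y - w.1.1 < peak w.2 j} =
          ⋃ j ∈ Finset.range N, {w | y - w.1.1 < peak w.2 j} := by ext; simp
      rw [this]
      exact Finset.measurableSet_biUnion _ fun j _ =>
        measurableSet_lt m2 ((measurable_peak j).comp measurable_snd)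
    exact (measurableSet_eq_fun m1 measurable_const).inter
      ((measurableSet_lt m2 measurable_const).union hE)
  have h1 : firstCross A h n ∩ {z | (fun j => z (n + 1 + j)) ∈ exceedBefore N (y - peak z n)} =
      (fun z => (g z, k z)) ⁻¹' W := by
    ext z
    simp [W, g, k, exceedBefore, indicator]
    tauto
  rw [h1, ← Measure.map_apply (hg.prodMk hk) hW]
  rw [hmap, Measure.prod_apply hW, lintegral_map (measurable_measure_prodMk_left hW) hg,
    ← lintegral_indicator (measurableSet_firstCross A h n)]
  refine lintegral_congr fun z => ?_
  by_cases hz : z ∈ firstCross A h n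
  · rw [indicator_of_mem hz]
    congr 1
    ext w
    simp [W, g, hz, exceedBefore]
  · rw [indicator_of_notMem hz]
    convert measure_empty (μ := seqLaw ρ)
    ext w
    simp [W, g, hz]

theorem measurable_exceedBefore_shift (N : ℕ) :
    Measurable fun y => seqLaw ρ (exceedBefore N y) :=
  Antitone.measurable fun _ _ h => measure_mono (antitone_exceedBefore N h)

variable {ρ}

theorem psum_succ_le_peak {z : ℕ → ℝ × ℝ} (hz : ∀ n, 0 ≤ (z n).2 ∧ (z n).1 ≤ (z n).2) (n : ℕ) :
    ∑ i ∈ Finset.range (n + 1), (z i).1 ≤ peak z n := by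
  rw [Finset.sum_range_succ]
  exact add_le_add le_rfl (hz n).2

theorem ae_seqLaw (hρ : ∀ᵐ p ∂ρ, 0 ≤ p.2 ∧ p.1 ≤ p.2) :
    ∀ᵐ z ∂(seqLaw ρ), ∀ n, 0 ≤ (z n).2 ∧ (z n).1 ≤ (z n).2 := by
  rw [ae_all_iff]
  intro n
  exact (measurePreserving_eval_infinitePi (fun _ : ℕ => ρ) n).quasiMeasurePreserving.ae hρ

/-- The renewal inequality: to exceed a level above `A`, the walk has to cross the line `A - h n`,
and it restarts after the cycle in which it does so for the first time. -/
theorem exceedBefore_le_lintegral (hρ : ∀ᵐ p ∂ρ, 0 ≤ p.2 ∧ p.1 ≤ p.2) {A h : ℝ} (hA : 0 ≤ A)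
    (hh : 0 ≤ h) {y : ℝ} (hy : A ≤ y) (N : ℕ) :
    seqLaw ρ (exceedBefore (N + 1) y) ≤
      ∫⁻ s, seqLaw ρ (exceedBefore N (y - s)) ∂(crossLaw ρ A h) := by
  have hsub : ∀ᵐ z ∂(seqLaw ρ), z ∈ exceedBefore (N + 1) y → z ∈ ⋃ n, firstCross A h n ∩
      {z | (fun j => z (n + 1 + j)) ∈ exceedBefore N (y - peak z n)} := by
    filter_upwards [ae_seqLaw hρ] with z hz hzy
    rcases hzy with h0 | ⟨m, hm, hmy⟩
    · linarith
    have hex : ∃ n, A - h * n < peak z n := ⟨m, by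
      have : 0 ≤ h * (m : ℝ) := by positivity
      linarith⟩
    classical
    have hspec := Nat.find_spec hex
    have hmin : ∀ k < Nat.find hex, peak z k ≤ A - h * k := fun k hk =>
      not_lt.1 (Nat.find_min hex hk)
    have hle : Nat.find hex ≤ m := Nat.find_min' hex (by
      have : 0 ≤ h * (m : ℝ) := by positivity
      linarith)
    set n := Nat.find hex
    refine mem_iUnion.2 ⟨n, ⟨hspec, hmin⟩, ?_⟩
    rcases hle.eq_or_lt with heq | hlt
    -- If the crossing peak itself is above `y`, the residual level is negative, and the clause `y <
    -- 0` of `exceedBefore` applies.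
    · exact Or.inl (by rw [heq]; linarith)
    -- After cycle `n` the walk starts from a height not above the peak of that cycle, so restarting
    -- from the peak only makes the level easier to exceed. Cycle `m` becomes cycle `m - (n + 1) <
    -- N` of the restarted walk.
    · refine Or.inr ⟨m - (n + 1), by omega, ?_⟩
      have hs := psum_succ_le_peak hz n
      have : peak (fun j => z (n + 1 + j)) (m - (n + 1)) =
          peak z m - ∑ i ∈ Finset.range (n + 1), (z i).1 := by
        simp only [peak]
        rw [show n + 1 + (m - (n + 1)) = m by omega]
        have := Finset.sum_range_add (fun i => (z i).1) (n + 1) (m - (n + 1))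
        rw [show n + 1 + (m - (n + 1)) = m by omega] at this
        linarith
      rw [this]
      linarith
  calc seqLaw ρ (exceedBefore (N + 1) y) ≤ seqLaw ρ (⋃ n, firstCross A h n ∩
      {z | (fun j => z (n + 1 + j)) ∈ exceedBefore N (y - peak z n)}) := measure_mono_ae hsub
    _ ≤ ∑' n, seqLaw ρ (firstCross A h n ∩
      {z | (fun j => z (n + 1 + j)) ∈ exceedBefore N (y - peak z n)}) := measure_iUnion_le _
    _ = _ := by
      unfold crossLaw
      rw [lintegral_sum_measure]
      refine tsum_congr fun n => ?_
      have hm : Measurable fun s => seqLaw ρ (exceedBefore N (y - s)) :=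
        (measurable_exceedBefore_shift ρ N).comp (measurable_const.sub measurable_id)
      rw [lintegral_firstCross_shift, lintegral_map hm (measurable_peak n)]

/-- The integrated tail of the maximum within a cycle. -/
noncomputable def peakTail (ρ : Measure (ℝ × ℝ)) (y : ℝ) : ℝ≥0∞ := integratedTail (ρ.map Prod.snd) y

theorem crossLaw_univ (A h : ℝ) :
    crossLaw ρ A h univ = seqLaw ρ (⋃ n, firstCross A h n) := by
  unfold crossLaw
  rw [Measure.sum_apply _ MeasurableSet.univ,
    measure_iUnion (pairwise_disjoint_firstCross A h) (measurableSet_firstCross A h)]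
  refine tsum_congr fun n => ?_
  rw [Measure.map_apply (measurable_peak n) MeasurableSet.univ, preimage_univ,
    Measure.restrict_apply_univ]

instance (A h : ℝ) : IsFiniteMeasure (crossLaw ρ A h) :=
  ⟨by rw [crossLaw_univ]; exact measure_lt_top _ _⟩

/-- If the line is not crossed before cycle `n`, the walk enters this cycle at a height at most `A +
h - h n`. Reaching `t` then requires a maximum within the cycle above `t - A - h + h n`, and summing
over `n` gives the integrated tail. -/
theorem crossLaw_Ioi_le (hρ : ∀ᵐ p ∂ρ, 0 ≤ p.2 ∧ p.1 ≤ p.2) {A h : ℝ} (hA : 0 ≤ A)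
    (hh : 0 < h) (t : ℝ) :
    ENNReal.ofReal h * crossLaw ρ A h (Ioi t) ≤ peakTail ρ (t - A - 2 * h) := by
  have h1 : ∀ n : ℕ, (((seqLaw ρ).restrict (firstCross A h n)).map fun z => peak z n) (Ioi t) ≤
      (ρ.map Prod.snd) (Ioi (t - A - 2 * h + h + h * n)) := by
    intro n
    have hsnd : ρ.map Prod.snd = (seqLaw ρ).map fun z => (z n).2 := by
      rw [← Function.comp_def Prod.snd fun z : ℕ → ℝ × ℝ => z n,
        ← Measure.map_map measurable_snd (measurable_pi_apply n)]
      congr 1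
      exact (measurePreserving_eval_infinitePi (fun _ : ℕ => ρ) n).map_eq.symm
    rw [Measure.map_apply (measurable_peak n) measurableSet_Ioi,
      Measure.restrict_apply (measurable_peak n measurableSet_Ioi), hsnd,
      Measure.map_apply (measurable_pi_apply n).snd measurableSet_Ioi]
    refine measure_mono_ae ?_
    filter_upwards [ae_seqLaw hρ] with z hz hzt
    obtain ⟨h2, h3, h4⟩ := hzt
    simp only [mem_preimage, mem_Ioi] at h2
    change t - A - 2 * h + h + h * n < (z n).2
    have h5 : ∑ i ∈ Finset.range n, (z i).1 ≤ A + h - h * n := by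
      rcases n with _ | n
      · simp; linarith
      · have := (psum_succ_le_peak hz n).trans (h4 n (Nat.lt_succ_self n))
        push_cast
        linarith
    unfold peak at h2
    linarith
  unfold crossLaw
  rw [Measure.sum_apply _ measurableSet_Ioi]
  calc _ ≤ ENNReal.ofReal h * ∑' n : ℕ, (ρ.map Prod.snd) (Ioi (t - A - 2 * h + h + h * n)) := by
        exact mul_le_mul_right (ENNReal.tsum_le_tsum h1) _
    _ ≤ _ := tsum_shift_le_setLIntegral (g := fun s => (ρ.map Prod.snd) (Ioi s))
        (fun _ _ h => measure_mono (Ioi_subset_Ioi h)) hh _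

/-- The total mass is the probability of ever crossing the line. As `h` is below the mean loss per
cycle, almost surely the peaks stay under some line `A - h n`, so a large `A` makes the mass small.
-/
theorem exists_crossLaw_univ_le (hψ : Integrable (fun p : ℝ × ℝ => p.1) ρ)
    (hV : Integrable (fun p : ℝ × ℝ => p.2) ρ) {h : ℝ} (hh : h < -∫ p, p.1 ∂ρ) {δ : ℝ}
    (hδ : 0 < δ) : ∃ A, 0 ≤ A ∧ (crossLaw ρ A h).real univ ≤ δ := by
  have hmp := fun n => measurePreserving_eval_infinitePi (fun _ : ℕ => ρ) n
  have hid : ∀ n, IdentDistrib (fun z : ℕ → ℝ × ℝ => z n) (fun z => z 0) (seqLaw ρ) (seqLaw ρ) :=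
    fun n => ⟨(measurable_pi_apply n).aemeasurable, (measurable_pi_apply 0).aemeasurable, by
      rw [show (fun z : ℕ → ℝ × ℝ => z n) = Function.eval n from rfl,
        show (fun z : ℕ → ℝ × ℝ => z 0) = Function.eval 0 from rfl, seqLaw, (hmp n).map_eq,
        (hmp 0).map_eq]⟩
  have hint : ∫ z, (z 0).1 ∂(seqLaw ρ) = ∫ p, p.1 ∂ρ := by
    calc ∫ z, (z 0).1 ∂(seqLaw ρ) = ∫ p, p.1 ∂((seqLaw ρ).map (Function.eval 0)) := by
          rw [integral_map (measurable_pi_apply 0).aemeasurable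
            measurable_fst.aestronglyMeasurable]
      _ = _ := by congr 1; exact (hmp 0).map_eq
  have hae := ae_exists_peak_bound (μ := seqLaw ρ) (ψ := fun n z => (z n).1)
    (V := fun n z => (z n).2) (h := h)
    ((hmp 0).integrable_comp_of_integrable hψ) ((hmp 0).integrable_comp_of_integrable hV)
    (fun i j hij => ((iIndepFun_seqLaw ρ).indepFun hij).comp measurable_fst measurable_fst)
    (fun i j hij => ((iIndepFun_seqLaw ρ).indepFun hij).comp measurable_snd measurable_snd)
    (fun n => (hid n).comp measurable_fst) (fun n => (hid n).comp measurable_snd)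
    (by rw [hint]; exact hh)
  have ht := tendsto_measure_compl_of_ae_exists (μ := seqLaw ρ)
    (G := fun A : ℕ => {z | ∀ n : ℕ, peak z n + h * n ≤ A}) (fun A => by
      have : {z : ℕ → ℝ × ℝ | ∀ n : ℕ, peak z n + h * n ≤ A} =
        ⋂ n : ℕ, {z | peak z n + h * n ≤ A} := by ext; simp
      rw [this]
      exact MeasurableSet.iInter fun n => measurableSet_le
        ((measurable_peak n).add_const _) measurable_const)
    (fun a b hab z hz n => (hz n).trans (by exact_mod_cast hab)) hae
  obtain ⟨A, hA⟩ := (ht.eventually (gt_mem_nhds hδ)).exists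
  refine ⟨A, Nat.cast_nonneg A, le_trans ?_ hA.le⟩
  rw [measureReal_def, crossLaw_univ]
  refine ENNReal.toReal_mono (measure_ne_top _ _) (measure_mono ?_)
  rintro z hz hz'
  obtain ⟨n, hn, _⟩ := mem_iUnion.1 hz
  have := hz' n
  linarith

end Renewal

end ModulatedWalk

namespace ModulatedWalk

/-! ### Upper bounds for the maximum of a walk of cycles -/

section MaximumBound

variable {ρ : Measure (ℝ × ℝ)} [IsProbabilityMeasure ρ] {H : Measure ℝ} [IsProbabilityMeasure H]

theorem peakTail_lt_top (hV : Integrable (fun p : ℝ × ℝ => p.2) ρ) (y : ℝ) :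
    peakTail ρ y < ∞ := by
  have : IsProbabilityMeasure (ρ.map Prod.snd) := Measure.isProbabilityMeasure_map (by fun_prop)
  refine integratedTail_lt_top _ ?_ y
  rw [integrable_map_measure (by fun_prop) (by fun_prop)]
  exact hV

theorem crossLaw_real_Ioi_le (hρ : ∀ᵐ p ∂ρ, 0 ≤ p.2 ∧ p.1 ≤ p.2)
    (hV : Integrable (fun p : ℝ × ℝ => p.2) ρ) {A h : ℝ} (hA : 0 ≤ A) (hh : 0 < h) (t : ℝ) :
    (crossLaw ρ A h).real (Ioi t) ≤ h⁻¹ * (peakTail ρ (t - A - 2 * h)).toReal := by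
  have h1 := ENNReal.toReal_mono (peakTail_lt_top hV _).ne (crossLaw_Ioi_le hρ hA hh t)
  rw [ENNReal.toReal_mul, ENNReal.toReal_ofReal hh.le] at h1
  rw [← div_eq_inv_mul, le_div_iff₀ hh, mul_comm]
  exact h1

theorem exists_crossLaw_bound (hH : HeavyTail H) (hρ : ∀ᵐ p ∂ρ, 0 ≤ p.2 ∧ p.1 ≤ p.2)
    (hV : Integrable (fun p : ℝ × ℝ => p.2) ρ) {C : ℝ}
    (hC : ∀ᶠ y in atTop, (peakTail ρ y).toReal ≤ C * tail H y) {A h : ℝ} (hA : 0 ≤ A)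
    (hh : 0 < h) :
    ∃ C', 0 ≤ C' ∧ ∀ t, 0 ≤ t → (crossLaw ρ A h).real (Ioi t) ≤ C' * tail H t := by
  refine hH.exists_bound (K := (crossLaw ρ A h).real univ)
    (fun t => measureReal_mono (subset_univ _)) (C := h⁻¹ * (max C 0 * 2)) ?_
  filter_upwards [(tendsto_atTop_add_const_right atTop (-(A + 2 * h)) tendsto_id).eventually hC,
    hH.eventually_shift_le (A + 2 * h) one_lt_two] with y h1 h2
  simp only [id] at h1
  refine (crossLaw_real_Ioi_le hρ hV hA hh y).trans ?_
  rw [mul_assoc, mul_assoc]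
  refine mul_le_mul_of_nonneg_left ?_ (by positivity)
  rw [show y - A - 2 * h = y + -(A + 2 * h) by ring]
  refine h1.trans ?_
  rw [← sub_eq_add_neg]
  have h3 := tail_nonneg H (y - (A + 2 * h))
  exact (mul_le_mul_of_nonneg_right (le_max_left C 0) h3).trans
    (mul_le_mul_of_nonneg_left h2 (le_max_right _ _))

theorem exceedBefore_zero_of_nonneg {y : ℝ} (hy : 0 ≤ y) : exceedBefore 0 y = ∅ := by
  ext z
  simp [exceedBefore, hy]

theorem tendsto_exceedBefore (y : ℝ) :
    Tendsto (fun N => (seqLaw ρ).real (exceedBefore N y)) atTop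
      (𝓝 ((seqLaw ρ).real (exceed y))) := by
  rw [exceed_eq_iUnion]
  exact (ENNReal.tendsto_toReal (measure_ne_top _ _)).comp
    (tendsto_measure_iUnion_atTop (monotone_exceedBefore y))

theorem ofReal_seqLaw_real (s : Set (ℕ → ℝ × ℝ)) :
    ENNReal.ofReal ((seqLaw ρ).real s) = seqLaw ρ s := ofReal_measureReal

/-- The constant comes from an induction on the number of cycles in the renewal inequality, with the
same `R` throughout. One step returns at most `1/2 + 1/4 + 1/4` of `R tail H t`: from the tail of
`crossLaw`, from its mass `1/8` against a tail doubled by the shift, and from the convolution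
remainder. -/
theorem exists_exceed_bound (hH : HeavyTail H) (hρ : ∀ᵐ p ∂ρ, 0 ≤ p.2 ∧ p.1 ≤ p.2)
    (hψ : Integrable (fun p : ℝ × ℝ => p.1) ρ) (hV : Integrable (fun p : ℝ × ℝ => p.2) ρ)
    (hm : ∫ p, p.1 ∂ρ < 0) {C : ℝ}
    (hC : ∀ᶠ y in atTop, (peakTail ρ y).toReal ≤ C * tail H y) :
    ∃ R, 0 ≤ R ∧ ∀ t, 0 ≤ t → (seqLaw ρ).real (exceed t) ≤ R * tail H t := by
  set h := (-∫ p, p.1 ∂ρ) / 2 with hdef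
  have hh : 0 < h := by rw [hdef]; linarith
  obtain ⟨A, hA, hΛ⟩ := exists_crossLaw_univ_le hψ hV (h := h) (by rw [hdef]; linarith)
    (by norm_num : (0 : ℝ) < 1 / 8)
  obtain ⟨C1, hC10, hC1⟩ := exists_crossLaw_bound hH hρ hV hC hA hh
  obtain ⟨B, hB, y₀, hconv⟩ := hH.lintegral_shift_le
    (by positivity : (0 : ℝ) < 1 / (4 * (C1 + 1)))
  obtain ⟨y₁, hy₁⟩ := eventually_atTop.1 ((hH.eventually_shift_le B one_lt_two).and
    ((eventually_ge_atTop y₀).and ((eventually_ge_atTop A).and (eventually_ge_atTop B))))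
  -- The first summand makes the bound trivial up to `y₁`; the second absorbs the tail of
  -- `crossLaw`.
  set R := 1 / tail H y₁ + 4 * C1 with hR
  have hpos := hH.pos y₁
  have hR0 : 0 ≤ R := by positivity
  refine ⟨R, hR0, fun t ht => ?_⟩
  have key : ∀ N t, 0 ≤ t → (seqLaw ρ).real (exceedBefore N t) ≤ R * tail H t := by
    intro N
    induction N with
    | zero =>
      intro t ht
      rw [exceedBefore_zero_of_nonneg ht, measureReal_empty]
      exact mul_nonneg hR0 (tail_nonneg _ _)
    | succ N ih =>
      intro t ht
      rcases le_total t y₁ with hle | hle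
      · calc (seqLaw ρ).real (exceedBefore (N + 1) t) ≤ 1 := measureReal_le_one
          _ = 1 / tail H y₁ * tail H y₁ := by field_simp
          _ ≤ R * tail H t := by
            refine mul_le_mul (by rw [hR]; linarith) (antitone_tail H hle) hpos.le hR0
      · obtain ⟨h1, h2, h3, h4⟩ := hy₁ t hle
        have h5 := hconv (crossLaw ρ A h) (fun s => (seqLaw ρ).real (exceedBefore N s)) C1 R hC10
          hR0 (fun _ _ hab => measureReal_mono (antitone_exceedBefore N hab))
          (fun _ => measureReal_le_one) hC1 (fun _ => measureReal_nonneg) ih t h2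
        have h6 := exceedBefore_le_lintegral hρ hA hh.le h3 N
        simp only [ofReal_seqLaw_real] at h5
        have h7 := h6.trans h5
        have hTt := tail_nonneg H t
        rw [← ofReal_measureReal, ENNReal.ofReal_le_ofReal_iff (by positivity)] at h7
        have h8 := hC1 (t - B) (by linarith)
        have h9 := ih (t - B) (by linarith)
        have h10 : C1 * tail H (t - B) ≤ C1 * (2 * tail H t) := by gcongr
        have h11 : R * tail H (t - B) ≤ R * (2 * tail H t) := by gcongr
        have h12 : (crossLaw ρ A h).real univ * (seqLaw ρ).real (exceedBefore N (t - B)) ≤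
            1 / 8 * (R * (2 * tail H t)) := by
          refine mul_le_mul hΛ (h9.trans h11) measureReal_nonneg (by norm_num)
        have h13 : 1 / (4 * (C1 + 1)) * C1 ≤ 1 / 4 := by
          rw [div_mul_eq_mul_div, div_le_div_iff₀ (by positivity) (by norm_num)]
          linarith
        have h14 : 1 / (4 * (C1 + 1)) * C1 * R * tail H t ≤ 1 / 4 * R * tail H t := by gcongr
        have h15 : 4 * C1 * tail H t ≤ R * tail H t := by
          refine mul_le_mul_of_nonneg_right ?_ hTt
          rw [hR]
          have : 0 ≤ 1 / tail H y₁ := by positivity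
          linarith
        linarith
  exact le_of_tendsto' (tendsto_exceedBefore t) fun N => key N t ht

theorem exceed_le_lintegral (hρ : ∀ᵐ p ∂ρ, 0 ≤ p.2 ∧ p.1 ≤ p.2) {A h : ℝ} (hA : 0 ≤ A)
    (hh : 0 ≤ h) {y : ℝ} (hy : A ≤ y) :
    seqLaw ρ (exceed y) ≤ ∫⁻ s, seqLaw ρ (exceed (y - s)) ∂(crossLaw ρ A h) := by
  rw [exceed_eq_iUnion]
  refine le_of_tendsto' (tendsto_measure_iUnion_atTop (monotone_exceedBefore y)) fun N => ?_
  refine (measure_mono (monotone_exceedBefore y (Nat.le_succ N))).trans ?_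
  refine (exceedBefore_le_lintegral hρ hA hh hy N).trans (lintegral_mono fun s => ?_)
  rw [exceed_eq_iUnion]
  exact measure_mono (subset_iUnion (fun N => exceedBefore N (y - s)) N)

/-- The upper bound in Veraverbeke's theorem, for a random walk observed along cycles. -/
theorem eventually_exceed_le (hH : HeavyTail H) (hρ : ∀ᵐ p ∂ρ, 0 ≤ p.2 ∧ p.1 ≤ p.2)
    (hψ : Integrable (fun p : ℝ × ℝ => p.1) ρ) (hV : Integrable (fun p : ℝ × ℝ => p.2) ρ)
    {C : ℝ} (hC : ∀ᶠ y in atTop, (peakTail ρ y).toReal ≤ C * tail H y) {h : ℝ} (hh : 0 < h)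
    (hhm : h < -∫ p, p.1 ∂ρ) {ε : ℝ} (hε : 0 < ε) :
    ∃ K, ∀ᶠ y in atTop,
      (seqLaw ρ).real (exceed y) ≤ h⁻¹ * (peakTail ρ (y - K)).toReal + ε * tail H y := by
  -- Once the order `tail H` is known, one more use of the renewal inequality is sharp. A large `A`
  -- makes the mass of `crossLaw` small compared with `1 / R`, and only the tail of the crossing
  -- height survives.
  obtain ⟨R, hR0, hR⟩ := exists_exceed_bound hH hρ hψ hV (by linarith) hC
  obtain ⟨A, hA, hΛ⟩ := exists_crossLaw_univ_le hψ hV hhm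
    (by positivity : (0 : ℝ) < ε / (4 * (R + 1)))
  obtain ⟨C1, hC10, hC1⟩ := exists_crossLaw_bound hH hρ hV hC hA hh
  obtain ⟨B, hB, y₀, hconv⟩ := hH.lintegral_shift_le
    (by positivity : (0 : ℝ) < ε / (2 * (C1 * R + 1)))
  refine ⟨B + A + 2 * h, ?_⟩
  filter_upwards [hH.eventually_shift_le B one_lt_two, eventually_ge_atTop y₀,
    eventually_ge_atTop A, eventually_ge_atTop B] with y h1 h2 h3 h4
  have h5 := hconv (crossLaw ρ A h) (fun s => (seqLaw ρ).real (exceed s)) C1 R hC10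
    hR0 (fun _ _ hab => measureReal_mono (antitone_exceed hab))
    (fun _ => measureReal_le_one) hC1 (fun _ => measureReal_nonneg) hR y h2
  have h6 := exceed_le_lintegral hρ hA hh.le h3
  simp only [ofReal_seqLaw_real] at h5
  have h7 := h6.trans h5
  have hTt := tail_nonneg H y
  rw [← ofReal_measureReal, ENNReal.ofReal_le_ofReal_iff (by positivity)] at h7
  have h8 := crossLaw_real_Ioi_le hρ hV hA hh (y - B)
  rw [show y - B - A - 2 * h = y - (B + A + 2 * h) by ring] at h8
  have h9 := hR (y - B) (by linarith)
  have h11 : R * tail H (y - B) ≤ R * (2 * tail H y) := by gcongr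
  have h12 : (crossLaw ρ A h).real univ * (seqLaw ρ).real (exceed (y - B)) ≤
      ε / (4 * (R + 1)) * (R * (2 * tail H y)) :=
    mul_le_mul hΛ (h9.trans h11) measureReal_nonneg (by positivity)
  have h13 : ε / (4 * (R + 1)) * (R * (2 * tail H y)) ≤ ε / 2 * tail H y := by
    rw [← mul_assoc, ← mul_assoc]
    refine mul_le_mul_of_nonneg_right ?_ hTt
    rw [div_mul_eq_mul_div, div_mul_eq_mul_div, div_le_div_iff₀ (by positivity) (by norm_num)]
    nlinarith
  have h14 : ε / (2 * (C1 * R + 1)) * C1 * R * tail H y ≤ ε / 2 * tail H y := by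
    refine mul_le_mul_of_nonneg_right ?_ hTt
    rw [mul_assoc, div_mul_eq_mul_div, div_le_div_iff₀ (by positivity) (by norm_num)]
    nlinarith [mul_nonneg hC10 hR0]
  linarith

end MaximumBound

end ModulatedWalk

namespace ModulatedWalk

/-! ### The quantile coupling -/

section Quantile

/-- The uniform law on `(0, 1)`. -/
noncomputable def unif : Measure ℝ := volume.restrict (Ioo 0 1)

instance : IsProbabilityMeasure unif := ⟨by simp [unif]⟩

open Classical in
/-- The quantile function of a law on `ℝ`, extended by `0` outside `(0, 1)`. -/
noncomputable def quantile (G : Measure ℝ) (u : ℝ) : ℝ :=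
  if u ∈ Ioo (0 : ℝ) 1 then sInf {y | u ≤ cdf G y} else 0

/-- The defining set is a nonempty half-line bounded below, as `u` lies strictly between `0` and
`1`; right continuity of the distribution function shows that the infimum is attained. -/
theorem quantile_le_iff (G : Measure ℝ) {u : ℝ} (hu : u ∈ Ioo (0 : ℝ) 1) (y : ℝ) :
    quantile G u ≤ y ↔ u ≤ cdf G y := by
  rw [quantile, if_pos hu]
  have hbdd : BddBelow {y | u ≤ cdf G y} := by
    obtain ⟨z, hz⟩ := ((tendsto_cdf_atBot G).eventually (gt_mem_nhds hu.1)).exists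
    refine ⟨z, fun w hw => ?_⟩
    by_contra hlt
    exact absurd (le_trans hw (monotone_cdf G (not_le.1 hlt).le)) (not_le.2 hz)
  have hne : {y | u ≤ cdf G y}.Nonempty := by
    obtain ⟨z, hz⟩ := ((tendsto_cdf_atTop G).eventually (lt_mem_nhds hu.2)).exists
    exact ⟨z, hz.le⟩
  constructor
  · intro h
    have hright : Tendsto (cdf G) (𝓝[>] y) (𝓝 (cdf G y)) :=
      ((cdf G).right_continuous y).tendsto.mono_left (nhdsWithin_mono _ Ioi_subset_Ici_self)
    refine ge_of_tendsto hright ?_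
    filter_upwards [self_mem_nhdsWithin] with z hz
    obtain ⟨w, hw, hwz⟩ := exists_lt_of_csInf_lt hne (lt_of_le_of_lt h hz)
    exact le_trans hw (monotone_cdf G hwz.le)
  · exact fun h => csInf_le hbdd h

theorem measurable_quantile_uncurry {𝒳 : Type*} [MeasurableSpace 𝒳] (P : Kernel 𝒳 ℝ)
    [IsMarkovKernel P] : Measurable fun p : 𝒳 × ℝ => quantile (P p.1) p.2 := by
  refine measurable_of_Iic fun y => ?_
  have hc : Measurable fun p : 𝒳 × ℝ => cdf (P p.1) y := by
    simp_rw [cdf_eq_real, measureReal_def]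
    exact ((P.measurable_coe measurableSet_Iic).comp measurable_fst).ennreal_toReal
  have hI : MeasurableSet {p : 𝒳 × ℝ | p.2 ∈ Ioo (0 : ℝ) 1} := measurable_snd measurableSet_Ioo
  have : (fun p : 𝒳 × ℝ => quantile (P p.1) p.2) ⁻¹' Iic y =
      ({p | p.2 ∈ Ioo (0 : ℝ) 1} ∩ {p | p.2 ≤ cdf (P p.1) y}) ∪
        ({p | p.2 ∈ Ioo (0 : ℝ) 1}ᶜ ∩ {_p | 0 ≤ y}) := by
    ext p
    by_cases hp : p.2 ∈ Ioo (0 : ℝ) 1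
    · have hp' : 0 < p.2 ∧ p.2 < 1 := hp
      simp [quantile_le_iff _ hp, hp']
    · have : quantile (P p.1) p.2 = 0 := if_neg hp
      rw [mem_preimage, this]
      simp only [mem_Iic, mem_union, mem_inter_iff, mem_compl_iff, mem_ofPred_eq]
      tauto
  rw [this]
  exact (hI.inter (measurableSet_le measurable_snd hc)).union
    (hI.compl.inter (MeasurableSet.const _))

theorem measurable_quantile (G : Measure ℝ) [IsProbabilityMeasure G] : Measurable (quantile G) :=
  (measurable_quantile_uncurry (Kernel.const Unit G)).comp
    (measurable_const.prodMk measurable_id : Measurable fun u : ℝ => ((), u))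

theorem unif_map_quantile (G : Measure ℝ) [IsProbabilityMeasure G] :
    unif.map (quantile G) = G := by
  have : IsProbabilityMeasure (unif.map (quantile G)) :=
    Measure.isProbabilityMeasure_map (measurable_quantile G).aemeasurable
  refine Measure.ext_of_Iic _ _ fun y => ?_
  rw [Measure.map_apply (measurable_quantile G) measurableSet_Iic, unif,
    Measure.restrict_apply (measurable_quantile G measurableSet_Iic), ← ofReal_cdf G]
  have h : quantile G ⁻¹' Iic y ∩ Ioo 0 1 = Iic (cdf G y) ∩ Ioo 0 1 := by
    ext u
    simp only [mem_inter_iff, mem_preimage, mem_Iic]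
    exact and_congr_left fun hu => quantile_le_iff G hu y
  rw [h]
  refine le_antisymm ?_ ?_
  · refine (measure_mono (t := Ioc 0 (cdf G y)) fun u hu => ⟨hu.2.1, hu.1⟩).trans ?_
    rw [Real.volume_Ioc, sub_zero]
  · refine le_trans ?_ (measure_mono (s := Ioo 0 (cdf G y)) fun u hu =>
      ⟨hu.2.le, hu.1, hu.2.trans_le (cdf_le_one G y)⟩)
    rw [Real.volume_Ioo, sub_zero]

theorem unif_quantile_Ioi (G : Measure ℝ) [IsProbabilityMeasure G] (t : ℝ) :
    unif {u | t < quantile G u} = G (Ioi t) := by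
  conv_rhs => rw [← unif_map_quantile G,
    Measure.map_apply (measurable_quantile G) measurableSet_Ioi]
  rfl

/-- A common uniform mark turns an ordering of tails into a pointwise ordering. This is how the
increments are placed below copies of `ζ`. -/
theorem quantile_mono {G₁ G₂ : Measure ℝ} [IsProbabilityMeasure G₁] [IsProbabilityMeasure G₂]
    (h : ∀ y, tail G₁ y ≤ tail G₂ y) (u : ℝ) : quantile G₁ u ≤ quantile G₂ u := by
  by_cases hu : u ∈ Ioo (0 : ℝ) 1
  · rw [quantile_le_iff _ hu]
    refine ((quantile_le_iff G₂ hu _).1 le_rfl).trans ?_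
    rw [cdf_eq_real, cdf_eq_real, measureReal_Iic_eq, measureReal_Iic_eq]
    linarith [h (quantile G₂ u)]
  · rw [quantile, quantile, if_neg hu, if_neg hu]

end Quantile

/-! ### Independent marks on an independent sequence -/

section PairedIndependence

variable {Ω α β : Type*} [MeasurableSpace Ω] [MeasurableSpace α] [MeasurableSpace β]

theorem map_pair_eval {μ : Measure Ω} [IsProbabilityMeasure μ] {W : ℕ → Ω → α}
    (hWm : ∀ n, Measurable (W n)) (ν : Measure β) [IsProbabilityMeasure ν] (n : ℕ) :
    (μ.prod (Measure.infinitePi fun _ : ℕ => ν)).map (fun p => (W n p.1, p.2 n)) =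
      (μ.map (W n)).prod ν := by
  have h := Measure.map_prod_map μ (Measure.infinitePi fun _ : ℕ => ν) (hWm n)
    (measurable_pi_apply n)
  rw [Measure.infinitePi_map_eval (fun _ : ℕ => ν) n] at h
  exact h.symm

/-- Attaching independent marks to an independent sequence gives an independent sequence. -/
theorem iIndepFun_pair {μ : Measure Ω} [IsProbabilityMeasure μ] {W : ℕ → Ω → α}
    (hW : iIndepFun W μ) (hWm : ∀ n, Measurable (W n)) (ν : Measure β) [IsProbabilityMeasure ν] :
    iIndepFun (fun n (p : Ω × (ℕ → β)) => (W n p.1, p.2 n))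
      (μ.prod (Measure.infinitePi fun _ : ℕ => ν)) := by
  classical
  have hm : ∀ n, Measurable fun p : Ω × (ℕ → β) => (W n p.1, p.2 n) := fun n => by
    have := hWm n
    fun_prop
  rw [iIndepFun_iff_measure_inter_preimage_eq_mul]
  intro S A hA
  have hmeas : MeasurableSet (⋂ i ∈ S, (fun p : Ω × (ℕ → β) => (W i p.1, p.2 i)) ⁻¹' A i) :=
    Finset.measurableSet_biInter _ fun i hi => hm i (hA i hi)
  let A' : ℕ → Set (α × β) := fun i => if i ∈ S then A i else univ
  have hA' : ∀ i, MeasurableSet (A' i) := by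
    intro i
    by_cases hi : i ∈ S
    · simpa [A', hi] using hA i hi
    · simp [A', hi]
  have hAA : ∀ i ∈ S, A i = A' i := fun i hi => by simp [A', hi]
  have hsl : ∀ i, Measurable fun a : α => ν (Prod.mk a ⁻¹' A' i) :=
    fun i => measurable_measure_prodMk_left (hA' i)
  rw [Measure.prod_apply hmeas]
  calc ∫⁻ ω, (Measure.infinitePi fun _ : ℕ => ν) (Prod.mk ω ⁻¹'
        ⋂ i ∈ S, (fun p : Ω × (ℕ → β) => (W i p.1, p.2 i)) ⁻¹' A i) ∂μ
      = ∫⁻ ω, ∏ i ∈ S, ν (Prod.mk (W i ω) ⁻¹' A' i) ∂μ := by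
        refine lintegral_congr fun ω => ?_
        have : Prod.mk ω ⁻¹' (⋂ i ∈ S, (fun p : Ω × (ℕ → β) => (W i p.1, p.2 i)) ⁻¹' A i) =
            (S : Set ℕ).pi fun i => Prod.mk (W i ω) ⁻¹' A' i := by
          ext b
          simp only [mem_preimage, mem_iInter, Set.mem_pi, Finset.mem_coe]
          exact forall₂_congr fun i hi => by rw [hAA i hi]
        rw [this, Measure.infinitePi_pi]
        exact fun i hi => measurable_prodMk_left (hA' i)
    _ = ∏ i ∈ S, ∫⁻ ω, ν (Prod.mk (W i ω) ⁻¹' A' i) ∂μ :=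
        lintegral_prod_eq_prod_lintegral_of_indepFun S _ (hW.comp _ hsl)
          fun i => (hsl i).comp (hWm i)
    _ = _ := by
        refine Finset.prod_congr rfl fun i hi => ?_
        rw [← Measure.map_apply (hm i) (hA i hi), map_pair_eval hWm, hAA i hi,
          Measure.prod_apply (hA' i), lintegral_map (hsl i) (hWm i)]

end PairedIndependence

/-! ### Concatenating blocks of marks -/

section Concatenation

/-- The position at which block `n` starts, when blocks of lengths `ℓ 0, ℓ 1, …` are
concatenated. -/
def blockStart (ℓ : ℕ → ℕ) (n : ℕ) : ℕ := ∑ i ∈ Finset.range n, ℓ i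

/-- The block to which the position `j` belongs. -/
def blockIndex (ℓ : ℕ → ℕ) (j : ℕ) : ℕ := Nat.findGreatest (fun n => blockStart ℓ n ≤ j) (j + 1)

/-- The offset of the position `j` within its block. -/
def blockOffset (ℓ : ℕ → ℕ) (j : ℕ) : ℕ := j - blockStart ℓ (blockIndex ℓ j)

/-- The concatenation of the initial segments of lengths `ℓ 0, ℓ 1, …` of the sequences `u 0`,
`u 1`, …. -/
def concat {β : Type*} (ℓ : ℕ → ℕ) (u : ℕ → ℕ → β) (j : ℕ) : β :=
  u (blockIndex ℓ j) (blockOffset ℓ j)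

theorem blockStart_succ (ℓ : ℕ → ℕ) (n : ℕ) : blockStart ℓ (n + 1) = blockStart ℓ n + ℓ n :=
  Finset.sum_range_succ _ _

theorem blockStart_mono (ℓ : ℕ → ℕ) : Monotone (blockStart ℓ) :=
  monotone_nat_of_le_succ fun n => by rw [blockStart_succ]; exact Nat.le_add_right _ _

theorem blockStart_blockIndex_le (ℓ : ℕ → ℕ) (j : ℕ) : blockStart ℓ (blockIndex ℓ j) ≤ j :=
  Nat.findGreatest_spec (P := fun n => blockStart ℓ n ≤ j) (Nat.zero_le _)
    (by simp [blockStart])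

theorem blockStart_add_blockOffset (ℓ : ℕ → ℕ) (j : ℕ) :
    blockStart ℓ (blockIndex ℓ j) + blockOffset ℓ j = j :=
  Nat.add_sub_of_le (blockStart_blockIndex_le ℓ j)

theorem blockPosition_injective (ℓ : ℕ → ℕ) :
    Function.Injective fun j => (blockIndex ℓ j, blockOffset ℓ j) := by
  intro i j hij
  simp only [Prod.mk.injEq] at hij
  rw [← blockStart_add_blockOffset ℓ i, ← blockStart_add_blockOffset ℓ j, hij.1, hij.2]

/-- Only block `0` may be empty, since `T_0 = 0` is allowed. Position `j` can therefore lie in block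
`j + 1`, which is why `blockIndex` searches up to `j + 1`. -/
theorem le_blockStart_succ {ℓ : ℕ → ℕ} (hℓ : ∀ n, 1 ≤ n → 1 ≤ ℓ n) (n : ℕ) :
    n ≤ blockStart ℓ (n + 1) := by
  induction n with
  | zero => exact Nat.zero_le _
  | succ n ih =>
    rw [blockStart_succ]
    have := hℓ (n + 1) (by omega)
    omega

theorem blockIndex_eq {ℓ : ℕ → ℕ} (hℓ : ∀ n, 1 ≤ n → 1 ≤ ℓ n) {n i : ℕ} (hi : i < ℓ n) :
    blockIndex ℓ (blockStart ℓ n + i) = n := by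
  refine (Nat.findGreatest_eq_iff).2 ⟨?_, fun _ => Nat.le_add_right _ _, fun {k} hk _ => ?_⟩
  · rcases n with _ | n
    · exact Nat.zero_le _
    · have := le_blockStart_succ hℓ n
      omega
  · have := blockStart_mono ℓ (Nat.succ_le_of_lt hk)
    rw [Nat.succ_eq_add_one, blockStart_succ] at this
    omega

theorem blockOffset_eq {ℓ : ℕ → ℕ} (hℓ : ∀ n, 1 ≤ n → 1 ≤ ℓ n) {n i : ℕ} (hi : i < ℓ n) :
    blockOffset ℓ (blockStart ℓ n + i) = i := by
  rw [blockOffset, blockIndex_eq hℓ hi, Nat.add_sub_cancel_left]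

theorem concat_apply {β : Type*} {ℓ : ℕ → ℕ} (hℓ : ∀ n, 1 ≤ n → 1 ≤ ℓ n) (u : ℕ → ℕ → β)
    {n i : ℕ} (hi : i < ℓ n) : concat ℓ u (blockStart ℓ n + i) = u n i := by
  rw [concat, blockIndex_eq hℓ hi, blockOffset_eq hℓ hi]

theorem blockOffset_lt {ℓ : ℕ → ℕ} (hℓ : ∀ n, 1 ≤ n → 1 ≤ ℓ n) (j : ℕ) :
    blockOffset ℓ j < ℓ (blockIndex ℓ j) := by
  by_contra hge
  rw [not_lt] at hge
  have h1 := blockStart_add_blockOffset ℓ j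
  have h2 : blockStart ℓ (blockIndex ℓ j + 1) ≤ j := by
    rw [blockStart_succ]; omega
  have h3 : blockIndex ℓ j + 1 ≤ j + 1 := by
    have := le_blockStart_succ hℓ (blockIndex ℓ j)
    omega
  have := Nat.le_findGreatest (P := fun n => blockStart ℓ n ≤ j) h3 h2
  exact absurd this (by unfold blockIndex; omega)

theorem sum_range_blockStart_add {ℓ : ℕ → ℕ} {Y : ℕ → ℝ} {y : ℕ → ℕ → ℝ}
    (h : ∀ n i, i < ℓ n → Y (blockStart ℓ n + i) = y n i) (n : ℕ) {j : ℕ} (hj : j ≤ ℓ n) :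
    ∑ i ∈ Finset.range (blockStart ℓ n + j), Y i =
      (∑ m ∈ Finset.range n, ∑ i ∈ Finset.range (ℓ m), y m i) + ∑ i ∈ Finset.range j, y n i := by
  have hblock : ∀ n j, j ≤ ℓ n → ∑ i ∈ Finset.range j, Y (blockStart ℓ n + i) =
      ∑ i ∈ Finset.range j, y n i := fun n j hj =>
    Finset.sum_congr rfl fun i hi => h n i ((Finset.mem_range.1 hi).trans_le hj)
  rw [Finset.sum_range_add, hblock n j hj]
  congr 1
  clear hj j
  induction n with
  | zero => simp [blockStart]
  | succ n ih => rw [blockStart_succ, Finset.sum_range_add, ih, Finset.sum_range_succ,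
      hblock n _ le_rfl]

theorem measurable_blockStart (n : ℕ) : Measurable fun ℓ : ℕ → ℕ => blockStart ℓ n := by
  unfold blockStart
  fun_prop

theorem measurable_blockIndex (j : ℕ) : Measurable fun ℓ : ℕ → ℕ => blockIndex ℓ j := by
  unfold blockIndex
  exact measurable_findGreatest fun n _ => measurableSet_le (measurable_blockStart n)
    measurable_const

theorem measurable_blockOffset (j : ℕ) : Measurable fun ℓ : ℕ → ℕ => blockOffset ℓ j := by
  have h : Measurable fun p : (ℕ → ℕ) × ℕ => blockStart p.1 p.2 :=
    measurable_from_prod_countable_left fun n => measurable_blockStart n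
  exact measurable_const.sub (h.comp (measurable_id.prodMk (measurable_blockIndex j)))

theorem measurable_concat {β : Type*} [MeasurableSpace β] :
    Measurable fun p : (ℕ → ℕ) × (ℕ → ℕ → β) => concat p.1 p.2 := by
  refine measurable_pi_iff.2 fun j => ?_
  have h : Measurable fun p : (ℕ → ℕ → β) × (ℕ × ℕ) => p.1 p.2.1 p.2.2 :=
    measurable_from_prod_countable_left fun n =>
      (measurable_pi_apply n.2).comp (measurable_pi_apply n.1)
  exact h.comp (measurable_snd.prodMk (((measurable_blockIndex j).comp measurable_fst).prodMk
    ((measurable_blockOffset j).comp measurable_fst)))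

/-- The law of an independent sequence with common law `unif`. -/
noncomputable def unifSeq : Measure (ℕ → ℝ) := Measure.infinitePi fun _ => unif

instance : IsProbabilityMeasure unifSeq := by unfold unifSeq; infer_instance

/-- The law of an independent double array with common law `unif`. -/
noncomputable def unifArray : Measure (ℕ → ℕ → ℝ) := Measure.infinitePi fun _ => unifSeq

instance : IsProbabilityMeasure unifArray := by unfold unifArray; infer_instance

/-- Whatever the lengths are, distinct positions read distinct entries of the array, and an i.i.d.
array read along an injection is an i.i.d. sequence. -/
theorem unifArray_map_concat (ℓ : ℕ → ℕ) : unifArray.map (concat ℓ) = unifSeq := by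
  have h1 : unifArray = (Measure.infinitePi fun _ : ℕ × ℕ => unif).map
      (MeasurableEquiv.curry ℕ ℕ ℝ) := by
    rw [Measure.infinitePi_map_curry (μ := fun _ _ => unif)]
    rfl
  have hm : Measurable (concat ℓ : (ℕ → ℕ → ℝ) → ℕ → ℝ) :=
    measurable_concat.comp (measurable_const.prodMk measurable_id)
  rw [h1, Measure.map_map hm (MeasurableEquiv.measurable _)]
  exact Measure.map_infinitePi_infinitePi_of_inj (P := fun _ : ℕ × ℕ => unif)
    (blockPosition_injective ℓ)

end Concatenation

end ModulatedWalk

namespace ModulatedWalk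

/-! ### Cycles as padded words -/

section Words

variable {Ω 𝒳 : Type*} [MeasurableSpace Ω] [MeasurableSpace 𝒳]

/-- A random word as a pair of its length and an infinite sequence extending it by `x₀`. -/
noncomputable def unpackWord (x₀ : 𝒳) (w : Σ k : ℕ, (Fin k → 𝒳)) : ℕ × (ℕ → 𝒳) :=
  (w.1, fun i => if h : i < w.1 then w.2 ⟨i, h⟩ else x₀)

/-- Padding puts words of all lengths into one product space, where the cycles can be paired with
marks. Measurability on the disjoint union is tested separately for each length. -/
theorem measurable_unpackWord (x₀ : 𝒳) : Measurable (unpackWord x₀) := by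
  intro s hs
  rw [MeasurableSpace.measurableSet_iInf]
  intro k
  change MeasurableSet (Sigma.mk k ⁻¹' (unpackWord x₀ ⁻¹' s))
  rw [← preimage_comp]
  have : Measurable (unpackWord x₀ ∘ Sigma.mk k) := by
    have h2 : Measurable fun w : Fin k → 𝒳 => (unpackWord x₀ ⟨k, w⟩).2 := by
      refine measurable_pi_iff.2 fun i => ?_
      by_cases h : i < k
      · simpa only [unpackWord, h, dite_true] using measurable_pi_apply (⟨i, h⟩ : Fin k)
      · simpa only [unpackWord, h, dite_false] using measurable_const
    exact measurable_const.prodMk h2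
  exact this hs

/-- The cycle number `n`, as a length together with an infinite sequence of states. -/
noncomputable def cycleWord (X : ℕ → Ω → 𝒳) (T : ℕ → Ω → ℕ) (x₀ : 𝒳) (n : ℕ) (ω : Ω) :
    ℕ × (ℕ → 𝒳) := unpackWord x₀ (cycle X T n ω)

theorem cycleWord_snd (X : ℕ → Ω → 𝒳) (T : ℕ → Ω → ℕ) (x₀ : 𝒳) {n i : ℕ} {ω : Ω}
    (hi : i < cycleLength T n ω) :
    (cycleWord X T x₀ n ω).2 i = X (cycleStart T n ω + i) ω := dif_pos hi

variable {μ : Measure Ω} {X : ℕ → Ω → 𝒳} {T : ℕ → Ω → ℕ}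

theorem IsRegenerative.measurable_cycleStart (hX : IsRegenerative μ X T) (n : ℕ) :
    Measurable (cycleStart T n) := by
  rcases n with _ | n
  · exact measurable_const
  · exact hX.measurable_epoch n

theorem IsRegenerative.measurable_cycleLength (hX : IsRegenerative μ X T) (n : ℕ) :
    Measurable (cycleLength T n) :=
  (hX.measurable_epoch n).sub (hX.measurable_cycleStart n)

theorem IsRegenerative.measurable_cycleWord (hX : IsRegenerative μ X T) (x₀ : 𝒳) (n : ℕ) :
    Measurable (cycleWord X T x₀ n) := by
  have hp : Measurable fun p : Ω × ℕ => X p.2 p.1 :=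
    measurable_from_prod_countable_left fun n => hX.measurable_process n
  refine (hX.measurable_cycleLength n).prodMk (measurable_pi_iff.2 fun i => ?_)
  have : (fun ω => (unpackWord x₀ (cycle X T n ω)).2 i) = fun ω =>
      if i < cycleLength T n ω then X (cycleStart T n ω + i) ω else x₀ := by
    ext ω
    by_cases h : i < cycleLength T n ω
    · rw [if_pos h]; exact dif_pos h
    · rw [if_neg h]; exact dif_neg h
  change Measurable fun ω => (unpackWord x₀ (cycle X T n ω)).2 i
  rw [this]
  refine Measurable.ite (measurableSet_lt measurable_const (hX.measurable_cycleLength n)) ?_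
    measurable_const
  exact hp.comp (measurable_id.prodMk ((hX.measurable_cycleStart n).add_const i))

theorem IsRegenerative.iIndepFun_cycleWord (hX : IsRegenerative μ X T) (x₀ : 𝒳) :
    iIndepFun (cycleWord X T x₀) μ :=
  hX.indep.comp (fun _ => unpackWord x₀) fun _ => measurable_unpackWord x₀

theorem IsRegenerative.map_cycleWord (hX : IsRegenerative μ X T) (x₀ : 𝒳) {n : ℕ} (hn : 1 ≤ n) :
    μ.map (cycleWord X T x₀ n) = μ.map (cycleWord X T x₀ 1) :=
  ((hX.identDistrib n hn).comp (measurable_unpackWord x₀)).map_eq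

theorem cycleStart_eq_blockStart {ω : Ω} (hT : StrictMono fun n => T n ω) (n : ℕ) :
    cycleStart T n ω = blockStart (fun n => cycleLength T n ω) n := by
  induction n with
  | zero => simp [cycleStart, blockStart]
  | succ n ih =>
    rw [blockStart_succ, ← ih]
    have : cycleStart T n ω ≤ T n ω := by
      rcases n with _ | n
      · exact Nat.zero_le _
      · exact (hT (Nat.lt_succ_self n)).le
    simp only [cycleLength]
    change T n ω = _
    omega

theorem one_le_cycleLength {ω : Ω} (hT : StrictMono fun n => T n ω) (n : ℕ) (hn : 1 ≤ n) :
    1 ≤ cycleLength T n ω := by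
  obtain ⟨n, rfl⟩ := Nat.exists_eq_add_of_le' hn
  have : T n ω < T (n + 1) ω := hT (Nat.lt_succ_self n)
  simp only [cycleLength, cycleStart]
  omega

end Words

/-! ### Conditioning on the modulating process -/

section Transfer

variable {Ω 𝒳 : Type*} [MeasurableSpace 𝒳]

theorem measure_eq_lintegral_of_indepFun {Ω' α : Type*} [MeasurableSpace Ω]
    [MeasurableSpace Ω'] [MeasurableSpace α] {μ : Measure Ω} [IsProbabilityMeasure μ] {Y : Ω → α}
    {g : Ω → Ω'} (hY : Measurable Y) (hg : Measurable g) (h : IndepFun Y g μ) {W : Set (α × Ω')}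
    (hW : MeasurableSet W) :
    μ {ω | (Y ω, g ω) ∈ W} = ∫⁻ ω, μ {ω' | (Y ω, g ω') ∈ W} ∂μ := by
  have hmap := (indepFun_iff_map_prod_eq_prod_map_map hY.aemeasurable hg.aemeasurable).1 h
  have h1 : μ {ω | (Y ω, g ω) ∈ W} = (μ.map fun ω => (Y ω, g ω)) W :=
    (Measure.map_apply (hY.prodMk hg) hW).symm
  rw [h1, hmap, Measure.prod_apply hW, lintegral_map (measurable_measure_prodMk_left hW) hY]
  refine lintegral_congr fun ω => ?_
  rw [Measure.map_apply hg (measurable_prodMk_left hW)]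
  rfl

/-- Given `X`, the increments are independent with laws `P (X n)`. Joint measurability in the state
and in the source `𝒢 n` is what allows the random state to be frozen by Fubini. -/
theorem measure_modulated_eq_lintegral [mΩ : MeasurableSpace Ω] {μ : Measure Ω}
    [IsProbabilityMeasure μ] {X : ℕ → Ω → 𝒳} (hXm : ∀ n, Measurable (X n)) {P : Kernel 𝒳 ℝ}
    [IsMarkovKernel P] {ξ : ℕ → 𝒳 → Ω → ℝ} (hξ : IsModulatedFamily μ X P ξ)
    {E : Set ((ℕ → 𝒳) × (ℕ → ℝ))} (hE : MeasurableSet E) :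
    μ {ω | ((fun n => X n ω), fun n => ξ n (X n ω) ω) ∈ E} =
      ∫⁻ ω, (Measure.infinitePi fun n => P (X n ω)) {y | ((fun n => X n ω), y) ∈ E} ∂μ := by
  obtain ⟨𝒢, h𝒢, hmeas, hind, hindX⟩ := hξ.indep
  have hYm : Measurable fun ω n => X n ω := measurable_pi_iff.2 hXm
  -- The randomness of all the families is represented by the identity map into `Ω` with the coarser
  -- σ-algebra `⨆ n, 𝒢 n`, a random element independent of `X`.
  have hgm : @Measurable Ω Ω mΩ (⨆ n, 𝒢 n) id :=
    fun s hs => iSup_le h𝒢 s hs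
  have hi : @IndepFun Ω (ℕ → 𝒳) Ω mΩ _ (⨆ n, 𝒢 n) (fun ω n => X n ω) id μ := by
    refine (IndepFun_iff_Indep (mγ := ⨆ n, 𝒢 n) _ _ _).2 ?_
    rw [MeasurableSpace.comap_id, MeasurableSpace.pi,
      MeasurableSpace.comap_iSup]
    simp_rw [MeasurableSpace.comap_comp]
    exact hindX.symm
  have hξm : ∀ n x, Measurable[𝒢 n] (ξ n x) := fun n x =>
    (hmeas n).comp (@measurable_prodMk_left _ _ _ (𝒢 n) x)
  have hW : @MeasurableSet _ (@Prod.instMeasurableSpace (ℕ → 𝒳) Ω _ (⨆ n, 𝒢 n))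
      {p : (ℕ → 𝒳) × Ω | (p.1, fun n => ξ n (p.1 n) p.2) ∈ E} := by
    let _ : MeasurableSpace Ω := ⨆ n, 𝒢 n
    have h1 : ∀ n, Measurable fun p : (ℕ → 𝒳) × Ω => ξ n (p.1 n) p.2 := by
      intro n
      have h2 : @Measurable _ _ _ (@Prod.instMeasurableSpace 𝒳 Ω _ (𝒢 n))
          fun p : (ℕ → 𝒳) × Ω => (p.1 n, p.2) :=
        @Measurable.prodMk _ _ 𝒳 Ω _ (𝒢 n) _ _
          ((measurable_pi_apply n).comp measurable_fst)
          (measurable_snd.mono le_rfl (le_iSup 𝒢 n))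
      exact (hmeas n).comp h2
    exact (measurable_fst.prodMk (measurable_pi_iff.2 h1)) hE
  have hkey := @measure_eq_lintegral_of_indepFun Ω Ω (ℕ → 𝒳) mΩ (⨆ n, 𝒢 n) _ μ _ _ _ hYm hgm hi
    _ hW
  refine hkey.trans (lintegral_congr fun ω => ?_)
  have hξn : ∀ n, Measurable (ξ n (X n ω)) := fun n => (hξm n _).mono (h𝒢 n) le_rfl
  have hindep : iIndepFun (fun n => ξ n (X n ω)) μ := by
    rw [iIndepFun_iff_iIndep]
    exact iIndep_of_iIndep_of_le hind fun n => (hξm n _).comap_le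
  have hlaw := hindep.map_fun_eq_infinitePi_map hξn
  simp_rw [hξ.law] at hlaw
  rw [← hlaw]
  exact (Measure.map_apply (measurable_pi_iff.2 hξn)
    (measurable_prodMk_left (x := fun n => X n ω) hE)).symm

/-- For a fixed `ω` the concatenated marks are i.i.d. uniform and the quantiles give them the laws
`P (X n ω)`. The right-hand side is the one obtained for the modulated walk, so the two joint laws
agree. -/
theorem measure_quantile_eq_lintegral [MeasurableSpace Ω] {μ : Measure Ω}
    [IsProbabilityMeasure μ] {X : ℕ → Ω → 𝒳} (hXm : ∀ n, Measurable (X n)) (P : Kernel 𝒳 ℝ)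
    [IsMarkovKernel P] {ℓ : Ω → ℕ → ℕ} (hℓ : Measurable ℓ)
    {E : Set ((ℕ → 𝒳) × (ℕ → ℝ))} (hE : MeasurableSet E) :
    (μ.prod unifArray) {p | ((fun n => X n p.1),
        fun j => quantile (P (X j p.1)) (concat (ℓ p.1) p.2 j)) ∈ E} =
      ∫⁻ ω, (Measure.infinitePi fun n => P (X n ω)) {y | ((fun n => X n ω), y) ∈ E} ∂μ := by
  have hm : Measurable fun p : Ω × (ℕ → ℕ → ℝ) => ((fun n => X n p.1),
      fun j => quantile (P (X j p.1)) (concat (ℓ p.1) p.2 j)) := by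
    refine (measurable_pi_iff.2 fun n => (hXm n).comp measurable_fst).prodMk
      (measurable_pi_iff.2 fun j => ?_)
    have hc : Measurable fun p : Ω × (ℕ → ℕ → ℝ) => concat (ℓ p.1) p.2 j :=
      (measurable_pi_apply j).comp (measurable_concat.comp
        ((hℓ.comp measurable_fst).prodMk measurable_snd))
    exact (measurable_quantile_uncurry P).comp (((hXm j).comp measurable_fst).prodMk hc)
  refine (Measure.prod_apply (hm hE)).trans (lintegral_congr fun ω => ?_)
  have h1 : (Measure.infinitePi fun n => P (X n ω)) =
      unifArray.map fun u j => quantile (P (X j ω)) (concat (ℓ ω) u j) := by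
    have hcm : Measurable (concat (ℓ ω) : (ℕ → ℕ → ℝ) → ℕ → ℝ) :=
      measurable_concat.comp (measurable_const.prodMk measurable_id)
    have hqm : ∀ j, Measurable (quantile (P (X j ω))) := fun j => measurable_quantile _
    have h2 : (fun u j => quantile (P (X j ω)) (concat (ℓ ω) u j)) =
      (fun (v : ℕ → ℝ) j => quantile (P (X j ω)) (v j)) ∘ concat (ℓ ω) := rfl
    rw [h2, ← Measure.map_map (by fun_prop) hcm, unifArray_map_concat, unifSeq,
      Measure.infinitePi_map_pi _ hqm]
    simp_rw [unif_map_quantile]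
  have hm2 : Measurable fun (u : ℕ → ℕ → ℝ) j => quantile (P (X j ω)) (concat (ℓ ω) u j) :=
    measurable_snd.comp (hm.comp (measurable_prodMk_left (x := ω)))
  rw [h1]
  exact (Measure.map_apply hm2 (measurable_prodMk_left (x := fun n => X n ω) hE)).symm

end Transfer

end ModulatedWalk

namespace ModulatedWalk

theorem measurable_sum_range_of {α M : Type*} [MeasurableSpace α] [AddCommMonoid M]
    [MeasurableSpace M] [MeasurableAdd₂ M] {k : α → ℕ} (hk : Measurable k) {g : ℕ → α → M}
    (hg : ∀ i, Measurable (g i)) : Measurable fun a => ∑ i ∈ Finset.range (k a), g i a := by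
  have h : Measurable fun p : α × ℕ => ∑ i ∈ Finset.range p.2, g i p.1 :=
    measurable_from_prod_countable_left fun j =>
      Finset.measurable_sum (Finset.range j) fun i _ => hg i
  exact h.comp (measurable_id.prodMk hk)

/-! ### Sum and maximum of the walk within a cycle -/

section CycleFunctionals

variable {𝒳 : Type*} [MeasurableSpace 𝒳] (q : 𝒳 → ℝ → ℝ)

/-- The walk within a cycle, with increments `q x u` computed from the states and the marks. -/
def partSum (z : (ℕ × (ℕ → 𝒳)) × (ℕ → ℝ)) (j : ℕ) : ℝ :=
  ∑ i ∈ Finset.range j, q (z.1.2 i) (z.2 i)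

/-- The total increment over a cycle. -/
def cycleSum (z : (ℕ × (ℕ → 𝒳)) × (ℕ → ℝ)) : ℝ := partSum q z z.1.1

/-- The maximum of the walk within a cycle. -/
def cycleMax (z : (ℕ × (ℕ → 𝒳)) × (ℕ → ℝ)) : ℝ :=
  (Finset.range (z.1.1 + 1)).sup' Finset.nonempty_range_add_one (partSum q z)

variable {q}

theorem lt_cycleMax_iff {z : (ℕ × (ℕ → 𝒳)) × (ℕ → ℝ)} {y : ℝ} :
    y < cycleMax q z ↔ ∃ j ≤ z.1.1, y < partSum q z j := by
  unfold cycleMax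
  rw [Finset.lt_sup'_iff]
  simp

theorem partSum_le_cycleMax (z : (ℕ × (ℕ → 𝒳)) × (ℕ → ℝ)) {j : ℕ} (hj : j ≤ z.1.1) :
    partSum q z j ≤ cycleMax q z :=
  Finset.le_sup' (partSum q z) (by simp; omega)

theorem cycleMax_nonneg (z : (ℕ × (ℕ → 𝒳)) × (ℕ → ℝ)) : 0 ≤ cycleMax q z := by
  have := partSum_le_cycleMax (q := q) z (Nat.zero_le _)
  simpa [partSum] using this

theorem cycleSum_le_cycleMax (z : (ℕ × (ℕ → 𝒳)) × (ℕ → ℝ)) : cycleSum q z ≤ cycleMax q z :=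
  partSum_le_cycleMax z le_rfl

theorem cycleMax_le_sum_abs (z : (ℕ × (ℕ → 𝒳)) × (ℕ → ℝ)) :
    cycleMax q z ≤ ∑ i ∈ Finset.range z.1.1, |q (z.1.2 i) (z.2 i)| := by
  refine Finset.sup'_le _ _ fun j hj => ?_
  refine (Finset.sum_le_sum fun i _ => le_abs_self _).trans ?_
  refine Finset.sum_le_sum_of_subset_of_nonneg (fun i hi => ?_) fun _ _ _ => abs_nonneg _
  simp only [Finset.mem_range] at hi hj ⊢
  omega

theorem cycleMax_mono {q₁ q₂ : 𝒳 → ℝ → ℝ} (h : ∀ x u, q₁ x u ≤ q₂ x u)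
    (z : (ℕ × (ℕ → 𝒳)) × (ℕ → ℝ)) : cycleMax q₁ z ≤ cycleMax q₂ z :=
  Finset.sup'_mono_fun fun _ _ => Finset.sum_le_sum fun _ _ => h _ _

variable (hq : Measurable fun p : 𝒳 × ℝ => q p.1 p.2)
include hq

theorem measurable_partSum (j : ℕ) :
    Measurable fun z : (ℕ × (ℕ → 𝒳)) × (ℕ → ℝ) => partSum q z j := by
  unfold partSum
  exact Finset.measurable_sum _ fun i _ => hq.comp
    (by fun_prop : Measurable fun z : (ℕ × (ℕ → 𝒳)) × (ℕ → ℝ) => (z.1.2 i, z.2 i))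

theorem measurable_cycleSum : Measurable fun z : (ℕ × (ℕ → 𝒳)) × (ℕ → ℝ) => cycleSum q z := by
  have h : Measurable fun p : ((ℕ × (ℕ → 𝒳)) × (ℕ → ℝ)) × ℕ => partSum q p.1 p.2 :=
    measurable_from_prod_countable_left fun j => measurable_partSum hq j
  exact h.comp (measurable_id.prodMk (measurable_fst.comp measurable_fst))

theorem measurable_cycleMax : Measurable fun z : (ℕ × (ℕ → 𝒳)) × (ℕ → ℝ) => cycleMax q z := by
  refine measurable_of_Ioi fun y => ?_
  have : (fun z : (ℕ × (ℕ → 𝒳)) × (ℕ → ℝ) => cycleMax q z) ⁻¹' Ioi y =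
      ⋃ j : ℕ, {z | j ≤ z.1.1} ∩ {z | y < partSum q z j} := by
    ext z
    simp [lt_cycleMax_iff]
  rw [this]
  exact MeasurableSet.iUnion fun j => (measurableSet_le measurable_const
    (measurable_fst.comp measurable_fst)).inter
      (measurableSet_lt measurable_const (measurable_partSum hq j))

end CycleFunctionals

/-! ### Occupation measure of a cycle -/

section Intensity

variable {𝒳 : Type*} [MeasurableSpace 𝒳]

theorem measurable_sum_dirac : Measurable fun w : ℕ × (ℕ → 𝒳) =>
    ∑ i ∈ Finset.range w.1, Measure.dirac (w.2 i) := by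
  refine Measure.measurable_of_measurable_coe _ fun s hs => ?_
  simp_rw [Measure.finsetSum_apply]
  refine measurable_sum_range_of measurable_fst fun i => ?_
  exact (Measure.measurable_coe hs).comp (Measure.measurable_dirac.comp (by fun_prop))

/-- The expected occupation measure of a random word. -/
noncomputable def intensity (ρ : Measure (ℕ × (ℕ → 𝒳))) : Measure 𝒳 :=
  ρ.bind fun w => ∑ i ∈ Finset.range w.1, Measure.dirac (w.2 i)

variable {ρ : Measure (ℕ × (ℕ → 𝒳))}

theorem lintegral_intensity {g : 𝒳 → ℝ≥0∞} (hg : Measurable g) :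
    ∫⁻ x, g x ∂(intensity ρ) = ∫⁻ w, ∑ i ∈ Finset.range w.1, g (w.2 i) ∂ρ := by
  unfold intensity
  rw [Measure.lintegral_bind measurable_sum_dirac.aemeasurable hg.aemeasurable]
  refine lintegral_congr fun w => ?_
  rw [lintegral_finsetSum_measure]
  refine Finset.sum_congr rfl fun i _ => ?_
  rw [lintegral_dirac' _ hg]

theorem integral_sum_of_nonneg {g : 𝒳 → ℝ} (hg : Measurable g) (hg0 : ∀ x, 0 ≤ g x) :
    ∫ w, ∑ i ∈ Finset.range w.1, g (w.2 i) ∂ρ = ∫ x, g x ∂(intensity ρ) := by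
  rw [integral_eq_lintegral_of_nonneg_ae (ae_of_all _ hg0) hg.aestronglyMeasurable,
    integral_eq_lintegral_of_nonneg_ae (ae_of_all _ fun w => Finset.sum_nonneg fun i _ => hg0 _)
      (measurable_sum_range_of measurable_fst (g := fun i (w : ℕ × (ℕ → 𝒳)) => g (w.2 i)) fun i =>
        hg.comp (by fun_prop : Measurable fun w : ℕ × (ℕ → 𝒳) => w.2 i)).aestronglyMeasurable,
    lintegral_intensity hg.ennreal_ofReal]
  congr 1
  refine lintegral_congr fun w => ?_
  rw [ENNReal.ofReal_sum_of_nonneg fun i _ => hg0 _]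

theorem integrable_sum_of_nonneg {g : 𝒳 → ℝ} (hg : Measurable g) (hg0 : ∀ x, 0 ≤ g x)
    (h : Integrable g (intensity ρ)) :
    Integrable (fun w : ℕ × (ℕ → 𝒳) => ∑ i ∈ Finset.range w.1, g (w.2 i)) ρ := by
  refine ⟨(measurable_sum_range_of measurable_fst (g := fun i (w : ℕ × (ℕ → 𝒳)) => g (w.2 i)) fun i =>
        hg.comp (by fun_prop : Measurable fun w : ℕ × (ℕ → 𝒳) => w.2 i)).aestronglyMeasurable, ?_⟩
  rw [hasFiniteIntegral_iff_ofReal (ae_of_all _ fun w => Finset.sum_nonneg fun i _ => hg0 _)]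
  have h1 := (hasFiniteIntegral_iff_ofReal (ae_of_all _ hg0)).1 h.2
  rw [lintegral_intensity hg.ennreal_ofReal] at h1
  convert h1 using 3 with w
  rw [ENNReal.ofReal_sum_of_nonneg fun i _ => hg0 _]

theorem integral_sum_eq {g : 𝒳 → ℝ} (hg : Measurable g) (h : Integrable g (intensity ρ)) :
    ∫ w, ∑ i ∈ Finset.range w.1, g (w.2 i) ∂ρ = ∫ x, g x ∂(intensity ρ) := by
  have hp : Measurable fun x => max (g x) 0 := hg.max measurable_const
  have hn : Measurable fun x => max (-g x) 0 := hg.neg.max measurable_const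
  have h1 : ∀ x, g x = max (g x) 0 - max (-g x) 0 := fun x => by
    rcases le_total 0 (g x) with h | h
    · rw [max_eq_left h, max_eq_right (by linarith), sub_zero]
    · rw [max_eq_right h, max_eq_left (by linarith)]; ring
  calc ∫ w, ∑ i ∈ Finset.range w.1, g (w.2 i) ∂ρ
      = ∫ w, (∑ i ∈ Finset.range w.1, max (g (w.2 i)) 0 -
          ∑ i ∈ Finset.range w.1, max (-g (w.2 i)) 0) ∂ρ := by
        congr 1
        ext w
        rw [← Finset.sum_sub_distrib]
        exact Finset.sum_congr rfl fun i _ => h1 _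
    _ = ∫ x, max (g x) 0 ∂(intensity ρ) - ∫ x, max (-g x) 0 ∂(intensity ρ) := by
        rw [integral_sub (integrable_sum_of_nonneg hp (fun _ => le_max_right _ _) h.pos_part)
          (integrable_sum_of_nonneg hn (fun _ => le_max_right _ _) h.neg_part),
          integral_sum_of_nonneg hp fun _ => le_max_right _ _,
          integral_sum_of_nonneg hn fun _ => le_max_right _ _]
    _ = _ := by
        rw [← integral_sub h.pos_part h.neg_part]
        exact integral_congr_ae (ae_of_all _ fun x => (h1 x).symm)

theorem intensity_univ : intensity ρ univ = ∫⁻ w, (w.1 : ℝ≥0∞) ∂ρ := by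
  rw [← lintegral_one, lintegral_intensity measurable_const]
  simp

end Intensity

section CycleLaw

variable {Ω 𝒳 : Type*} [MeasurableSpace Ω] [MeasurableSpace 𝒳] {μ : Measure Ω}
  {X : ℕ → Ω → 𝒳} {T : ℕ → Ω → ℕ}

theorem cycleLaw_eq (hX : IsRegenerative μ X T) (x₀ : 𝒳) :
    cycleLaw μ X T = (∫⁻ ω, (cycleLength T 1 ω : ℝ≥0∞) ∂μ)⁻¹ •
      intensity (μ.map (cycleWord X T x₀ 1)) := by
  unfold cycleLaw intensity
  congr 1
  have hm := hX.measurable_cycleWord x₀ 1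
  have h : (fun ω => ∑ i ∈ Finset.Ico (T 0 ω) (T 1 ω), Measure.dirac (X i ω)) =
      (fun w : ℕ × (ℕ → 𝒳) => ∑ i ∈ Finset.range w.1, Measure.dirac (w.2 i)) ∘
        cycleWord X T x₀ 1 := by
    ext1 ω
    rw [Finset.sum_Ico_eq_sum_range]
    refine Finset.sum_congr rfl fun i hi => ?_
    rw [cycleWord_snd X T x₀ (Finset.mem_range.1 hi)]
    rfl
  rw [h]
  ext s hs
  rw [Measure.bind_apply hs (measurable_sum_dirac.comp hm).aemeasurable,
    Measure.bind_apply hs measurable_sum_dirac.aemeasurable,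
    lintegral_map (f := fun w : ℕ × (ℕ → 𝒳) =>
      (∑ i ∈ Finset.range w.1, Measure.dirac (w.2 i) : Measure 𝒳) s)
      ((Measure.measurable_coe hs).comp measurable_sum_dirac) hm]
  rfl

end CycleLaw

section CycleIntegrals

variable {𝒳 : Type*} [MeasurableSpace 𝒳] {ρ : Measure (ℕ × (ℕ → 𝒳))} {q : 𝒳 → ℝ → ℝ}

theorem unifSeq_map_eval (i : ℕ) : unifSeq.map (fun u => u i) = unif :=
  Measure.infinitePi_map_eval (fun _ => unif) i

/-- A Wald identity: the marks are independent of the length and the states, so they are integrated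
out position by position. For the law of a regenerative cycle, `intensity` is `E τ` times `π`. -/
theorem lintegral_cycle_sum {g : 𝒳 × ℝ → ℝ≥0∞} (hg : Measurable g) :
    ∫⁻ z, ∑ i ∈ Finset.range z.1.1, g (z.1.2 i, z.2 i) ∂(ρ.prod unifSeq) =
      ∫⁻ x, ∫⁻ u, g (x, u) ∂unif ∂(intensity ρ) := by
  have hm : Measurable fun z : (ℕ × (ℕ → 𝒳)) × (ℕ → ℝ) =>
      ∑ i ∈ Finset.range z.1.1, g (z.1.2 i, z.2 i) := by
    exact measurable_sum_range_of (measurable_fst.comp measurable_fst) fun i => hg.comp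
      (by fun_prop : Measurable fun z : (ℕ × (ℕ → 𝒳)) × (ℕ → ℝ) => (z.1.2 i, z.2 i))
  rw [lintegral_prod _ hm.aemeasurable, lintegral_intensity hg.lintegral_prod_right']
  refine lintegral_congr fun w => ?_
  have hgi : ∀ i, Measurable fun u : ℕ → ℝ => g (w.2 i, u i) := fun i =>
    hg.comp (by fun_prop : Measurable fun u : ℕ → ℝ => (w.2 i, u i))
  change ∫⁻ u : ℕ → ℝ, ∑ i ∈ Finset.range w.1, g (w.2 i, u i) ∂unifSeq = _
  rw [lintegral_finsetSum _ fun i _ => hgi i]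
  refine Finset.sum_congr rfl fun i _ => ?_
  rw [← unifSeq_map_eval i, lintegral_map (f := fun u => g (w.2 i, u))
    (hg.comp measurable_prodMk_left) (measurable_pi_apply i)]

theorem integrable_sum_abs [SFinite ρ] (hq : Measurable fun p : 𝒳 × ℝ => q p.1 p.2)
    (h : ∫⁻ x, ∫⁻ u, ‖q x u‖ₑ ∂unif ∂(intensity ρ) < ∞) :
    Integrable (fun z => ∑ i ∈ Finset.range z.1.1, |q (z.1.2 i) (z.2 i)|)
      (ρ.prod unifSeq) := by
  have hm : Measurable fun z : (ℕ × (ℕ → 𝒳)) × (ℕ → ℝ) =>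
      ∑ i ∈ Finset.range z.1.1, |q (z.1.2 i) (z.2 i)| := by
    exact measurable_sum_range_of (measurable_fst.comp measurable_fst) fun i => (hq.comp
      (by fun_prop : Measurable fun z : (ℕ × (ℕ → 𝒳)) × (ℕ → ℝ) => (z.1.2 i, z.2 i))).abs
  refine ⟨hm.aestronglyMeasurable, ?_⟩
  rw [hasFiniteIntegral_iff_ofReal (ae_of_all _ fun z =>
    Finset.sum_nonneg fun i _ => abs_nonneg _)]
  have h1 := lintegral_cycle_sum (ρ := ρ) hq.enorm
  simp only at h1
  rw [← h1] at h
  convert h using 3 with z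
  rw [ENNReal.ofReal_sum_of_nonneg fun i _ => abs_nonneg _]
  exact Finset.sum_congr rfl fun i _ => (Real.enorm_eq_ofReal_abs _).symm

theorem integrable_cycleMax [SFinite ρ] (hq : Measurable fun p : 𝒳 × ℝ => q p.1 p.2)
    (h : ∫⁻ x, ∫⁻ u, ‖q x u‖ₑ ∂unif ∂(intensity ρ) < ∞) :
    Integrable (cycleMax q) (ρ.prod unifSeq) :=
  (integrable_sum_abs hq h).mono' (measurable_cycleMax hq).aestronglyMeasurable
    (ae_of_all _ fun z => by
      rw [Real.norm_of_nonneg (cycleMax_nonneg z)]; exact cycleMax_le_sum_abs z)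

theorem integrable_cycleSum [SFinite ρ] (hq : Measurable fun p : 𝒳 × ℝ => q p.1 p.2)
    (h : ∫⁻ x, ∫⁻ u, ‖q x u‖ₑ ∂unif ∂(intensity ρ) < ∞) :
    Integrable (cycleSum q) (ρ.prod unifSeq) :=
  (integrable_sum_abs hq h).mono' (measurable_cycleSum hq).aestronglyMeasurable
    (ae_of_all _ fun z => by
      rw [Real.norm_eq_abs]; exact Finset.abs_sum_le_sum_abs (fun i => q (z.1.2 i) (z.2 i))
        (Finset.range z.1.1))

theorem integral_cycleSum [IsFiniteMeasure ρ] (hq : Measurable fun p : 𝒳 × ℝ => q p.1 p.2)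
    (hqi : ∀ x, Integrable (q x) unif)
    (h : ∫⁻ x, ∫⁻ u, ‖q x u‖ₑ ∂unif ∂(intensity ρ) < ∞) :
    ∫ z, cycleSum q z ∂(ρ.prod unifSeq) = ∫ x, ∫ u, q x u ∂unif ∂(intensity ρ) := by
  have hm : Measurable fun x => ∫ u, q x u ∂unif :=
    (hq.stronglyMeasurable.integral_prod_right' (ν := unif)).measurable
  have hint : Integrable (fun x => ∫ u, q x u ∂unif) (intensity ρ) := by
    refine ⟨hm.aestronglyMeasurable, lt_of_le_of_lt (lintegral_mono fun x => ?_) h⟩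
    exact enorm_integral_le_lintegral_enorm _
  rw [integral_prod _ (integrable_cycleSum hq h), ← integral_sum_eq hm hint]
  congr 1
  ext w
  simp only [cycleSum, partSum]
  have hi : ∀ i, Integrable (fun u : ℕ → ℝ => q (w.2 i) (u i)) unifSeq := fun i =>
    (measurePreserving_eval_infinitePi (fun _ : ℕ => unif) i).integrable_comp_of_integrable (hqi _)
  rw [integral_finsetSum _ fun i _ => hi i]
  refine Finset.sum_congr rfl fun i _ => ?_
  have hqx : Measurable (q (w.2 i)) := hq.comp measurable_prodMk_left
  rw [← unifSeq_map_eval i, integral_map (measurable_pi_apply i).aemeasurable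
    hqx.aestronglyMeasurable]

end CycleIntegrals

end ModulatedWalk

namespace ModulatedWalk

/-- `H` is a heavy-tailed law whose tail is the second tail of `F` far out, and dominates the tail
of `F`. -/
structure IsSecondTail (F H : Measure ℝ) : Prop where
  heavy : HeavyTail H
  eq : ∀ᶠ y in atTop, ENNReal.ofReal (tail H y) = integratedTail F y
  little : tail F =o[atTop] tail H

theorem IsSecondTail.tail_pos {F H : Measure ℝ} [IsProbabilityMeasure F] (h : IsSecondTail F H)
    (y : ℝ) : 0 < tail F y := by
  by_contra hneg
  have h0 : tail F y = 0 := le_antisymm (not_lt.1 hneg) (tail_nonneg _ _)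
  obtain ⟨z, hz, hyz⟩ := (h.eq.and (eventually_ge_atTop y)).exists
  have : integratedTail F z = 0 := by
    unfold integratedTail
    rw [← nonpos_iff_eq_zero]
    calc ∫⁻ t in Ioi z, F (Ioi t) ≤ ∫⁻ _ in Ioi z, 0 := by
          refine setLIntegral_mono' measurableSet_Ioi fun t ht => ?_
          rw [← ofReal_tail, ← ENNReal.ofReal_zero, ← h0]
          exact ENNReal.ofReal_le_ofReal (antitone_tail F (hyz.trans (le_of_lt ht)))
      _ = 0 := by simp
  rw [this, ENNReal.ofReal_eq_zero] at hz
  exact absurd (h.heavy.pos z) (not_lt.2 hz)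

/-! ### Expected number of large increments in a cycle -/

section WeightedTail

variable {𝒳 : Type*} [MeasurableSpace 𝒳]

/-- The expected weighted sum of the tails at `t` of the increments of a cycle. -/
noncomputable def weightedTail (P : Kernel 𝒳 ℝ) (ρ : Measure (ℕ × (ℕ → 𝒳)))
    (w : ℕ → ℕ × (ℕ → 𝒳) → ℝ≥0∞) (t : ℝ) : ℝ≥0∞ :=
  ∫⁻ a, ∑ i ∈ Finset.range a.1, w i a * P (a.2 i) (Ioi t) ∂ρ

/-- The expected weighted sum of the tail constants of the increments of a cycle. -/
noncomputable def weightedLimit (c : 𝒳 → ℝ) (ρ : Measure (ℕ × (ℕ → 𝒳)))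
    (w : ℕ → ℕ × (ℕ → 𝒳) → ℝ≥0∞) : ℝ≥0∞ :=
  ∫⁻ a, ∑ i ∈ Finset.range a.1, w i a * ENNReal.ofReal (c (a.2 i)) ∂ρ

variable {P : Kernel 𝒳 ℝ} [IsMarkovKernel P] {ρ : Measure (ℕ × (ℕ → 𝒳))}
  {w : ℕ → ℕ × (ℕ → 𝒳) → ℝ≥0∞} {F H : Measure ℝ} [IsProbabilityMeasure F]
  [IsProbabilityMeasure H] {c : 𝒳 → ℝ} {L : ℝ}

omit [IsProbabilityMeasure F] in
theorem tailConstant_le (hFpos : ∀ y, 0 < tail F y)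
    (hc : ∀ x, Tendsto (fun y => tail (P x) y / tail F y) atTop (𝓝 (c x)))
    (hL : ∀ x, ∀ y, 0 ≤ y → tail (P x) y ≤ L * tail F y) (x : 𝒳) : c x ≤ L := by
  refine le_of_tendsto (hc x) ?_
  filter_upwards [eventually_ge_atTop 0] with y hy
  rw [div_le_iff₀ (hFpos y)]
  exact hL x y hy

theorem weightedLimit_lt_top (hFH : IsSecondTail F H)
    (hc : ∀ x, Tendsto (fun y => tail (P x) y / tail F y) atTop (𝓝 (c x)))
    (hL : ∀ x, ∀ y, 0 ≤ y → tail (P x) y ≤ L * tail F y)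
    (hρ : ∫⁻ a, (a.1 : ℝ≥0∞) ∂ρ < ∞) (hw1 : ∀ i a, w i a ≤ 1) : weightedLimit c ρ w < ∞ := by
  calc weightedLimit c ρ w ≤ ∫⁻ a, (a.1 : ℝ≥0∞) * ENNReal.ofReal L ∂ρ := by
        refine lintegral_mono fun a => ?_
        calc _ ≤ ∑ _i ∈ Finset.range a.1, ENNReal.ofReal L := by
              refine Finset.sum_le_sum fun i _ => ?_
              calc _ ≤ 1 * ENNReal.ofReal L := mul_le_mul' (hw1 _ _)
                    (ENNReal.ofReal_le_ofReal (tailConstant_le hFH.tail_pos hc hL _))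
                _ = _ := one_mul _
          _ = _ := by simp
    _ = (∫⁻ a, (a.1 : ℝ≥0∞) ∂ρ) * ENNReal.ofReal L :=
        lintegral_mul_const _ (by fun_prop)
    _ < ∞ := ENNReal.mul_lt_top hρ ENNReal.ofReal_lt_top

/-- Dominated convergence with majorant `L` times the cycle length. The weights will be
probabilities that the other increments of the cycle are moderate, so one asymptotic relation serves
both the upper and the lower bound. -/
theorem tendsto_weightedTail_div (hFH : IsSecondTail F H)
    (hc : ∀ x, Tendsto (fun y => tail (P x) y / tail F y) atTop (𝓝 (c x)))
    (hL : ∀ x, ∀ y, 0 ≤ y → tail (P x) y ≤ L * tail F y)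
    (hρ : ∫⁻ a, (a.1 : ℝ≥0∞) ∂ρ < ∞) (hw : ∀ i, Measurable (w i)) (hw1 : ∀ i a, w i a ≤ 1) :
    Tendsto (fun t => weightedTail P ρ w t / F (Ioi t)) atTop (𝓝 (weightedLimit c ρ w)) := by
  have hF0 : ∀ t, F (Ioi t) ≠ 0 := fun t h => by
    have := hFH.tail_pos t
    rw [tail, measureReal_def, h] at this
    simp at this
  have hFt : ∀ t, F (Ioi t) ≠ ∞ := fun t => measure_ne_top _ _
  have hdiv : ∀ x t, P x (Ioi t) / F (Ioi t) = ENNReal.ofReal (tail (P x) t / tail F t) := by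
    intro x t
    rw [ENNReal.ofReal_div_of_pos (hFH.tail_pos t), ofReal_tail, ofReal_tail]
  have heq : ∀ t, weightedTail P ρ w t / F (Ioi t) = ∫⁻ a, ∑ i ∈ Finset.range a.1,
      w i a * (P (a.2 i) (Ioi t) / F (Ioi t)) ∂ρ := by
    intro t
    unfold weightedTail
    rw [ENNReal.div_eq_inv_mul, ← lintegral_const_mul' _ _ (ENNReal.inv_ne_top.2 (hF0 t))]
    refine lintegral_congr fun a => ?_
    rw [Finset.mul_sum]
    refine Finset.sum_congr rfl fun i _ => ?_
    rw [ENNReal.div_eq_inv_mul]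
    ring
  simp_rw [heq]
  unfold weightedLimit
  refine tendsto_lintegral_filter_of_dominated_convergence
    (fun a => (a.1 : ℝ≥0∞) * ENNReal.ofReal L) (Eventually.of_forall fun t => ?_) ?_ ?_ ?_
  · refine measurable_sum_range_of measurable_fst fun i => (hw i).mul ?_
    exact ((P.measurable_coe measurableSet_Ioi).comp
      (by fun_prop : Measurable fun a : ℕ × (ℕ → 𝒳) => a.2 i)).div_const _
  · filter_upwards [eventually_ge_atTop 0] with t ht
    refine ae_of_all _ fun a => ?_
    calc _ ≤ ∑ _i ∈ Finset.range a.1, ENNReal.ofReal L := by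
          refine Finset.sum_le_sum fun i _ => ?_
          calc _ ≤ 1 * ENNReal.ofReal L := by
                refine mul_le_mul' (hw1 _ _) ?_
                rw [hdiv]
                refine ENNReal.ofReal_le_ofReal ?_
                rw [div_le_iff₀ (hFH.tail_pos t)]
                exact hL _ _ ht
            _ = _ := one_mul _
      _ = _ := by simp
  · rw [lintegral_mul_const _ (by fun_prop)]
    exact (ENNReal.mul_lt_top hρ ENNReal.ofReal_lt_top).ne
  · refine ae_of_all _ fun a => tendsto_finsetSum _ fun i _ => ?_
    refine ENNReal.Tendsto.const_mul ?_ (Or.inr (lt_of_le_of_lt (hw1 _ _) ENNReal.one_lt_top).ne)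
    simp_rw [hdiv]
    exact ENNReal.tendsto_ofReal (hc _)

theorem eventually_setLIntegral_weightedTail_le (hFH : IsSecondTail F H)
    (hc : ∀ x, Tendsto (fun y => tail (P x) y / tail F y) atTop (𝓝 (c x)))
    (hL : ∀ x, ∀ y, 0 ≤ y → tail (P x) y ≤ L * tail F y)
    (hρ : ∫⁻ a, (a.1 : ℝ≥0∞) ∂ρ < ∞) (hw : ∀ i, Measurable (w i)) (hw1 : ∀ i a, w i a ≤ 1)
    {ε : ℝ} (hε : 0 < ε) :
    ∀ᶠ y in atTop, ∫⁻ t in Ioi y, weightedTail P ρ w t ≤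
      ENNReal.ofReal (((weightedLimit c ρ w).toReal + ε) * tail H y) := by
  have hlt := weightedLimit_lt_top (w := w) hFH hc hL hρ hw1
  have h1 := (tendsto_weightedTail_div hFH hc hL hρ hw hw1).eventually
    (gt_mem_nhds (ENNReal.lt_add_right hlt.ne (ENNReal.ofReal_pos.2 hε).ne'))
  obtain ⟨y₀, hy₀⟩ := eventually_atTop.1 h1
  filter_upwards [eventually_ge_atTop y₀, hFH.eq] with y hy hy2
  rw [ENNReal.ofReal_mul (by positivity), hy2, ENNReal.ofReal_add ENNReal.toReal_nonneg hε.le,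
    ENNReal.ofReal_toReal hlt.ne]
  unfold integratedTail
  rw [← lintegral_const_mul _ (measurable_measure_Ioi F)]
  refine setLIntegral_mono' measurableSet_Ioi fun t ht => ?_
  have h2 := (hy₀ t (hy.trans (le_of_lt ht))).le
  rwa [ENNReal.div_le_iff_le_mul] at h2
  · left; intro h
    have := hFH.tail_pos t
    rw [tail, measureReal_def, h] at this
    simp at this
  · left; exact measure_ne_top _ _

theorem eventually_le_setLIntegral_weightedTail (hFH : IsSecondTail F H)
    (hc : ∀ x, Tendsto (fun y => tail (P x) y / tail F y) atTop (𝓝 (c x)))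
    (hL : ∀ x, ∀ y, 0 ≤ y → tail (P x) y ≤ L * tail F y)
    (hρ : ∫⁻ a, (a.1 : ℝ≥0∞) ∂ρ < ∞) (hw : ∀ i, Measurable (w i)) (hw1 : ∀ i a, w i a ≤ 1)
    {ε : ℝ} (hε : 0 < ε) :
    ∀ᶠ y in atTop, ENNReal.ofReal (((weightedLimit c ρ w).toReal - ε) * tail H y) ≤
      ∫⁻ t in Ioi y, weightedTail P ρ w t := by
  have hlt := weightedLimit_lt_top (w := w) hFH hc hL hρ hw1
  rcases le_or_gt ((weightedLimit c ρ w).toReal - ε) 0 with hneg | hpos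
  · refine Eventually.of_forall fun y => ?_
    rw [ENNReal.ofReal_of_nonpos (mul_nonpos_of_nonpos_of_nonneg hneg (tail_nonneg _ _))]
    exact zero_le
  have hlt' : ENNReal.ofReal ((weightedLimit c ρ w).toReal - ε) < weightedLimit c ρ w := by
    rw [ENNReal.ofReal_lt_iff_lt_toReal hpos.le hlt.ne]
    linarith
  have h1 := (tendsto_weightedTail_div hFH hc hL hρ hw hw1).eventually (lt_mem_nhds hlt')
  obtain ⟨y₀, hy₀⟩ := eventually_atTop.1 h1
  filter_upwards [eventually_ge_atTop y₀, hFH.eq] with y hy hy2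
  rw [ENNReal.ofReal_mul hpos.le, hy2]
  unfold integratedTail
  rw [← lintegral_const_mul _ (measurable_measure_Ioi F)]
  refine setLIntegral_mono' measurableSet_Ioi fun t ht => ?_
  exact (ENNReal.le_div_iff_mul_le (Or.inl fun h => by
    have := hFH.tail_pos t
    rw [tail, measureReal_def, h] at this
    simp at this) (Or.inl (measure_ne_top _ _))).1 (hy₀ t (hy.trans (le_of_lt ht))).le

/-- Used to remove a truncation level `K` from the weights after the limit in `y` has been taken. -/
theorem tendsto_weightedLimit (hFH : IsSecondTail F H)
    (hc : ∀ x, Tendsto (fun y => tail (P x) y / tail F y) atTop (𝓝 (c x)))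
    (hL : ∀ x, ∀ y, 0 ≤ y → tail (P x) y ≤ L * tail F y) (hcm : Measurable c)
    (hρ : ∫⁻ a, (a.1 : ℝ≥0∞) ∂ρ < ∞) {h : ℕ → ℕ → ℕ × (ℕ → 𝒳) → ℝ≥0∞}
    (hh : ∀ K i, Measurable (h K i)) (hh1 : ∀ K i a, h K i a ≤ 1)
    (hlim : ∀ i a, Tendsto (fun K => h K i a) atTop (𝓝 (w i a))) :
    Tendsto (fun K => weightedLimit c ρ (h K)) atTop (𝓝 (weightedLimit c ρ w)) := by
  unfold weightedLimit
  refine tendsto_lintegral_of_dominated_convergence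
    (fun a => (a.1 : ℝ≥0∞) * ENNReal.ofReal L) (fun K => ?_) (fun K => ae_of_all _ fun a => ?_)
    ?_ ?_
  · exact measurable_sum_range_of measurable_fst fun i => (hh K i).mul
      (hcm.comp (by fun_prop : Measurable fun a : ℕ × (ℕ → 𝒳) => a.2 i)).ennreal_ofReal
  · calc _ ≤ ∑ _i ∈ Finset.range a.1, ENNReal.ofReal L := by
          refine Finset.sum_le_sum fun i _ => ?_
          calc _ ≤ 1 * ENNReal.ofReal L := mul_le_mul' (hh1 _ _ _)
                (ENNReal.ofReal_le_ofReal (tailConstant_le hFH.tail_pos hc hL _))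
            _ = _ := one_mul _
      _ = _ := by simp
  · rw [lintegral_mul_const _ (by fun_prop)]
    exact (ENNReal.mul_lt_top hρ ENNReal.ofReal_lt_top).ne
  · refine ae_of_all _ fun a => tendsto_finsetSum _ fun i _ => ?_
    exact ENNReal.Tendsto.mul_const (hlim i a) (Or.inr ENNReal.ofReal_ne_top)

end WeightedTail

end ModulatedWalk

namespace ModulatedWalk

/-! ### Lower bound by disjoint first jumps -/

section LowerBound

variable {E : Type*} [MeasurableSpace E] {ρ : Measure E} [IsProbabilityMeasure ρ] {f : E → ℝ × ℝ}

/-- The event that the cycle `n` lies in `A`, where the walk with increments `f` stays above the line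
`-K - h n` at the beginning of this cycle, and its peaks have not exceeded `y` before. -/
def firstJump (f : E → ℝ × ℝ) (h K y : ℝ) (n : ℕ) (A : Set E) : Set (ℕ → E) :=
  {z | (-K ≤ (∑ i ∈ Finset.range n, (f (z i)).1) + h * n ∧ ∀ k < n, peak (fun i => f (z i)) k ≤ y) ∧
    z n ∈ A}

theorem measurable_peak_comp (hf : Measurable f) (n : ℕ) :
    Measurable fun z : ℕ → E => peak (fun i => f (z i)) n :=
  (measurable_peak n).comp (measurable_pi_iff.2 fun i => hf.comp (measurable_pi_apply i))

theorem measurable_sum_comp (hf : Measurable f) (n : ℕ) :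
    Measurable fun z : ℕ → E => ∑ i ∈ Finset.range n, (f (z i)).1 :=
  Finset.measurable_sum _ fun i _ => (hf.comp (measurable_pi_apply i)).fst

theorem measurableSet_firstJump (hf : Measurable f) (h K y : ℝ) (n : ℕ) {A : Set E}
    (hA : MeasurableSet A) : MeasurableSet (firstJump f h K y n A) := by
  have : firstJump f h K y n A = ({z | -K ≤ (∑ i ∈ Finset.range n, (f (z i)).1) + h * n} ∩
      ⋂ k ∈ Finset.range n, {z | peak (fun i => f (z i)) k ≤ y}) ∩ {z | z n ∈ A} := by
    ext z; simp [firstJump]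
  rw [this]
  exact ((measurableSet_le measurable_const ((measurable_sum_comp hf n).add_const _)).inter
    (Finset.measurableSet_biInter _ fun k _ => measurableSet_le (measurable_peak_comp hf k)
      measurable_const)).inter (measurable_pi_apply n hA)

/-- A jump in cycle `m` starts from at least `-K - h m` and has a maximum above `y + K + h m`, so
peak `m` exceeds `y`. A first jump in a later cycle forbids this. -/
theorem pairwise_disjoint_firstJump {h K y : ℝ} {A : ℝ → Set E} (hA : ∀ t, ∀ e ∈ A t, t < (f e).2) :
    Pairwise fun m n : ℕ => Disjoint (firstJump f h K y m (A (y + K + h * m)))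
      (firstJump f h K y n (A (y + K + h * n))) := by
  have key : ∀ m n : ℕ, m < n → Disjoint (firstJump f h K y m (A (y + K + h * m)))
      (firstJump f h K y n (A (y + K + h * n))) := by
    intro m n hmn
    rw [Set.disjoint_left]
    rintro z ⟨⟨h1, _⟩, h2⟩ ⟨⟨_, h3⟩, _⟩
    have h4 := h3 m hmn
    have h5 := hA _ _ h2
    unfold peak at h4
    linarith
  intro m n hmn
  rcases lt_or_gt_of_ne hmn with hlt | hlt
  · exact key m n hlt
  · exact (key n m hlt).symm

/-- The restriction on the past involves only the cycles before `n`. -/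
theorem firstJump_indep (hf : Measurable f) (h K y : ℝ) (n : ℕ) {A : Set E} (hA : MeasurableSet A) :
    Measure.infinitePi (fun _ : ℕ => ρ) (firstJump f h K y n A) =
      Measure.infinitePi (fun _ : ℕ => ρ) (firstJump f h K y n univ) * ρ A := by
  classical
  have hne : Nonempty E := by
    by_contra hE
    rw [not_nonempty_iff] at hE
    have h1 := measure_univ (μ := ρ)
    rw [univ_eq_empty_iff.2 hE, measure_empty] at h1
    exact zero_ne_one h1
  have hi : iIndepFun (fun (i : ℕ) (z : ℕ → E) => z i) (Measure.infinitePi fun _ => ρ) :=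
    iIndepFun_infinitePi (X := fun _ x => x) fun _ => measurable_id
  have hm := measurableSet_firstJump hf h K y n (A := univ) MeasurableSet.univ
  have hd : DependsOn ((firstJump f h K y n univ).indicator fun _ => (1 : ℝ)) (Iio n) := by
    intro x y' hxy
    have h1 : ∀ k < n, peak (fun i => f (x i)) k = peak (fun i => f (y' i)) k := by
      intro k hk
      refine dependsOn_peak k fun i hi => ?_
      simp only [mem_Iio] at hi
      rw [hxy i (mem_Iio.2 (by omega))]
    have h2 : ∑ i ∈ Finset.range n, (f (x i)).1 = ∑ i ∈ Finset.range n, (f (y' i)).1 :=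
      Finset.sum_congr rfl fun i hi => by rw [hxy i (by simpa using hi)]
    have h3 : x ∈ firstJump f h K y n univ ↔ y' ∈ firstJump f h K y n univ := by
      simp only [firstJump, mem_ofPred_eq, h2, mem_univ, and_true]
      exact and_congr_right fun _ => forall₂_congr fun k hk => by rw [h1 k hk]
    simp only [indicator, h3]
  have hd2 : DependsOn (fun z : ℕ → E => z n) ({n} : Set ℕ) := fun x y' hxy => hxy n rfl
  have hind := indepFun_of_dependsOn hi (fun i => measurable_pi_apply i)
    (S := Iio n) (T := {n}) (by simp) (measurable_const.indicator hm) (measurable_pi_apply n) hd hd2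
  have h4 := hind.measure_inter_preimage_eq_mul _ _ (measurableSet_singleton (1 : ℝ)) hA
  have h5 : (fun z : ℕ → E => (firstJump f h K y n univ).indicator (fun _ => (1 : ℝ)) fun i => z i) ⁻¹'
      {1} = firstJump f h K y n univ := by
    ext z
    by_cases hz : z ∈ firstJump f h K y n univ <;> simp [hz]
  rw [h5] at h4
  have h6 : firstJump f h K y n A = firstJump f h K y n univ ∩ (fun z : ℕ → E => z n) ⁻¹' A := by
    ext z; simp [firstJump]
  rw [h6, h4]
  congr 1
  exact (measurePreserving_eval_infinitePi (fun _ : ℕ => ρ) n).measure_preimage hA.nullMeasurableSet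

/-- The bound is uniform in `n` because it comes from two events that do not involve `n`. As `h`
exceeds the mean loss per cycle, some line `-K - h n` lies below the whole walk with high
probability; and the supremum of the peaks is almost surely finite, so a large `y` is not exceeded
at all. -/
theorem exists_le_firstJump_univ (hf : Measurable f) (hψ : Integrable (fun e => (f e).1) ρ)
    (hV : Integrable (fun e => (f e).2) ρ) (hm : ∫ e, (f e).1 ∂ρ < 0) {h : ℝ}
    (hhm : -∫ e, (f e).1 ∂ρ < h) {ε : ℝ} (hε : 0 < ε) :
    ∃ K, 0 ≤ K ∧ ∃ y₀, ∀ y ≥ y₀, ∀ n, 1 - ε ≤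
      (Measure.infinitePi fun _ : ℕ => ρ).real (firstJump f h K y n univ) := by
  set κ := Measure.infinitePi fun _ : ℕ => ρ with hκ
  have hmp := fun n => measurePreserving_eval_infinitePi (fun _ : ℕ => ρ) n
  have hid : ∀ n, IdentDistrib (fun z : ℕ → E => z n) (fun z => z 0) κ κ :=
    fun n => ⟨(measurable_pi_apply n).aemeasurable, (measurable_pi_apply 0).aemeasurable, by
      rw [show (fun z : ℕ → E => z n) = Function.eval n from rfl,
        show (fun z : ℕ → E => z 0) = Function.eval 0 from rfl, hκ, (hmp n).map_eq,
        (hmp 0).map_eq]⟩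
  have hi : iIndepFun (fun (i : ℕ) (z : ℕ → E) => z i) κ :=
    iIndepFun_infinitePi (X := fun _ x => x) fun _ => measurable_id
  have hint : ∫ z, (f (z 0)).1 ∂κ = ∫ e, (f e).1 ∂ρ := by
    calc ∫ z, (f (z 0)).1 ∂κ = ∫ e, (f e).1 ∂(κ.map (Function.eval 0)) := by
          rw [integral_map (measurable_pi_apply 0).aemeasurable hf.fst.aestronglyMeasurable]
      _ = _ := by congr 1; exact (hmp 0).map_eq
  have hψ0 : Integrable (fun z : ℕ → E => (f (z 0)).1) κ := (hmp 0).integrable_comp_of_integrable hψ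
  have hV0 : Integrable (fun z : ℕ → E => (f (z 0)).2) κ := (hmp 0).integrable_comp_of_integrable hV
  have hψi : Pairwise fun i j => IndepFun (fun z : ℕ → E => (f (z i)).1) (fun z => (f (z j)).1) κ :=
    fun i j hij => (hi.indepFun hij).comp hf.fst hf.fst
  have hVi : Pairwise fun i j => IndepFun (fun z : ℕ → E => (f (z i)).2) (fun z => (f (z j)).2) κ :=
    fun i j hij => (hi.indepFun hij).comp hf.snd hf.snd
  have hψd := fun n => (hid n).comp hf.fst
  have hVd := fun n => (hid n).comp hf.snd
  have hpk := ae_exists_peak_bound hψ0 hV0 hψi hVi hψd hVd (h := 0) (by rw [hint]; linarith)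
  have hlb := ae_exists_walk_lower_bound hψ0 hψi hψd (h := h) (by rw [hint]; linarith)
  let G1 : ℕ → Set (ℕ → E) := fun A => {z | ∀ n : ℕ, peak (fun i => f (z i)) n ≤ A}
  let G2 : ℕ → Set (ℕ → E) := fun A =>
    {z | ∀ n : ℕ, -(A : ℝ) ≤ (∑ i ∈ Finset.range n, (f (z i)).1) + h * n}
  have t1 : Tendsto (fun A => κ.real (G1 A)ᶜ) atTop (𝓝 0) := by
    refine tendsto_measure_compl_of_ae_exists (fun A => ?_) ?_ ?_
    · have : G1 A = ⋂ n : ℕ, {z | peak (fun i => f (z i)) n ≤ A} := by ext z; simp [G1]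
      rw [this]
      exact MeasurableSet.iInter fun n => measurableSet_le (measurable_peak_comp hf n) measurable_const
    · intro A A' hA z hz n
      exact (hz n).trans (by exact_mod_cast hA)
    · filter_upwards [hpk] with z ⟨A, hA⟩
      refine ⟨A, fun n => ?_⟩
      have := hA n
      simpa [peak] using this
  have t2 : Tendsto (fun A => κ.real (G2 A)ᶜ) atTop (𝓝 0) := by
    refine tendsto_measure_compl_of_ae_exists (fun A => ?_) ?_ ?_
    · have : G2 A = ⋂ n : ℕ, {z | -(A : ℝ) ≤ (∑ i ∈ Finset.range n, (f (z i)).1) + h * n} := by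
        ext z; simp [G2]
      rw [this]
      exact MeasurableSet.iInter fun n => measurableSet_le measurable_const
        ((measurable_sum_comp hf n).add_const _)
    · intro A A' hA z hz n
      have : (A : ℝ) ≤ A' := by exact_mod_cast hA
      linarith [hz n]
    · exact hlb
  obtain ⟨A1, hA1⟩ := (t1.eventually (gt_mem_nhds (half_pos hε))).exists
  obtain ⟨A2, hA2⟩ := (t2.eventually (gt_mem_nhds (half_pos hε))).exists
  refine ⟨A2, by positivity, A1, fun y hy n => ?_⟩
  have hmeas := measurableSet_firstJump hf h A2 y n (A := univ) MeasurableSet.univ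
  have hsub : (firstJump f h A2 y n univ)ᶜ ⊆ (G1 A1)ᶜ ∪ (G2 A2)ᶜ := by
    rw [← compl_inter]
    refine compl_subset_compl.2 ?_
    rintro z ⟨h1, h2⟩
    exact ⟨⟨h2 n, fun k _ => (h1 k).trans hy⟩, mem_univ _⟩
  have h1 := (measureReal_mono hsub (μ := κ)).trans (measureReal_union_le _ _)
  rw [probReal_compl_eq_one_sub hmeas] at h1
  linarith

/-- The lower bound in Veraverbeke's theorem, for jumps in a prescribed family of sets of cycles. -/
theorem exists_le_iUnion_firstJump (hf : Measurable f) (hψ : Integrable (fun e => (f e).1) ρ)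
    (hV : Integrable (fun e => (f e).2) ρ) (hm : ∫ e, (f e).1 ∂ρ < 0) {h : ℝ}
    (hhm : -∫ e, (f e).1 ∂ρ < h) {ε : ℝ} (hε : 0 < ε) :
    ∃ K, 0 ≤ K ∧ ∃ y₀, ∀ y ≥ y₀, ∀ A : ℝ → Set E, Antitone A → (∀ t, MeasurableSet (A t)) →
      (∀ t, ∀ e ∈ A t, t < (f e).2) →
      ENNReal.ofReal (1 - ε) * ∫⁻ t in Ioi (y + K), ρ (A t) ≤ ENNReal.ofReal h *
        Measure.infinitePi (fun _ : ℕ => ρ) (⋃ n : ℕ, firstJump f h K y n (A (y + K + h * n))) := by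
  obtain ⟨K, hK, y₀, hy₀⟩ := exists_le_firstJump_univ hf hψ hV hm hhm hε
  refine ⟨K, hK, y₀, fun y hy A hanti hA hAV => ?_⟩
  rw [measure_iUnion (pairwise_disjoint_firstJump hAV)
    fun n => measurableSet_firstJump hf _ _ _ _ (hA _)]
  have h1 : ∫⁻ t in Ioi (y + K), ρ (A t) ≤ ENNReal.ofReal h * ∑' n : ℕ, ρ (A (y + K + h * n)) :=
    setLIntegral_le_tsum (g := fun t => ρ (A t)) (fun s t hst => measure_mono (hanti hst))
      (by linarith) _
  calc _ ≤ ENNReal.ofReal (1 - ε) * (ENNReal.ofReal h * ∑' n : ℕ, ρ (A (y + K + h * n))) := by gcongr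
    _ = ENNReal.ofReal h * ∑' n : ℕ, ENNReal.ofReal (1 - ε) * ρ (A (y + K + h * n)) := by
        rw [ENNReal.tsum_mul_left]; ring
    _ ≤ _ := by
        gcongr with n
        rw [firstJump_indep hf h K y n (hA _)]
        gcongr
        exact ENNReal.ofReal_le_of_le_toReal (hy₀ y hy n)

end LowerBound

end ModulatedWalk

namespace ModulatedWalk

section LowerBoundReal

variable {ρ : Measure (ℝ × ℝ)} [IsProbabilityMeasure ρ]

theorem exists_le_exceed (hψ : Integrable (fun p : ℝ × ℝ => p.1) ρ)
    (hV : Integrable (fun p : ℝ × ℝ => p.2) ρ) (hm : ∫ p, p.1 ∂ρ < 0) {h : ℝ}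
    (hhm : -∫ p, p.1 ∂ρ < h) {ε : ℝ} (hε : 0 < ε) :
    ∃ K, 0 ≤ K ∧ ∀ᶠ y in atTop,
      (1 - ε) * (peakTail ρ (y + K)).toReal ≤ h * (seqLaw ρ).real (exceed y) := by
  obtain ⟨K, hK, y₀, hy₀⟩ := exists_le_iUnion_firstJump (f := id) measurable_id hψ hV hm hhm hε
  refine ⟨K, hK, ?_⟩
  filter_upwards [eventually_ge_atTop y₀] with y hy
  rcases le_total ε 1 with hε1 | hε1
  swap
  · refine (mul_nonpos_of_nonpos_of_nonneg (by linarith) ENNReal.toReal_nonneg).trans ?_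
    exact mul_nonneg (by linarith) measureReal_nonneg
  have h1 := hy₀ y hy (fun t => {p | t < p.2}) (fun s t hst p hp => hst.trans_lt hp)
    (fun t => measurableSet_lt measurable_const measurable_snd) (fun t e he => he)
  have h2 : (⋃ n : ℕ, firstJump id h K y n {p : ℝ × ℝ | y + K + h * n < p.2}) ⊆ exceed y := by
    refine iUnion_subset fun n => ?_
    rintro z ⟨⟨h3, _⟩, h4⟩
    refine Or.inr ⟨n, ?_⟩
    have h5 : y + K + h * n < (z n).2 := h4
    simp only [id] at h3
    unfold peak
    linarith
  have h6 : ∫⁻ t in Ioi (y + K), ρ {p | t < p.2} = peakTail ρ (y + K) := by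
    unfold peakTail integratedTail
    refine lintegral_congr fun t => ?_
    rw [Measure.map_apply measurable_snd measurableSet_Ioi]
    rfl
  rw [h6] at h1
  have h7 := h1.trans (mul_le_mul_right (measure_mono h2) _)
  have h8 := ENNReal.toReal_mono (ENNReal.mul_ne_top ENNReal.ofReal_ne_top (measure_ne_top _ _)) h7
  rwa [ENNReal.toReal_mul, ENNReal.toReal_mul, ENNReal.toReal_ofReal (by linarith),
    ENNReal.toReal_ofReal (by linarith)] at h8

end LowerBoundReal

/-! ### The random walk with i.i.d. steps -/

section Independent

/-- The event that the random walk with increments `quantile ν (u l) - b` exceeds `y`. -/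
def walkExceed (ν : Measure ℝ) (b y : ℝ) : Set (ℕ → ℝ) :=
  {u | y < 0 ∨ ∃ m, y < ∑ l ∈ Finset.range m, (quantile ν (u l) - b)}

/-- The law of `(ζ - b, max (ζ - b) 0)` where `ζ` has law `ν`. -/
noncomputable def stepLaw (ν : Measure ℝ) (b : ℝ) : Measure (ℝ × ℝ) :=
  ν.map fun t => (t - b, max (t - b) 0)

variable {ν : Measure ℝ} [IsProbabilityMeasure ν] {b : ℝ}

instance : IsProbabilityMeasure (stepLaw ν b) :=
  Measure.isProbabilityMeasure_map (by fun_prop)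

theorem antitone_walkExceed (ν : Measure ℝ) (b : ℝ) : Antitone (walkExceed ν b) := by
  rintro x y h u (h1 | ⟨m, h1⟩)
  · exact Or.inl (h.trans_lt h1)
  · exact Or.inr ⟨m, h.trans_lt h1⟩

theorem seqLaw_stepLaw : seqLaw (stepLaw ν b) = unifSeq.map
    fun u i => (quantile ν (u i) - b, max (quantile ν (u i) - b) 0) := by
  have hq := measurable_quantile ν
  have h := Measure.infinitePi_map_pi (μ := fun _ : ℕ => unif)
    (f := fun _ u => (quantile ν u - b, max (quantile ν u - b) 0)) (fun _ => by fun_prop)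
  rw [unifSeq, h, seqLaw]
  congr 1
  funext i
  rw [stepLaw]
  conv_lhs => rw [← unif_map_quantile ν, Measure.map_map (by fun_prop) hq]
  rfl

/-- Each step is a cycle of length one. A partial sum of `m + 1` steps is at most the peak of cycle
`m`, and the empty sum belongs to the clause `y < 0`. -/
theorem unifSeq_walkExceed_le (y : ℝ) :
    unifSeq.real (walkExceed ν b y) ≤ (seqLaw (stepLaw ν b)).real (exceed y) := by
  have hq := measurable_quantile ν
  rw [seqLaw_stepLaw, map_measureReal_apply (by fun_prop) (measurableSet_exceed y)]
  refine measureReal_mono ?_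
  rintro u (h | ⟨m, h⟩)
  · exact Or.inl h
  rcases m with _ | m
  · left; simpa using h
  · refine Or.inr ⟨m, h.trans_le ?_⟩
    rw [Finset.sum_range_succ]
    exact add_le_add le_rfl (le_max_left _ _)

theorem stepLaw_le : ∀ᵐ p ∂(stepLaw ν b), 0 ≤ p.2 ∧ p.1 ≤ p.2 := by
  have hS : MeasurableSet {p : ℝ × ℝ | 0 ≤ p.2 ∧ p.1 ≤ p.2} :=
    (measurableSet_le measurable_const measurable_snd).inter
      (measurableSet_le measurable_fst measurable_snd)
  exact (ae_map_iff (by fun_prop) hS).2 (ae_of_all _ fun t => ⟨le_max_right _ _, le_max_left _ _⟩)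

theorem integrable_stepLaw_fst (hν : Integrable (fun t : ℝ => t) ν) :
    Integrable (fun p : ℝ × ℝ => p.1) (stepLaw ν b) := by
  rw [stepLaw, integrable_map_measure (by fun_prop) (by fun_prop)]
  exact hν.sub (integrable_const b)

theorem integrable_stepLaw_snd (hν : Integrable (fun t : ℝ => t) ν) :
    Integrable (fun p : ℝ × ℝ => p.2) (stepLaw ν b) := by
  rw [stepLaw, integrable_map_measure (by fun_prop) (by fun_prop)]
  exact (hν.sub (integrable_const b)).sup (integrable_zero ..)

theorem integral_stepLaw_fst (hν : Integrable (fun t : ℝ => t) ν) :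
    ∫ p, p.1 ∂(stepLaw ν b) = ∫ t, t ∂ν - b := by
  rw [stepLaw, integral_map (by fun_prop) (by fun_prop)]
  simp only
  rw [integral_sub hν (integrable_const b)]
  simp

theorem peakTail_stepLaw {y : ℝ} (hy : 0 ≤ y) : peakTail (stepLaw ν b) y = integratedTail ν (y + b) := by
  unfold peakTail
  rw [stepLaw, Measure.map_map measurable_snd (by fun_prop), ← lintegral_ofReal_sub_eq,
    ← lintegral_ofReal_sub_eq, lintegral_map (by fun_prop) (by fun_prop)]
  refine lintegral_congr fun t => ?_
  simp only [Function.comp]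
  rcases le_total (t - b) 0 with h | h
  · rw [max_eq_right h, ENNReal.ofReal_of_nonpos (by linarith), ENNReal.ofReal_of_nonpos (by linarith)]
  · rw [max_eq_left h]; congr 1; ring

variable {H : Measure ℝ} [IsProbabilityMeasure H]

theorem eventually_shift_bound (hH : HeavyTail H) {g : ℝ → ℝ} {C : ℝ}
    (hC : ∀ᶠ y in atTop, g y ≤ C * tail H y) (k : ℝ) :
    ∀ᶠ y in atTop, g (y - k) ≤ 2 * max C 0 * tail H y := by
  filter_upwards [(tendsto_atTop_add_const_right atTop (-k) tendsto_id).eventually hC,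
    hH.eventually_shift_le k one_lt_two] with y h1 h2
  simp only [id] at h1
  rw [← sub_eq_add_neg] at h1
  calc g (y - k) ≤ C * tail H (y - k) := h1
    _ ≤ max C 0 * tail H (y - k) := by gcongr; exact tail_nonneg _ _; exact le_max_left _ _
    _ ≤ max C 0 * (2 * tail H y) := by gcongr
    _ = _ := by ring

theorem eventually_peakTail_stepLaw_le (hH : HeavyTail H) {C : ℝ}
    (hC : ∀ᶠ y in atTop, (integratedTail ν y).toReal ≤ C * tail H y) :
    ∀ᶠ y in atTop, (peakTail (stepLaw ν b) y).toReal ≤ 2 * max C 0 * tail H y := by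
  filter_upwards [eventually_shift_bound hH hC (-b), eventually_ge_atTop 0] with y h1 h2
  rwa [peakTail_stepLaw h2, ← sub_neg_eq_add]

theorem exists_walkExceed_bound (hH : HeavyTail H) (hν : Integrable (fun t : ℝ => t) ν) {C : ℝ}
    (hC : ∀ᶠ y in atTop, (integratedTail ν y).toReal ≤ C * tail H y) (hb : ∫ t, t ∂ν < b) :
    ∃ R, 0 ≤ R ∧ ∀ t, 0 ≤ t → unifSeq.real (walkExceed ν b t) ≤ R * tail H t := by
  obtain ⟨R, hR, h⟩ := exists_exceed_bound hH stepLaw_le (integrable_stepLaw_fst hν (b := b))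
    (integrable_stepLaw_snd hν) (by rw [integral_stepLaw_fst hν]; linarith)
    (eventually_peakTail_stepLaw_le hH hC)
  exact ⟨R, hR, fun t ht => (unifSeq_walkExceed_le t).trans (h t ht)⟩

theorem eventually_walkExceed_le (hH : HeavyTail H) (hν : Integrable (fun t : ℝ => t) ν) {C : ℝ}
    (hC : ∀ᶠ y in atTop, (integratedTail ν y).toReal ≤ C * tail H y) {h : ℝ} (hh : 0 < h)
    (hhm : h < b - ∫ t, t ∂ν) {ε : ℝ} (hε : 0 < ε) :
    ∃ K, ∀ᶠ y in atTop, unifSeq.real (walkExceed ν b y) ≤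
      h⁻¹ * (integratedTail ν (y - K)).toReal + ε * tail H y := by
  obtain ⟨K, hK⟩ := eventually_exceed_le hH stepLaw_le (integrable_stepLaw_fst hν (b := b))
    (integrable_stepLaw_snd hν) (eventually_peakTail_stepLaw_le hH hC) hh
    (by rw [integral_stepLaw_fst hν]; linarith) hε
  refine ⟨K - b, ?_⟩
  filter_upwards [hK, eventually_ge_atTop K] with y h1 h2
  refine (unifSeq_walkExceed_le y).trans (h1.trans ?_)
  rw [peakTail_stepLaw (by linarith), show y - K + b = y - (K - b) by ring]

end Independent

end ModulatedWalk

namespace ModulatedWalk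

/-! ### Grouping i.i.d. steps into cycles of random length -/

section Overshoot

variable {𝒳 : Type*} [MeasurableSpace 𝒳]

/-- The supremum over the cycles `n` of `b k_n - δ (k_0 + … + k_{n-1})`, where `k_n` is the length of
the cycle. -/
noncomputable def lengthSup (b δ : ℝ) (w : ℕ → ℕ × (ℕ → 𝒳)) : ℝ≥0∞ :=
  ⨆ n, ENNReal.ofReal (b * (w n).1 - δ * (blockStart (fun i => (w i).1) n : ℝ))

theorem measurable_lengthSup (b δ : ℝ) :
    Measurable (lengthSup b δ : (ℕ → ℕ × (ℕ → 𝒳)) → ℝ≥0∞) := by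
  refine Measurable.iSup fun n => ?_
  have h1 : Measurable fun w : ℕ → ℕ × (ℕ → 𝒳) => ((w n).1 : ℝ) := by fun_prop
  have h2 : Measurable fun w : ℕ → ℕ × (ℕ → 𝒳) => (blockStart (fun i => (w i).1) n : ℝ) :=
    measurable_from_top.comp ((measurable_blockStart n).comp
      (measurable_pi_iff.2 fun i => (measurable_pi_apply i).fst))
  exact ((h1.const_mul b).sub (h2.const_mul δ)).ennreal_ofReal

variable {ρ : Measure (ℕ × (ℕ → 𝒳))} [IsProbabilityMeasure ρ] {F H : Measure ℝ}
  [IsProbabilityMeasure F] [IsProbabilityMeasure H] {b δ : ℝ}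

theorem ae_one_le_length (h1 : ∀ᵐ a ∂ρ, 1 ≤ a.1) :
    ∀ᵐ w ∂(Measure.infinitePi fun _ : ℕ => ρ), ∀ n, 1 ≤ (w n).1 := by
  rw [ae_all_iff]
  intro n
  exact (measurePreserving_eval_infinitePi (fun _ : ℕ => ρ) n).quasiMeasurePreserving.ae h1

theorem le_blockStart {ℓ : ℕ → ℕ} (hℓ : ∀ n, 1 ≤ ℓ n) (n : ℕ) : n ≤ blockStart ℓ n := by
  unfold blockStart
  calc n = ∑ _i ∈ Finset.range n, 1 := by simp
    _ ≤ _ := Finset.sum_le_sum fun i _ => hℓ i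

/-- Since every cycle has length at least `1`, the supremum exceeds `y` only if `b k_n > y + δ n`
for some `n`. The sum of these probabilities is compared with an integral. -/
theorem measure_lengthSup_le (h1 : ∀ᵐ a ∂ρ, 1 ≤ a.1) (hδ : 0 < δ) {y : ℝ} (hy : 0 ≤ y) :
    ENNReal.ofReal δ * Measure.infinitePi (fun _ : ℕ => ρ) {w | ENNReal.ofReal y < lengthSup b δ w} ≤
      ∫⁻ t in Ioi (y - δ), ρ {a | t < b * (a.1 : ℝ)} := by
  refine le_trans ?_ (tsum_shift_le_setLIntegral (g := fun t => ρ {a | t < b * (a.1 : ℝ)})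
    (fun s t hst => measure_mono fun a (ha : t < b * (a.1 : ℝ)) => hst.trans_lt ha) hδ (y - δ))
  gcongr
  have hsub : ∀ᵐ w ∂(Measure.infinitePi fun _ : ℕ => ρ), w ∈ {w | ENNReal.ofReal y < lengthSup b δ w} →
      w ∈ ⋃ n : ℕ, {w : ℕ → ℕ × (ℕ → 𝒳) | y - δ + δ + δ * n < b * ((w n).1 : ℝ)} := by
    filter_upwards [ae_one_le_length h1] with w hw hwy
    have hwy' : ENNReal.ofReal y < lengthSup b δ w := hwy
    unfold lengthSup at hwy'
    obtain ⟨n, hn⟩ := lt_iSup_iff.1 hwy'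
    rw [ENNReal.ofReal_lt_ofReal_iff_of_nonneg hy] at hn
    refine mem_iUnion.2 ⟨n, ?_⟩
    have h2 : (n : ℝ) ≤ blockStart (fun i => (w i).1) n := by exact_mod_cast le_blockStart hw n
    have h3 := mul_le_mul_of_nonneg_left h2 hδ.le
    change y - δ + δ + δ * n < b * ((w n).1 : ℝ)
    linarith
  refine (measure_mono_ae hsub).trans ((measure_iUnion_le _).trans ?_)
  refine ENNReal.tsum_le_tsum fun n => le_of_eq ?_
  have hA : MeasurableSet {a : ℕ × (ℕ → 𝒳) | y - δ + δ + δ * n < b * (a.1 : ℝ)} :=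
    measurableSet_lt measurable_const (by fun_prop)
  exact (measurePreserving_eval_infinitePi (fun _ : ℕ => ρ) n).measure_preimage hA.nullMeasurableSet

theorem eventually_lengthSup_le (hFH : IsSecondTail F H) (h1 : ∀ᵐ a ∂ρ, 1 ≤ a.1) (hδ : 0 < δ)
    (hτ : (fun y => ρ.real {a | y < b * (a.1 : ℝ)}) =o[atTop] tail F) {ε : ℝ} (hε : 0 < ε) :
    ∀ᶠ y in atTop, (Measure.infinitePi fun _ : ℕ => ρ).real {w | ENNReal.ofReal y < lengthSup b δ w} ≤
      ε * tail H y := by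
  have hη : 0 < ε * δ / 2 := by positivity
  obtain ⟨y₀, hy₀⟩ := eventually_atTop.1 (hτ.bound hη)
  have hsh := tendsto_atTop_add_const_right atTop (-δ) tendsto_id
  filter_upwards [eventually_ge_atTop (y₀ + δ), eventually_ge_atTop 0, hsh.eventually hFH.eq,
    hFH.heavy.eventually_shift_le δ one_lt_two] with y h2 h3 h4 h5
  simp only [id, ← sub_eq_add_neg] at h4
  have h6 : ∫⁻ t in Ioi (y - δ), ρ {a | t < b * (a.1 : ℝ)} ≤
      ENNReal.ofReal (ε * δ / 2) * integratedTail F (y - δ) := by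
    unfold integratedTail
    rw [← lintegral_const_mul _ (measurable_measure_Ioi F)]
    refine setLIntegral_mono' measurableSet_Ioi fun t ht => ?_
    have h7 := hy₀ t (by linarith [mem_Ioi.1 ht])
    rw [Real.norm_of_nonneg measureReal_nonneg, Real.norm_of_nonneg (tail_nonneg _ _)] at h7
    have h8 := ENNReal.ofReal_le_ofReal h7
    rwa [ofReal_measureReal, ENNReal.ofReal_mul hη.le, ofReal_tail] at h8
  have h9 := (measure_lengthSup_le (b := b) h1 hδ h3).trans h6
  rw [← h4, ← ENNReal.ofReal_mul hη.le] at h9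
  have h10 := ENNReal.toReal_mono ENNReal.ofReal_ne_top h9
  rw [ENNReal.toReal_mul, ENNReal.toReal_ofReal hδ.le,
    ENNReal.toReal_ofReal (mul_nonneg hη.le (tail_nonneg _ _)), ← measureReal_def] at h10
  rw [← mul_le_mul_iff_right₀ hδ]
  refine h10.trans ?_
  calc ε * δ / 2 * tail H (y - δ) ≤ ε * δ / 2 * (2 * tail H y) := by gcongr
    _ = _ := by ring

theorem ae_lengthSup_lt_top (hFH : IsSecondTail F H) (h1 : ∀ᵐ a ∂ρ, 1 ≤ a.1) (hδ : 0 < δ)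
    (hτ : (fun y => ρ.real {a | y < b * (a.1 : ℝ)}) =o[atTop] tail F) :
    ∀ᵐ w ∂(Measure.infinitePi fun _ : ℕ => ρ), lengthSup b δ w < ∞ := by
  have h2 : (Measure.infinitePi fun _ : ℕ => ρ).real {w | ¬ lengthSup b δ w < ∞} ≤ 0 := by
    have h3 := (tendsto_tail_atTop H).const_mul 1
    rw [mul_zero] at h3
    refine ge_of_tendsto h3 ?_
    filter_upwards [eventually_lengthSup_le hFH h1 hδ hτ zero_lt_one] with y hy
    refine (measureReal_mono fun w (hw : ¬ lengthSup b δ w < ∞) => ?_).trans hy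
    rw [not_lt, top_le_iff] at hw
    change ENNReal.ofReal y < lengthSup b δ w
    rw [hw]; exact ENNReal.ofReal_lt_top
  rw [ae_iff]
  exact (measureReal_eq_zero_iff).1 (le_antisymm h2 measureReal_nonneg)

variable {ν : Measure ℝ} [IsProbabilityMeasure ν]

/-- The increment of a cycle corrected by its length, and the maximum within the cycle. -/
noncomputable def cyclePair (q : 𝒳 → ℝ → ℝ) (d : ℝ) (z : (ℕ × (ℕ → 𝒳)) × (ℕ → ℝ)) : ℝ × ℝ :=
  (cycleSum q z - d * z.1.1, cycleMax q z)

theorem measurable_cyclePair {q : 𝒳 → ℝ → ℝ} (hq : Measurable fun p : 𝒳 × ℝ => q p.1 p.2) (d : ℝ) :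
    Measurable (cyclePair q d) := by
  have h : Measurable fun z : (ℕ × (ℕ → 𝒳)) × (ℕ → ℝ) => (z.1.1 : ℝ) := by fun_prop
  exact ((measurable_cycleSum hq).sub (h.const_mul d)).prodMk (measurable_cycleMax hq)

/-- Completed cycles are charged `b + δ` per step, the maximum of the current cycle nothing. At
offset `j` of cycle `n` the height is that of the walk with steps `ζ - b` plus `b j - δ (k_0 + … +
k_{n-1})`, and this excess is at most `lengthSup`, whatever the sign of `b`. -/
theorem concat_mem_walkExceed {w : ℕ → ℕ × (ℕ → 𝒳)} (hw : ∀ n, 1 ≤ (w n).1)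
    (hfin : lengthSup b δ w < ∞) (hδ : 0 ≤ δ) {u : ℕ → ℕ → ℝ} {y : ℝ}
    (h : (fun n => cyclePair (fun _ => quantile ν) (b + δ) (w n, u n)) ∈ exceed y) :
    concat (fun n => (w n).1) u ∈ walkExceed ν b (y - (lengthSup b δ w).toReal) := by
  set M := (lengthSup b δ w).toReal with hM
  have hM0 : 0 ≤ M := ENNReal.toReal_nonneg
  rcases h with h | ⟨n, h⟩
  · left; linarith
  set ℓ : ℕ → ℕ := fun n => (w n).1 with hℓ
  have hMn : b * (ℓ n) - δ * (blockStart ℓ n : ℝ) ≤ M := by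
    rw [hM, ← ENNReal.ofReal_le_iff_le_toReal hfin.ne]
    exact le_iSup (fun n => ENNReal.ofReal (b * (w n).1 - δ * (blockStart (fun i => (w i).1) n : ℝ))) n
  simp only [peak, cyclePair] at h
  have h' : y - ∑ i ∈ Finset.range n, (cycleSum (fun _ : 𝒳 => quantile ν) (w i, u i) - (b + δ) * (ℓ i)) <
      cycleMax (fun _ : 𝒳 => quantile ν) (w n, u n) := by linarith
  obtain ⟨j, hj, hlt⟩ := lt_cycleMax_iff.1 h'
  refine Or.inr ⟨blockStart ℓ n + j, ?_⟩
  rw [sum_range_blockStart_add (ℓ := ℓ) (Y := fun i => quantile ν (concat ℓ u i) - b)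
    (y := fun n i => quantile ν (u n i) - b)
    (fun n i hi => by rw [concat_apply (fun n _ => hw n) u hi]) n (j := j) hj]
  simp only [Finset.sum_sub_distrib, Finset.sum_const, Finset.card_range, nsmul_eq_mul, ← Finset.mul_sum,
    ← Finset.sum_mul, cycleSum, partSum] at hlt ⊢
  have hs : (blockStart ℓ n : ℝ) = ∑ i ∈ Finset.range n, (ℓ i : ℝ) := by
    unfold blockStart; push_cast; rfl
  rw [← hs] at hlt ⊢
  have hbs : (0 : ℝ) ≤ blockStart ℓ n := by positivity
  have hjl : (j : ℝ) ≤ ℓ n := by exact_mod_cast hj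
  have hbj : b * j - δ * (blockStart ℓ n : ℝ) ≤ M := by
    rcases le_total 0 b with hb | hb
    · have := mul_le_mul_of_nonneg_left hjl hb
      linarith
    · have h1 : b * j ≤ 0 := mul_nonpos_of_nonpos_of_nonneg hb (by positivity)
      have h2 : 0 ≤ δ * (blockStart ℓ n : ℝ) := by positivity
      linarith
  linarith

theorem infinitePi_map_pairs :
    ((Measure.infinitePi fun _ : ℕ => ρ).prod unifArray).map (fun p n => (p.1 n, p.2 n)) =
      Measure.infinitePi fun _ : ℕ => ρ.prod unifSeq := by
  have hi : iIndepFun (fun (i : ℕ) (z : ℕ → ℕ × (ℕ → 𝒳)) => z i) (Measure.infinitePi fun _ => ρ) :=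
    iIndepFun_infinitePi (X := fun _ x => x) fun _ => measurable_id
  have h := iIndepFun_pair hi (fun n => measurable_pi_apply n) unifSeq
  have h2 := h.map_fun_eq_infinitePi_map (fun n => by fun_prop)
  rw [unifArray, h2]
  congr 1
  funext n
  rw [map_pair_eval (W := fun (i : ℕ) (z : ℕ → ℕ × (ℕ → 𝒳)) => z i) (fun n => measurable_pi_apply n)]
  congr 1
  exact (measurePreserving_eval_infinitePi (fun _ : ℕ => ρ) n).map_eq

/-- The law of `cyclePair` for a cycle with random marks. -/
noncomputable def pairLaw (ρ : Measure (ℕ × (ℕ → 𝒳))) (q : 𝒳 → ℝ → ℝ) (d : ℝ) : Measure (ℝ × ℝ) :=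
  (ρ.prod unifSeq).map (cyclePair q d)

theorem seqLaw_pairLaw {q : 𝒳 → ℝ → ℝ} (hq : Measurable fun p : 𝒳 × ℝ => q p.1 p.2) (d : ℝ) :
    seqLaw (pairLaw ρ q d) = ((Measure.infinitePi fun _ : ℕ => ρ).prod unifArray).map
      fun p n => cyclePair q d (p.1 n, p.2 n) := by
  have hm := measurable_cyclePair hq d
  rw [seqLaw, pairLaw, ← Measure.infinitePi_map_pi (μ := fun _ : ℕ => ρ.prod unifSeq)
    (f := fun _ => cyclePair q d) (fun _ => hm), ← infinitePi_map_pairs,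
    Measure.map_map (g := fun (x : ℕ → (ℕ × (ℕ → 𝒳)) × (ℕ → ℝ)) i => cyclePair q d (x i))
      (measurable_pi_iff.2 fun i => hm.comp (measurable_pi_apply i))
      (measurable_pi_iff.2 fun i => by fun_prop)]
  rfl

theorem measurableSet_concat_walkExceed {S : Type*} [MeasurableSpace S] {ℓ : S → ℕ → ℕ}
    (hℓ : Measurable ℓ) {g : S → ℝ} (hg : Measurable g) (ν : Measure ℝ) [IsProbabilityMeasure ν]
    (b : ℝ) :
    MeasurableSet {p : S × (ℕ → ℕ → ℝ) | concat (ℓ p.1) p.2 ∈ walkExceed ν b (g p.1)} := by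
  have hc : Measurable fun p : S × (ℕ → ℕ → ℝ) => concat (ℓ p.1) p.2 :=
    measurable_concat.comp ((hℓ.comp measurable_fst).prodMk measurable_snd)
  have hq := measurable_quantile ν
  have : {p : S × (ℕ → ℕ → ℝ) | concat (ℓ p.1) p.2 ∈ walkExceed ν b (g p.1)} =
      {p | g p.1 < 0} ∪ ⋃ m : ℕ, {p | g p.1 < ∑ l ∈ Finset.range m,
        (quantile ν (concat (ℓ p.1) p.2 l) - b)} := by
    ext p; simp [walkExceed]
  rw [this]
  refine (measurableSet_lt (hg.comp measurable_fst) measurable_const).union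
    (MeasurableSet.iUnion fun m => measurableSet_lt (hg.comp measurable_fst)
      (Finset.measurable_sum _ fun l _ => (hq.comp ((measurable_pi_apply l).comp hc)).sub_const b))

/-- For fixed lengths the concatenated marks are i.i.d. with a law that does not depend on the
lengths. So the walk with steps `ζ - b` is independent of `lengthSup`, and a convolution results. -/
theorem exceed_pairLaw_le (hFH : IsSecondTail F H) (h1 : ∀ᵐ a ∂ρ, 1 ≤ a.1) (hδ : 0 < δ)
    (hτ : (fun y => ρ.real {a | y < b * (a.1 : ℝ)}) =o[atTop] tail F) (y : ℝ) :
    seqLaw (pairLaw ρ (fun _ => quantile ν) (b + δ)) (exceed y) ≤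
      ∫⁻ s, ENNReal.ofReal (unifSeq.real (walkExceed ν b (y - s)))
        ∂((Measure.infinitePi fun _ : ℕ => ρ).map fun w => (lengthSup b δ w).toReal) := by
  have hq : Measurable fun p : 𝒳 × ℝ => quantile ν p.2 := (measurable_quantile ν).comp measurable_snd
  have hM := (measurable_lengthSup (𝒳 := 𝒳) b δ).ennreal_toReal
  have hℓ : Measurable fun (w : ℕ → ℕ × (ℕ → 𝒳)) n => (w n).1 :=
    measurable_pi_iff.2 fun i => (measurable_pi_apply i).fst
  have hmeas := measurableSet_concat_walkExceed hℓ (hM.const_sub y) ν b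
  have hanti : Antitone fun t => ENNReal.ofReal (unifSeq.real (walkExceed ν b t)) := fun s t hst =>
    ENNReal.ofReal_le_ofReal (measureReal_mono (antitone_walkExceed ν b hst))
  rw [seqLaw_pairLaw (q := fun _ => quantile ν) hq,
    Measure.map_apply (f := fun (p : (ℕ → ℕ × (ℕ → 𝒳)) × (ℕ → ℕ → ℝ)) n =>
        cyclePair (fun _ => quantile ν) (b + δ) (p.1 n, p.2 n))
      (measurable_pi_iff.2 fun i => (measurable_cyclePair (q := fun _ => quantile ν) hq _).comp
        (by fun_prop)) (measurableSet_exceed y), lintegral_map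
    (f := fun s => ENNReal.ofReal (unifSeq.real (walkExceed ν b (y - s))))
    (hanti.measurable.comp (measurable_const.sub measurable_id)) hM]
  calc _ ≤ ((Measure.infinitePi fun _ : ℕ => ρ).prod unifArray)
        {p | concat (fun n => (p.1 n).1) p.2 ∈ walkExceed ν b (y - (lengthSup b δ p.1).toReal)} := by
        refine measure_mono_ae ?_
        have ha : ∀ᵐ p ∂((Measure.infinitePi fun _ : ℕ => ρ).prod unifArray),
            (∀ n, 1 ≤ (p.1 n).1) ∧ lengthSup b δ p.1 < ∞ :=
          Measure.quasiMeasurePreserving_fst.ae ((ae_one_le_length h1).and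
            (ae_lengthSup_lt_top hFH h1 hδ hτ))
        filter_upwards [ha] with p hp hpy
        exact concat_mem_walkExceed hp.1 hp.2 hδ.le hpy
    _ = _ := by
        rw [Measure.prod_apply hmeas]
        refine lintegral_congr fun w => ?_
        have hc : Measurable (concat (fun n => (w n).1) : (ℕ → ℕ → ℝ) → ℕ → ℝ) :=
          measurable_concat.comp (measurable_const.prodMk measurable_id)
        have hw : MeasurableSet (walkExceed ν b (y - (lengthSup b δ w).toReal)) := by
          have hqν := measurable_quantile ν
          have : walkExceed ν b (y - (lengthSup b δ w).toReal) =
              {_u | y - (lengthSup b δ w).toReal < 0} ∪ ⋃ m : ℕ, {u | y - (lengthSup b δ w).toReal <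
                ∑ l ∈ Finset.range m, (quantile ν (u l) - b)} := by
            ext p; simp [walkExceed]
          rw [this]
          exact (MeasurableSet.const _).union (MeasurableSet.iUnion fun m =>
            measurableSet_lt measurable_const (by fun_prop))
        rw [ofReal_measureReal, ← unifArray_map_concat (fun n => (w n).1), Measure.map_apply hc hw]
        rfl

/-- In the convolution, `lengthSup` has a tail negligible against `tail H` and the i.i.d. walk one
of order at most `tail H`. Up to a shift, only the walk remains. -/
theorem eventually_exceed_pairLaw_le (hFH : IsSecondTail F H) (h1 : ∀ᵐ a ∂ρ, 1 ≤ a.1) (hδ : 0 < δ)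
    (hτ : (fun y => ρ.real {a | y < b * (a.1 : ℝ)}) =o[atTop] tail F)
    (hν : Integrable (fun t : ℝ => t) ν) {C : ℝ}
    (hC : ∀ᶠ y in atTop, (integratedTail ν y).toReal ≤ C * tail H y) (hb : ∫ t, t ∂ν < b)
    {ε : ℝ} (hε : 0 < ε) : ∃ B, ∀ᶠ y in atTop,
      (seqLaw (pairLaw ρ (fun _ => quantile ν) (b + δ))).real (exceed y) ≤
        unifSeq.real (walkExceed ν b (y - B)) + ε * tail H y := by
  obtain ⟨R, hR0, hR⟩ := exists_walkExceed_bound hFH.heavy hν hC hb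
  have hM := (measurable_lengthSup (𝒳 := 𝒳) b δ).ennreal_toReal
  set Λ := (Measure.infinitePi fun _ : ℕ => ρ).map fun w => (lengthSup b δ w).toReal with hΛ
  have : IsProbabilityMeasure Λ := Measure.isProbabilityMeasure_map hM.aemeasurable
  have hΛle : ∀ y, 0 ≤ y → Λ.real (Ioi y) ≤
      (Measure.infinitePi fun _ : ℕ => ρ).real {w | ENNReal.ofReal y < lengthSup b δ w} := by
    intro y hy
    rw [hΛ, map_measureReal_apply hM measurableSet_Ioi]
    refine measureReal_mono fun w (hw : y < (lengthSup b δ w).toReal) => ?_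
    have hne : lengthSup b δ w ≠ ∞ := by
      intro h
      rw [h, ENNReal.toReal_top] at hw
      linarith
    exact (ENNReal.ofReal_lt_iff_lt_toReal hy hne).2 hw
  obtain ⟨C', hC'0, hC'⟩ := hFH.heavy.exists_bound (K := 1) (g := fun t => Λ.real (Ioi t))
    (fun t => measureReal_le_one) (C := 1) (by
      filter_upwards [eventually_lengthSup_le hFH h1 hδ hτ zero_lt_one, eventually_ge_atTop 0]
        with y hy hy0
      exact (hΛle y hy0).trans hy)
  obtain ⟨B, hB, y₀, hconv⟩ := hFH.heavy.lintegral_shift_le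
    (by positivity : (0 : ℝ) < ε / (2 * (C' * R + 1)))
  refine ⟨B, ?_⟩
  have hsh := tendsto_atTop_add_const_right atTop (-B) tendsto_id
  filter_upwards [eventually_ge_atTop y₀, eventually_ge_atTop B,
    hFH.heavy.eventually_shift_le B one_lt_two,
    hsh.eventually (eventually_lengthSup_le hFH h1 hδ hτ (by positivity : 0 < ε / 4))] with y h2 hyB h3 h4
  simp only [id, ← sub_eq_add_neg] at h4
  have h5 := (exceed_pairLaw_le (ν := ν) hFH h1 hδ hτ y).trans
    (hconv Λ (fun t => unifSeq.real (walkExceed ν b t)) C' R hC'0 hR0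
    (fun s t hst => measureReal_mono (antitone_walkExceed ν b hst)) (fun t => measureReal_le_one) hC'
    (fun t => measureReal_nonneg) hR y h2)
  have h6 : ε / (2 * (C' * R + 1)) * C' * R ≤ ε / 2 := by
    have h7 : 0 ≤ C' * R := by positivity
    rw [div_mul_eq_mul_div, div_mul_eq_mul_div, div_le_div_iff₀ (by positivity) (by positivity)]
    nlinarith
  have hpos := tail_nonneg H y
  have hneg : 0 ≤ unifSeq.real (walkExceed ν b (y - B)) := measureReal_nonneg
  have h8 := ENNReal.toReal_le_of_le_ofReal (by positivity) h5
  refine h8.trans ?_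
  rw [probReal_univ, one_mul]
  have h9 := (hΛle (y - B) (by linarith)).trans h4
  have h10 := mul_le_mul_of_nonneg_right h6 hpos
  have h11 := mul_le_mul_of_nonneg_left h3 (by positivity : 0 ≤ ε / 4)
  linarith

end Overshoot

end ModulatedWalk

namespace ModulatedWalk

/-! ### The cycle maximum for i.i.d. increments -/

section Domination

variable {𝒳 : Type*} [MeasurableSpace 𝒳] {ρ : Measure (ℕ × (ℕ → 𝒳))} [IsProbabilityMeasure ρ]

theorem integrable_length (hρ : ∫⁻ a, (a.1 : ℝ≥0∞) ∂ρ < ∞) : Integrable (fun a => (a.1 : ℝ)) ρ := by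
  have hm : Measurable fun a : ℕ × (ℕ → 𝒳) => (a.1 : ℝ) := by fun_prop
  refine ⟨hm.aestronglyMeasurable, ?_⟩
  rw [hasFiniteIntegral_iff_ofReal (ae_of_all _ fun a => Nat.cast_nonneg _)]
  simpa using hρ

theorem integral_length : ∫ a, (a.1 : ℝ) ∂ρ = (∫⁻ a, (a.1 : ℝ≥0∞) ∂ρ).toReal := by
  have hm : Measurable fun a : ℕ × (ℕ → 𝒳) => (a.1 : ℝ) := by fun_prop
  rw [integral_eq_lintegral_of_nonneg_ae (ae_of_all _ fun a => Nat.cast_nonneg _)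
    hm.aestronglyMeasurable]
  simp

variable {q : 𝒳 → ℝ → ℝ} {d : ℝ}

theorem isProbabilityMeasure_pairLaw (hq : Measurable fun p : 𝒳 × ℝ => q p.1 p.2) :
    IsProbabilityMeasure (pairLaw ρ q d) :=
  Measure.isProbabilityMeasure_map (measurable_cyclePair hq d).aemeasurable

theorem peakTail_pairLaw (hq : Measurable fun p : 𝒳 × ℝ => q p.1 p.2) (y : ℝ) :
    peakTail (pairLaw ρ q d) y = integratedTail ((ρ.prod unifSeq).map (cycleMax q)) y := by
  unfold peakTail pairLaw
  rw [Measure.map_map measurable_snd (measurable_cyclePair hq d)]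
  rfl

theorem pairLaw_le (hq : Measurable fun p : 𝒳 × ℝ => q p.1 p.2) (hd : 0 ≤ d) :
    ∀ᵐ p ∂(pairLaw ρ q d), 0 ≤ p.2 ∧ p.1 ≤ p.2 := by
  have hS : MeasurableSet {p : ℝ × ℝ | 0 ≤ p.2 ∧ p.1 ≤ p.2} :=
    (measurableSet_le measurable_const measurable_snd).inter
      (measurableSet_le measurable_fst measurable_snd)
  refine (ae_map_iff (measurable_cyclePair hq d).aemeasurable hS).2 (ae_of_all _ fun z =>
    ⟨cycleMax_nonneg z, ?_⟩)
  have h1 := cycleSum_le_cycleMax (q := q) z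
  have h2 : 0 ≤ d * (z.1.1 : ℝ) := by positivity
  simp only [cyclePair]
  linarith

theorem integrable_pairLaw_snd (hq : Measurable fun p : 𝒳 × ℝ => q p.1 p.2)
    (h : ∫⁻ x, ∫⁻ u, ‖q x u‖ₑ ∂unif ∂(intensity ρ) < ∞) :
    Integrable (fun p : ℝ × ℝ => p.2) (pairLaw ρ q d) := by
  rw [pairLaw, integrable_map_measure (by fun_prop) (measurable_cyclePair hq d).aemeasurable]
  exact integrable_cycleMax hq h

theorem integrable_pairLaw_fst (hq : Measurable fun p : 𝒳 × ℝ => q p.1 p.2)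
    (hρ : ∫⁻ a, (a.1 : ℝ≥0∞) ∂ρ < ∞) (h : ∫⁻ x, ∫⁻ u, ‖q x u‖ₑ ∂unif ∂(intensity ρ) < ∞) :
    Integrable (fun p : ℝ × ℝ => p.1) (pairLaw ρ q d) := by
  rw [pairLaw, integrable_map_measure (by fun_prop) (measurable_cyclePair hq d).aemeasurable]
  exact (integrable_cycleSum hq h).sub (((integrable_length hρ).comp_fst unifSeq).const_mul d)

theorem integral_pairLaw_fst (hq : Measurable fun p : 𝒳 × ℝ => q p.1 p.2)
    (hρ : ∫⁻ a, (a.1 : ℝ≥0∞) ∂ρ < ∞) (hqi : ∀ x, Integrable (q x) unif)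
    (h : ∫⁻ x, ∫⁻ u, ‖q x u‖ₑ ∂unif ∂(intensity ρ) < ∞) :
    ∫ p, p.1 ∂(pairLaw ρ q d) =
      ∫ x, ∫ u, q x u ∂unif ∂(intensity ρ) - d * (∫⁻ a, (a.1 : ℝ≥0∞) ∂ρ).toReal := by
  rw [pairLaw, integral_map (measurable_cyclePair hq d).aemeasurable (by fun_prop)]
  simp only [cyclePair]
  rw [integral_sub (integrable_cycleSum hq h) (((integrable_length hρ).comp_fst unifSeq).const_mul d),
    integral_cycleSum hq hqi h, integral_const_mul, ← integral_length,
    integral_fun_fst (fun a : ℕ × (ℕ → 𝒳) => (a.1 : ℝ))]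
  simp

theorem lintegral_quantile_const {ν : Measure ℝ} [IsProbabilityMeasure ν]
    (hν : Integrable (fun t : ℝ => t) ν) (hρ : ∫⁻ a, (a.1 : ℝ≥0∞) ∂ρ < ∞) :
    ∫⁻ _x, ∫⁻ u, ‖quantile ν u‖ₑ ∂unif ∂(intensity ρ) < ∞ := by
  rw [lintegral_const, intensity_univ]
  refine ENNReal.mul_lt_top ?_ hρ
  have h : ∫⁻ t, ‖t‖ₑ ∂ν = ∫⁻ u, ‖quantile ν u‖ₑ ∂unif := by
    conv_lhs => rw [← unif_map_quantile ν]
    rw [lintegral_map (by fun_prop) (measurable_quantile ν)]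
  rw [← h]
  exact hν.2

theorem integrable_quantile {ν : Measure ℝ} [IsProbabilityMeasure ν]
    (hν : Integrable (fun t : ℝ => t) ν) : Integrable (quantile ν) unif := by
  have h := hν
  rw [← unif_map_quantile ν, integrable_map_measure (by fun_prop)
    (measurable_quantile ν).aemeasurable] at h
  exact h

theorem integral_quantile {ν : Measure ℝ} [IsProbabilityMeasure ν] :
    ∫ u, quantile ν u ∂unif = ∫ t, t ∂ν := by
  conv_rhs => rw [← unif_map_quantile ν, integral_map (measurable_quantile ν).aemeasurable
    (by fun_prop)]

/-- At `δ = 0` the two sides are `m` and `m + η`, and continuity preserves the strict inequality.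
The slopes `s + 2 δ` (per step) and `s - δ` are those of the lower and the upper Veraverbeke bound,
and `1 - δ` is the loss in the lower one. -/
theorem exists_ratio_le {s m η : ℝ} (hs : 0 < s) (hη : 0 < η) :
    ∃ δ, 0 < δ ∧ δ < s ∧ δ < 1 ∧ (s + 2 * δ) * m * (s - δ)⁻¹ ≤ (m + η) * (1 - δ) := by
  have h1 : ContinuousAt (fun δ : ℝ => (m + η) * (1 - δ) - (s + 2 * δ) * m * (s - δ)⁻¹) 0 := by
    refine ContinuousAt.sub (by fun_prop) (ContinuousAt.mul (by fun_prop) (ContinuousAt.inv₀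
      (by fun_prop) (by simpa using hs.ne')))
  have h2 : 0 < (m + η) * (1 - (0 : ℝ)) - (s + 2 * 0) * m * (s - 0)⁻¹ := by
    have : (s + 2 * 0) * m * (s - 0)⁻¹ = m := by
      rw [mul_zero, add_zero, sub_zero]; field_simp
    rw [this]; linarith
  have h3 := (h1.eventually (lt_mem_nhds h2)).filter_mono (nhdsWithin_le_nhds (s := Ioi 0))
  have h4 : ∀ᶠ δ in 𝓝[>] (0 : ℝ), δ < min s 1 :=
    (eventually_lt_nhds (lt_min hs one_pos)).filter_mono nhdsWithin_le_nhds
  obtain ⟨δ, hδ1, hδ2, hδ3⟩ := (h3.and (h4.and self_mem_nhdsWithin)).exists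
  exact ⟨δ, hδ3, hδ2.trans_le (min_le_left _ _), hδ2.trans_le (min_le_right _ _), by linarith⟩

variable {F H ν : Measure ℝ} [IsProbabilityMeasure F] [IsProbabilityMeasure H]
  [IsProbabilityMeasure ν] {b : ℝ}

/-- The integrated tail of the maximum within a cycle of independent increments with law `ν`. -/
theorem eventually_integratedTail_cycleMax_le (hFH : IsSecondTail F H) (h1 : ∀ᵐ a ∂ρ, 1 ≤ a.1)
    (hρ : ∫⁻ a, (a.1 : ℝ≥0∞) ∂ρ < ∞)
    (hτ : (fun y => ρ.real {a | y < b * (a.1 : ℝ)}) =o[atTop] tail F)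
    (hν : Integrable (fun t : ℝ => t) ν) {C : ℝ}
    (hC : ∀ᶠ y in atTop, (integratedTail ν y).toReal ≤ C * tail H y) (hb : ∫ t, t ∂ν < b)
    {ε : ℝ} (hε : 0 < ε) : ∃ A, ∀ᶠ y in atTop,
      (integratedTail ((ρ.prod unifSeq).map (cycleMax fun _ => quantile ν)) y).toReal ≤
        (∫⁻ a, (a.1 : ℝ≥0∞) ∂ρ).toReal * (integratedTail ν (y - A)).toReal + ε * tail H y := by
  set m := (∫⁻ a, (a.1 : ℝ≥0∞) ∂ρ).toReal with hm
  set s := b - ∫ t, t ∂ν with hs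
  have hs0 : 0 < s := by rw [hs]; linarith
  have hq : Measurable fun p : 𝒳 × ℝ => (fun _ => quantile ν : 𝒳 → ℝ → ℝ) p.1 p.2 :=
    (measurable_quantile ν).comp measurable_snd
  have hm1 : 1 ≤ m := by
    rw [hm, ← integral_length]
    have h2 : ∫ _a, (1 : ℝ) ∂ρ ≤ ∫ a, (a.1 : ℝ) ∂ρ := by
      refine integral_mono_ae (integrable_const 1) (integrable_length hρ) ?_
      filter_upwards [h1] with a ha
      exact_mod_cast ha
    simpa using h2
  set C₀ := max C 0 with hC₀
  have hC₀0 : 0 ≤ C₀ := le_max_right _ _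
  obtain ⟨δ, hδ0, hδs, hδ1, hδ⟩ := exists_ratio_le (m := m) hs0
    (by positivity : 0 < ε / (4 * (C₀ + 1)))
  have hint := lintegral_quantile_const hν hρ
  have := isProbabilityMeasure_pairLaw (q := fun _ => quantile ν) (ρ := ρ) (d := b + δ) hq
  have hfst := integral_pairLaw_fst (q := fun _ => quantile ν) (d := b + δ) hq hρ (fun _ => integrable_quantile hν) hint
  have hmean : ∫ p, p.1 ∂(pairLaw ρ (fun _ => quantile ν) (b + δ)) = -((s + δ) * m) := by
    rw [hfst, integral_const, integral_quantile, measureReal_def, intensity_univ, ← hm, smul_eq_mul,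
      hs]
    ring
  have hh : 0 < (s + 2 * δ) * m := by positivity
  -- Veraverbeke's theorem is read backwards. Its lower bound estimates the integrated tail of the
  -- cycle maximum by the maximum of the walk grouped into cycles; that maximum is controlled by the
  -- i.i.d. walk with steps `ζ - b`, for which the upper bound is available.
  obtain ⟨K, hK, hlow⟩ := exists_le_exceed (integrable_pairLaw_fst (q := fun _ => quantile ν) (d := b + δ) hq hρ hint)
    (integrable_pairLaw_snd (q := fun _ => quantile ν) hq hint) (by rw [hmean]; nlinarith [mul_pos (add_pos hs0 hδ0) (by linarith : 0 < m)])
    (h := (s + 2 * δ) * m) (by rw [hmean, neg_neg]; nlinarith) hδ0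
  -- Two errors `η tail H`, each at most doubled by a shift, make `4 η tail H y`. The factor `12`
  -- turns them into `ε / 3` after division by `1 - δ`.
  set η := ε * (1 - δ) / (12 * ((s + 2 * δ) * m)) with hη
  have hη0 : 0 < η := div_pos (mul_pos hε (by linarith)) (by positivity)
  obtain ⟨B, hB⟩ := eventually_exceed_pairLaw_le hFH h1 hδ0 hτ hν hC hb hη0
  obtain ⟨K₁, hK₁⟩ := eventually_walkExceed_le hFH.heavy hν hC (h := s - δ) (by linarith)
    (b := b) (by linarith) hη0
  have shift : ∀ k : ℝ, Tendsto (fun y : ℝ => y - k) atTop atTop := fun k =>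
    tendsto_atTop_add_const_right atTop (-k) tendsto_id
  refine ⟨K + B + K₁, ?_⟩
  filter_upwards [(shift K).eventually hlow, (shift K).eventually hB,
    ((shift (K + B)).eventually hK₁), hFH.heavy.eventually_shift_le K one_lt_two,
    hFH.heavy.eventually_shift_le (K + B) one_lt_two,
    eventually_shift_bound hFH.heavy hC (K + B + K₁)] with y h2 h3 h4 h5 h6 h7
  rw [sub_add_cancel, peakTail_pairLaw (q := fun _ => quantile ν) hq] at h2
  rw [sub_sub y K B] at h3
  rw [sub_sub y (K + B) K₁] at h4
  set Q := (integratedTail ((ρ.prod unifSeq).map (cycleMax fun _ => quantile ν)) y).toReal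
  set D := (integratedTail ν (y - (K + B + K₁))).toReal
  have hD : 0 ≤ D := ENNReal.toReal_nonneg
  have h8 : (1 - δ) * Q ≤ (s + 2 * δ) * m * ((s - δ)⁻¹ * D + 4 * η * tail H y) := by
    refine h2.trans (mul_le_mul_of_nonneg_left ?_ hh.le)
    have h9 := mul_le_mul_of_nonneg_left h5 hη0.le
    have h10 := mul_le_mul_of_nonneg_left h6 hη0.le
    linarith
  have h11 : (s + 2 * δ) * m * (4 * η * tail H y) = (1 - δ) * (ε / 3 * tail H y) := by
    rw [hη]; field_simp; ring
  have h12 : (1 - δ) * Q ≤ (1 - δ) * ((m + ε / (4 * (C₀ + 1))) * D + ε / 3 * tail H y) := by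
    have := mul_le_mul_of_nonneg_right hδ hD
    nlinarith
  have h13 := le_of_mul_le_mul_left h12 (by linarith)
  have h14 : ε / (4 * (C₀ + 1)) * D ≤ ε / 2 * tail H y := by
    have hpos := tail_nonneg H y
    calc ε / (4 * (C₀ + 1)) * D ≤ ε / (4 * (C₀ + 1)) * (2 * C₀ * tail H y) := by gcongr
      _ = ε / 2 * (C₀ / (C₀ + 1)) * tail H y := by field_simp; ring
      _ ≤ ε / 2 * 1 * tail H y := by
          gcongr
          rw [div_le_one (by positivity)]; linarith
      _ = _ := by ring
  have hpos := mul_nonneg hε.le (tail_nonneg H y)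
  linarith

end Domination

end ModulatedWalk

namespace ModulatedWalk

/-! ### Comparing the true increments with copies of `ζ` within a cycle -/

section Comparison

theorem unifSeq_inter_eq_mul {A : Set (ℕ → ℝ)} (hA : MeasurableSet A) {S : Set ℕ}
    (hAS : ∀ u u' : ℕ → ℝ, (∀ l ∈ S, u l = u' l) → u ∈ A → u' ∈ A) {i : ℕ} (hi : i ∉ S)
    {s : Set ℝ} (hs : MeasurableSet s) :
    unifSeq (A ∩ {u | u i ∈ s}) = unifSeq A * unif s := by
  classical
  have hind : iIndepFun (fun (i : ℕ) (z : ℕ → ℝ) => z i) unifSeq :=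
    iIndepFun_infinitePi (X := fun _ x => x) fun _ => measurable_id
  have hd : DependsOn (A.indicator fun _ => (1 : ℝ)) S := by
    intro x y hxy
    have h3 : x ∈ A ↔ y ∈ A := ⟨hAS x y hxy, hAS y x fun l hl => (hxy l hl).symm⟩
    simp only [indicator, h3]
  have hd2 : DependsOn (fun z : ℕ → ℝ => z i) ({i} : Set ℕ) := fun x y' hxy => hxy i rfl
  have h := indepFun_of_dependsOn hind (fun i => measurable_pi_apply i)
    (S := S) (T := {i}) (by simpa using hi) (measurable_const.indicator hA) (measurable_pi_apply i) hd hd2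
  have h4 := h.measure_inter_preimage_eq_mul _ _ (measurableSet_singleton (1 : ℝ)) hs
  have h5 : (fun z : ℕ → ℝ => A.indicator (fun _ => (1 : ℝ)) fun i => z i) ⁻¹' {1} = A := by
    ext z
    by_cases hz : z ∈ A <;> simp [hz]
  rw [h5] at h4
  rw [show A ∩ {u | u i ∈ s} = A ∩ (fun z : ℕ → ℝ => z i) ⁻¹' s from rfl, h4, ← unifSeq_map_eval i,
    Measure.map_apply (measurable_pi_apply i) hs]

/-- The event that the partial sums of length at most `k`, without the term `i`, are bounded by `K`. -/
def offEvent (ν : Measure ℝ) (K : ℝ) (k i : ℕ) : Set (ℕ → ℝ) :=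
  {u | ∀ j ≤ k, |∑ l ∈ (Finset.range j).erase i, quantile ν (u l)| ≤ K}

variable {𝒳 : Type*} [MeasurableSpace 𝒳] {ν : Measure ℝ} [IsProbabilityMeasure ν]

theorem measurableSet_offEvent (K : ℝ) (k i : ℕ) : MeasurableSet (offEvent ν K k i) := by
  have hq := measurable_quantile ν
  have : offEvent ν K k i = ⋂ j ∈ Finset.range (k + 1),
      {u | |∑ l ∈ (Finset.range j).erase i, quantile ν (u l)| ≤ K} := by
    ext u; simp [offEvent]
  rw [this]
  refine Finset.measurableSet_biInter _ fun j _ => measurableSet_le ?_ measurable_const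
  have : Measurable fun u : ℕ → ℝ => ∑ l ∈ (Finset.range j).erase i, quantile ν (u l) := by fun_prop
  simpa only [Real.norm_eq_abs] using this.norm

theorem unifSeq_offEvent_inter (K : ℝ) (k i : ℕ) {s : Set ℝ} (hs : MeasurableSet s) :
    unifSeq (offEvent ν K k i ∩ {u | u i ∈ s}) = unifSeq (offEvent ν K k i) * unif s := by
  refine unifSeq_inter_eq_mul (measurableSet_offEvent K k i) (S := {i}ᶜ) ?_ (by simp) hs
  intro u u' huu hu j hj
  have h : ∑ l ∈ (Finset.range j).erase i, quantile ν (u' l) =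
      ∑ l ∈ (Finset.range j).erase i, quantile ν (u l) :=
    Finset.sum_congr rfl fun l hl => by rw [huu l (Finset.ne_of_mem_erase hl)]
  rw [h]
  exact hu j hj

theorem tendsto_unifSeq_offEvent (k i : ℕ) :
    Tendsto (fun K : ℕ => unifSeq (offEvent ν K k i)) atTop (𝓝 1) := by
  have hU : (⋃ K : ℕ, offEvent ν (K : ℝ) k i) = univ := by
    refine eq_univ_of_forall fun u => mem_iUnion.2 ?_
    obtain ⟨K, hK⟩ := exists_nat_ge (∑ j ∈ Finset.range (k + 1),
      |∑ l ∈ (Finset.range j).erase i, quantile ν (u l)|)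
    refine ⟨K, fun j hj => (Finset.single_le_sum (f := fun j =>
      |∑ l ∈ (Finset.range j).erase i, quantile ν (u l)|) (fun _ _ => abs_nonneg _)
      (Finset.mem_range.2 (by omega))).trans hK⟩
  have hmono : Monotone fun K : ℕ => offEvent ν (K : ℝ) k i := fun K K' h u hu j hj =>
    (hu j hj).trans (by exact_mod_cast h)
  have h := tendsto_measure_iUnion_atTop (μ := unifSeq) hmono
  rwa [hU, measure_univ] at h

/-- Two consecutive partial sums that omit term `m` differ by term `i`. So on this event term `m` is
the only one that may be large. -/
theorem quantile_le_of_mem_offEvent {K : ℝ} {k i m : ℕ} {u : ℕ → ℝ} (h : u ∈ offEvent ν K k m) (hik : i < k)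
    (him : i ≠ m) : quantile ν (u i) ≤ 2 * K := by
  have h1 := h (i + 1) (by omega)
  have h2 := h i (by omega)
  have h3 : (Finset.range (i + 1)).erase m = insert i ((Finset.range i).erase m) := by
    ext l; simp only [Finset.mem_erase, Finset.mem_range, Finset.mem_insert]; omega
  rw [h3, Finset.sum_insert (by simp)] at h1
  have h4 := (abs_le.1 h1).2
  have h5 := (abs_le.1 h2).1
  linarith

theorem lt_cycleMax_of_mem_offEvent {K t : ℝ} {a : ℕ × (ℕ → 𝒳)} {i : ℕ} (hi : i < a.1) {u : ℕ → ℝ}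
    (h : u ∈ offEvent ν K a.1 i) (ht : t + K < quantile ν (u i)) :
    t < cycleMax (fun _ => quantile ν) (a, u) := by
  refine lt_cycleMax_iff.2 ⟨i + 1, hi, ?_⟩
  have h1 := (abs_le.1 (h (i + 1) hi)).1
  unfold partSum
  rw [← Finset.add_sum_erase _ _ (Finset.self_mem_range_succ i)]
  simp only
  linarith

/-- The terms other than `i` are dominated by copies of `ζ` whose partial sums stay below `K`. A
term `i` of size at most `t - K` cannot lift them above `t`, and partial sums without it are covered
by `K ≤ t`. -/
theorem cycleMax_le_of_mem_offEvent {K t : ℝ} {a : ℕ × (ℕ → 𝒳)} {i : ℕ} {u : ℕ → ℝ}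
    (h : u ∈ offEvent ν K a.1 i) (hK : K ≤ t) {q : 𝒳 → ℝ → ℝ} (hq : ∀ x v, q x v ≤ quantile ν v)
    (ht : q (a.2 i) (u i) ≤ t - K) : cycleMax q (a, u) ≤ t := by
  by_contra hlt
  obtain ⟨j, hj, hlt⟩ := lt_cycleMax_iff.1 (not_le.1 hlt)
  have h1 := (abs_le.1 (h j hj)).2
  have h2 : ∑ l ∈ (Finset.range j).erase i, q (a.2 l) (u l) ≤
      ∑ l ∈ (Finset.range j).erase i, quantile ν (u l) := Finset.sum_le_sum fun l _ => hq _ _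
  unfold partSum at hlt
  simp only at hlt
  by_cases hij : i ∈ Finset.range j
  · rw [← Finset.add_sum_erase _ _ hij] at hlt
    linarith
  · rw [Finset.erase_eq_of_notMem hij] at h1 h2
    linarith

variable {P : Kernel 𝒳 ℝ} [IsMarkovKernel P]

/-- Comparison of the maxima within a cycle of given states, for increments with laws `P x` and for
independent increments with law `ν`. -/
theorem unifSeq_cycleMax_add_le (hPν : ∀ x y, tail (P x) y ≤ tail ν y) {K t : ℝ}
    (ht : K ≤ t) (a : ℕ × (ℕ → 𝒳)) :
    unifSeq {u | t < cycleMax (fun x => quantile (P x)) (a, u)} +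
        ∑ i ∈ Finset.range a.1, unifSeq (offEvent ν K a.1 i) * ν (Ioi (t + K)) ≤
      unifSeq {u | t < cycleMax (fun _ => quantile ν) (a, u)} +
        ∑ i ∈ Finset.range a.1, unifSeq (offEvent ν K a.1 i) * P (a.2 i) (Ioi (t - K)) := by
  have hqle : ∀ x v, quantile (P x) v ≤ quantile ν v := fun x v => quantile_mono (hPν x) v
  have hqP := measurable_quantile_uncurry P
  have hqν := measurable_quantile ν
  have hqν' : Measurable fun p : 𝒳 × ℝ => (fun _ => quantile ν : 𝒳 → ℝ → ℝ) p.1 p.2 :=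
    hqν.comp measurable_snd
  -- In `A i` the copy of `ζ` at position `i` is large and the coupled increment is not. For `i`
  -- within the cycle these events are disjoint, lie in the event that the maximum for `ν` exceeds
  -- `t`, and miss the corresponding event for `P`. Their total probability bounds the difference
  -- from below.
  set A : ℕ → Set (ℕ → ℝ) := fun i => offEvent ν K a.1 i ∩
    {u | u i ∈ {v | t + K < quantile ν v ∧ quantile (P (a.2 i)) v ≤ t - K}} with hA
  have hS : ∀ i, MeasurableSet {v | t + K < quantile ν v ∧ quantile (P (a.2 i)) v ≤ t - K} := fun i =>
    (measurableSet_lt measurable_const hqν).inter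
      (measurableSet_le (measurable_quantile (P (a.2 i))) measurable_const)
  have hAm : ∀ i, MeasurableSet (A i) := fun i => (measurableSet_offEvent K a.1 i).inter
    (measurable_pi_apply i (hS i))
  have hdisj : (Finset.range a.1 : Set ℕ).PairwiseDisjoint A := by
    intro i hi m _ him
    rw [Function.onFun, Set.disjoint_left]
    rintro u ⟨_, h1⟩ ⟨h2, _⟩
    have h3 := quantile_le_of_mem_offEvent h2 (Finset.mem_range.1 hi) him
    have h4 : t + K < quantile ν (u i) := h1.1
    linarith
  have h1 : unifSeq {u | t < cycleMax (fun x => quantile (P x)) (a, u)} +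
      ∑ i ∈ Finset.range a.1, unifSeq (A i) ≤
      unifSeq {u | t < cycleMax (fun _ => quantile ν) (a, u)} := by
    rw [← measure_biUnion_finset hdisj fun i _ => hAm i, ← measure_union]
    · refine measure_mono (union_subset (fun u hu => ?_) (iUnion₂_subset fun i hi u hu => ?_))
      · exact lt_of_lt_of_le hu (cycleMax_mono hqle _)
      · exact lt_cycleMax_of_mem_offEvent (Finset.mem_range.1 hi) hu.1 hu.2.1
    · rw [Set.disjoint_left]
      rintro u hu hu'
      obtain ⟨i, _, hui⟩ := mem_iUnion₂.1 hu'
      have hu2 : t < cycleMax (fun x => quantile (P x)) (a, u) := hu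
      exact absurd hu2 (not_lt.2 (cycleMax_le_of_mem_offEvent hui.1 ht hqle hui.2.2))
    · exact Finset.measurableSet_biUnion _ fun i _ => hAm i
  -- Term `i` is independent of `offEvent`, which ignores it, so probabilities factor. The
  -- inequality stays additive because `[0, ∞]` has no true subtraction.
  have h2 : ∀ i, unifSeq (offEvent ν K a.1 i) * ν (Ioi (t + K)) ≤
      unifSeq (A i) + unifSeq (offEvent ν K a.1 i) * P (a.2 i) (Ioi (t - K)) := by
    intro i
    rw [hA, unifSeq_offEvent_inter K a.1 i (hS i), ← mul_add]
    gcongr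
    rw [← unif_quantile_Ioi ν, ← unif_quantile_Ioi (P (a.2 i))]
    refine (measure_mono fun v hv => ?_).trans (measure_union_le _ _)
    by_cases h : quantile (P (a.2 i)) v ≤ t - K
    · exact Or.inl ⟨hv, h⟩
    · exact Or.inr (not_le.1 h)
  calc _ ≤ unifSeq {u | t < cycleMax (fun x => quantile (P x)) (a, u)} +
        ∑ i ∈ Finset.range a.1,
          (unifSeq (A i) + unifSeq (offEvent ν K a.1 i) * P (a.2 i) (Ioi (t - K))) := by
        gcongr with i; exact h2 i
    _ = (unifSeq {u | t < cycleMax (fun x => quantile (P x)) (a, u)} +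
        ∑ i ∈ Finset.range a.1, unifSeq (A i)) +
        ∑ i ∈ Finset.range a.1, unifSeq (offEvent ν K a.1 i) * P (a.2 i) (Ioi (t - K)) := by
        rw [Finset.sum_add_distrib, add_assoc]
    _ ≤ _ := by gcongr

variable {ρ : Measure (ℕ × (ℕ → 𝒳))} [IsProbabilityMeasure ρ]

theorem measurable_offWeight (K : ℝ) (i : ℕ) :
    Measurable fun a : ℕ × (ℕ → 𝒳) => unifSeq (offEvent ν K a.1 i) :=
  (measurable_from_top (f := fun k : ℕ => unifSeq (offEvent ν K k i))).comp measurable_fst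

theorem map_cycleMax_Ioi {q : 𝒳 → ℝ → ℝ} (hq : Measurable fun p : 𝒳 × ℝ => q p.1 p.2) (t : ℝ) :
    ((ρ.prod unifSeq).map (cycleMax q)) (Ioi t) = ∫⁻ a, unifSeq {u | t < cycleMax q (a, u)} ∂ρ := by
  have hm := measurable_cycleMax hq
  rw [Measure.map_apply hm measurableSet_Ioi, Measure.prod_apply (hm measurableSet_Ioi)]
  rfl

theorem measurable_unifSeq_cycleMax {q : 𝒳 → ℝ → ℝ} (hq : Measurable fun p : 𝒳 × ℝ => q p.1 p.2) (t : ℝ) :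
    Measurable fun a : ℕ × (ℕ → 𝒳) => unifSeq {u | t < cycleMax q (a, u)} :=
  measurable_measure_prodMk_left (measurable_cycleMax hq measurableSet_Ioi)

/-- The expected sum of the weights of the positions of a cycle. -/
noncomputable def offMass (ρ : Measure (ℕ × (ℕ → 𝒳))) (ν : Measure ℝ) (K : ℝ) : ℝ≥0∞ :=
  ∫⁻ a, ∑ i ∈ Finset.range a.1, unifSeq (offEvent ν K a.1 i) ∂ρ

theorem measurable_offSum (K : ℝ) : Measurable fun a : ℕ × (ℕ → 𝒳) =>
    ∑ i ∈ Finset.range a.1, unifSeq (offEvent ν K a.1 i) :=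
  measurable_sum_range_of measurable_fst fun i => measurable_offWeight K i

theorem tendsto_offMass (hρ : ∫⁻ a, (a.1 : ℝ≥0∞) ∂ρ < ∞) :
    Tendsto (fun K : ℕ => offMass ρ ν K) atTop (𝓝 (∫⁻ a, (a.1 : ℝ≥0∞) ∂ρ)) := by
  unfold offMass
  refine tendsto_lintegral_of_dominated_convergence (fun a => (a.1 : ℝ≥0∞))
    (fun K => measurable_offSum _) (fun K => ae_of_all _ fun a => ?_) hρ.ne (ae_of_all _ fun a => ?_)
  · calc ∑ i ∈ Finset.range a.1, unifSeq (offEvent ν K a.1 i) ≤ ∑ _i ∈ Finset.range a.1, 1 :=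
        Finset.sum_le_sum fun i _ => prob_le_one
      _ = _ := by simp
  · have h := tendsto_finsetSum (Finset.range a.1) fun i _ => tendsto_unifSeq_offEvent (ν := ν) a.1 i
    simpa using h

theorem map_cycleMax_add_le (hPν : ∀ x y, tail (P x) y ≤ tail ν y) {K t : ℝ}
    (ht : K ≤ t) :
    ((ρ.prod unifSeq).map (cycleMax fun x => quantile (P x))) (Ioi t) +
        offMass ρ ν K * ν (Ioi (t + K)) ≤
      ((ρ.prod unifSeq).map (cycleMax fun _ => quantile ν)) (Ioi t) +
        weightedTail P ρ (fun i a => unifSeq (offEvent ν K a.1 i)) (t - K) := by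
  have hqP := measurable_quantile_uncurry P
  have hqν' : Measurable fun p : 𝒳 × ℝ => (fun _ => quantile ν : 𝒳 → ℝ → ℝ) p.1 p.2 :=
    (measurable_quantile ν).comp measurable_snd
  rw [map_cycleMax_Ioi (q := fun x => quantile (P x)) hqP, map_cycleMax_Ioi (q := fun _ => quantile ν) hqν',
    offMass, ← lintegral_mul_const _ (measurable_offSum K), weightedTail,
    ← lintegral_add_left (measurable_unifSeq_cycleMax (q := fun x => quantile (P x)) hqP t),
    ← lintegral_add_left (measurable_unifSeq_cycleMax (q := fun _ => quantile ν) hqν' t)]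
  refine lintegral_mono fun a => ?_
  simp only [Finset.sum_mul]
  exact unifSeq_cycleMax_add_le hPν ht a

theorem setLIntegral_Ioi_add (g : ℝ → ℝ≥0∞) (y k : ℝ) :
    ∫⁻ t in Ioi (y + k), g t = ∫⁻ t in Ioi y, g (t + k) := by
  have h := (measurePreserving_add_right volume k).setLIntegral_comp_preimage_emb
    (measurableEmbedding_addRight k) g (Ioi (y + k))
  rw [← h]
  congr 2
  ext t; simp

theorem integratedTail_cycleMax_add_le (hPν : ∀ x y, tail (P x) y ≤ tail ν y) {K y : ℝ}
    (hy : K ≤ y) :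
    integratedTail ((ρ.prod unifSeq).map (cycleMax fun x => quantile (P x))) y +
        offMass ρ ν K * integratedTail ν (y + K) ≤
      integratedTail ((ρ.prod unifSeq).map (cycleMax fun _ => quantile ν)) y +
        ∫⁻ t in Ioi (y - K), weightedTail P ρ (fun i a => unifSeq (offEvent ν K a.1 i)) t := by
  unfold integratedTail
  have hm := fun G : Measure ℝ => measurable_measure_Ioi G
  rw [setLIntegral_Ioi_add, sub_eq_add_neg, setLIntegral_Ioi_add, ← lintegral_const_mul (f := fun t => ν (Ioi (t + K))) _
      ((hm ν).comp (measurable_id.add_const K)),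
    ← lintegral_add_left (hm _), ← lintegral_add_left (hm _)]
  refine setLIntegral_mono' measurableSet_Ioi fun t ht => ?_
  rw [← sub_eq_add_neg]
  exact map_cycleMax_add_le hPν (hy.trans (le_of_lt ht))

end Comparison

end ModulatedWalk

namespace ModulatedWalk

/-! ### The integrated tail of the cycle maximum for the true increments -/

section CycleTail

variable {𝒳 : Type*} [MeasurableSpace 𝒳] {ρ : Measure (ℕ × (ℕ → 𝒳))} [IsProbabilityMeasure ρ]
  {F H ν : Measure ℝ} [IsProbabilityMeasure F] [IsProbabilityMeasure H] [IsProbabilityMeasure ν]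
  {P : Kernel 𝒳 ℝ} [IsMarkovKernel P] {b : ℝ} {c : 𝒳 → ℝ} {L : ℝ}

theorem integratedTail_sub_le (hν : Integrable (fun t : ℝ => t) ν) {x y : ℝ} (h : x ≤ y) :
    (integratedTail ν x).toReal ≤ (y - x) * tail ν x + (integratedTail ν y).toReal := by
  have h1 : ∫⁻ t in Ioc x y, ν (Ioi t) ≤ ENNReal.ofReal ((y - x) * tail ν x) := by
    calc ∫⁻ t in Ioc x y, ν (Ioi t) ≤ ∫⁻ _ in Ioc x y, ν (Ioi x) :=
          setLIntegral_mono' measurableSet_Ioc fun t ht => measure_mono (Ioi_subset_Ioi ht.1.le)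
      _ = _ := by
          rw [setLIntegral_const, Real.volume_Ioc, ENNReal.ofReal_mul (by linarith), ofReal_tail, mul_comm]
  refine ENNReal.toReal_le_of_le_ofReal (add_nonneg (mul_nonneg (by linarith) (tail_nonneg _ _))
    ENNReal.toReal_nonneg) ?_
  rw [integratedTail_add ν h, ENNReal.ofReal_add (mul_nonneg (by linarith) (tail_nonneg _ _))
    ENNReal.toReal_nonneg, ENNReal.ofReal_toReal (integratedTail_lt_top ν hν y).ne]
  gcongr

theorem weightedLimit_le_one {w : ℕ → ℕ × (ℕ → 𝒳) → ℝ≥0∞} (hw1 : ∀ i a, w i a ≤ 1) :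
    weightedLimit c ρ w ≤ weightedLimit c ρ fun _ _ => 1 :=
  lintegral_mono fun a => Finset.sum_le_sum fun i _ => mul_le_mul_left (hw1 i a) _

/-- The integrated tail of the maximum within a cycle. -/
theorem eventually_integratedTail_cycleMax_kernel_le (hFH : IsSecondTail F H)
    (hPν : ∀ x y, tail (P x) y ≤ tail ν y)
    (hc : ∀ x, Tendsto (fun y => tail (P x) y / tail F y) atTop (𝓝 (c x)))
    (hL : ∀ x, ∀ y, 0 ≤ y → tail (P x) y ≤ L * tail F y)
    (h1 : ∀ᵐ a ∂ρ, 1 ≤ a.1) (hρ : ∫⁻ a, (a.1 : ℝ≥0∞) ∂ρ < ∞)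
    (hτ : (fun y => ρ.real {a | y < b * (a.1 : ℝ)}) =o[atTop] tail F)
    (hν : Integrable (fun t : ℝ => t) ν) (hνF : tail ν =O[atTop] tail F) {C : ℝ}
    (hC : ∀ᶠ y in atTop, (integratedTail ν y).toReal ≤ C * tail H y) (hb : ∫ t, t ∂ν < b)
    {ε : ℝ} (hε : 0 < ε) : ∀ᶠ y in atTop,
      (integratedTail ((ρ.prod unifSeq).map (cycleMax fun x => quantile (P x))) y).toReal ≤
        ((weightedLimit c ρ fun _ _ => 1).toReal + ε) * tail H y := by
  -- Five errors: one from the cycle maximum for `ν`, one from moving the integrated tail of `ν`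
  -- between `y - A` and `y + K`, one from the missing mass `m - offMass`, and two from the weighted
  -- tail and its shift by `K`.
  obtain ⟨ε', hε', rfl⟩ : ∃ ε', 0 < ε' ∧ ε = 5 * ε' := ⟨ε / 5, by positivity, by ring⟩
  set Γ := (weightedLimit c ρ fun _ _ => 1).toReal with hΓ
  have hΓ0 : 0 ≤ Γ := ENNReal.toReal_nonneg
  set m := (∫⁻ a, (a.1 : ℝ≥0∞) ∂ρ).toReal with hm
  have hm0 : 0 ≤ m := ENNReal.toReal_nonneg
  set C₀ := max C 0 with hC₀
  have hC₀0 : 0 ≤ C₀ := le_max_right _ _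
  obtain ⟨A₀, hA₀⟩ := eventually_integratedTail_cycleMax_le hFH h1 hρ hτ hν hC hb hε'
  set A := max A₀ 0 with hA
  have hA0 : 0 ≤ A := le_max_right _ _
  have hmass : Tendsto (fun K : ℕ => (offMass ρ ν K).toReal) atTop (𝓝 m) :=
    (ENNReal.tendsto_toReal hρ.ne).comp (tendsto_offMass hρ)
  obtain ⟨K, hK⟩ := (hmass.eventually (lt_mem_nhds
    (by have : 0 < ε' / (C₀ + 1) := by positivity
        linarith : m - ε' / (C₀ + 1) < m))).exists
  have hK0 : (0 : ℝ) ≤ K := Nat.cast_nonneg K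
  have hW := eventually_setLIntegral_weightedTail_le (w := fun i a => unifSeq (offEvent ν K a.1 i))
    hFH hc hL hρ (fun i => measurable_offWeight _ i) (fun i a => prob_le_one) hε'
  have hΓK : (weightedLimit c ρ fun i a => unifSeq (offEvent ν (K : ℝ) a.1 i)).toReal ≤ Γ :=
    ENNReal.toReal_mono (weightedLimit_lt_top hFH hc hL hρ fun _ _ => le_rfl).ne
      (weightedLimit_le_one fun _ _ => prob_le_one)
  set η := ε' / (2 * (m * (A + K) + 1)) with hη
  have hη0 : 0 < η := by positivity
  have hνH := (hνF.trans_isLittleO hFH.little).bound hη0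
  have shift : ∀ k : ℝ, Tendsto (fun y : ℝ => y - k) atTop atTop := fun k =>
    tendsto_atTop_add_const_right atTop (-k) tendsto_id
  have hqν' : Measurable fun p : 𝒳 × ℝ => (fun _ => quantile ν : 𝒳 → ℝ → ℝ) p.1 p.2 :=
    (measurable_quantile ν).comp measurable_snd
  have hVint : Integrable (fun t : ℝ => t)
      ((ρ.prod unifSeq).map (cycleMax (𝒳 := 𝒳) fun _ => quantile ν)) := by
    rw [integrable_map_measure (by fun_prop)
      (measurable_cycleMax (q := fun _ => quantile ν) hqν').aemeasurable]
    exact integrable_cycleMax (q := fun _ => quantile ν) hqν' (lintegral_quantile_const hν hρ)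
  have hmass_fin : offMass ρ ν K ≠ ∞ := by
    refine ne_top_of_le_ne_top hρ.ne (lintegral_mono fun a => ?_)
    calc ∑ i ∈ Finset.range a.1, unifSeq (offEvent ν K a.1 i) ≤ ∑ _i ∈ Finset.range a.1, 1 :=
        Finset.sum_le_sum fun i _ => prob_le_one
      _ = _ := by simp
  filter_upwards [hA₀, hC, (shift K).eventually hW, (shift A).eventually hνH,
    hFH.heavy.eventually_shift_le A one_lt_two,
    hFH.heavy.eventually_shift_le K (r := 1 + ε' / (Γ + ε')) (by
      have : 0 < ε' / (Γ + ε') := by positivity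
      linarith), eventually_ge_atTop (K : ℝ)] with y h2 h3 h4 h5 h6 h7 h8
  -- The maximum for `ν` contributes `m` times the integrated tail of `ν`, and the second term on
  -- the left removes `offMass`, nearly `m`, times the same quantity. What remains is the weighted
  -- tail of the true increments.
  have h9 := integratedTail_cycleMax_add_le (ρ := ρ) hPν h8
  set Q := integratedTail ((ρ.prod unifSeq).map (cycleMax fun x => quantile (P x))) y with hQ
  set Q' := integratedTail ((ρ.prod unifSeq).map (cycleMax fun _ => quantile ν)) y with hQ'
  have : IsProbabilityMeasure ((ρ.prod unifSeq).map (cycleMax (𝒳 := 𝒳) fun _ => quantile ν)) :=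
    Measure.isProbabilityMeasure_map (measurable_cycleMax (q := fun _ => quantile ν) hqν').aemeasurable
  have hQ'fin : Q' ≠ ∞ := (integratedTail_lt_top _ hVint y).ne
  have hDfin : ∀ y, integratedTail ν y ≠ ∞ := fun y => (integratedTail_lt_top ν hν y).ne
  have hpos := tail_nonneg H y
  have h10 : Q + offMass ρ ν K * integratedTail ν (y + K) ≤ Q' + ENNReal.ofReal ((Γ + ε') * tail H (y - K)) := by
    refine h9.trans ?_
    gcongr
    refine h4.trans (ENNReal.ofReal_le_ofReal ?_)
    have := tail_nonneg H (y - K)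
    gcongr
  have hrhs : Q' + ENNReal.ofReal ((Γ + ε') * tail H (y - K)) ≠ ∞ :=
    ENNReal.add_ne_top.2 ⟨hQ'fin, ENNReal.ofReal_ne_top⟩
  have hlhs := ne_top_of_le_ne_top hrhs h10
  have h11 := ENNReal.toReal_mono hrhs h10
  rw [ENNReal.toReal_add (ENNReal.add_ne_top.1 hlhs).1 (ENNReal.add_ne_top.1 hlhs).2,
    ENNReal.toReal_add hQ'fin ENNReal.ofReal_ne_top, ENNReal.toReal_mul,
    ENNReal.toReal_ofReal (mul_nonneg (by positivity) (tail_nonneg _ _))] at h11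
  have hDanti : ∀ {s t : ℝ}, s ≤ t → (integratedTail ν t).toReal ≤ (integratedTail ν s).toReal :=
    fun {s t} h => ENNReal.toReal_mono (hDfin s) (antitone_lintegral_tail ν h)
  have h12 : (integratedTail ν (y - A₀)).toReal ≤ (integratedTail ν (y - A)).toReal :=
    hDanti (by linarith [le_max_left A₀ 0])
  have h13 := integratedTail_sub_le hν (by linarith : y - A ≤ y + K)
  have h14 : (integratedTail ν (y + K)).toReal ≤ C₀ * tail H y :=
    (hDanti (by linarith)).trans (h3.trans (by gcongr; exact le_max_left _ _))
  rw [Real.norm_of_nonneg (tail_nonneg _ _), Real.norm_of_nonneg (tail_nonneg _ _)] at h5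
  set D := (integratedTail ν (y + K)).toReal
  have hD : 0 ≤ D := ENNReal.toReal_nonneg
  have h15 : m * ((y + K - (y - A)) * tail ν (y - A)) ≤ ε' * tail H y := by
    calc m * ((y + K - (y - A)) * tail ν (y - A)) = m * (A + K) * tail ν (y - A) := by ring
      _ ≤ m * (A + K) * (η * (2 * tail H y)) := by
          gcongr
          exact h5.trans (by gcongr)
      _ = ε' * (m * (A + K) / (m * (A + K) + 1)) * tail H y := by rw [hη]; field_simp
      _ ≤ ε' * 1 * tail H y := by
          gcongr
          rw [div_le_one (by positivity)]; linarith
      _ = _ := by ring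
  have h16 : (m - (offMass ρ ν K).toReal) * D ≤ ε' * tail H y := by
    calc (m - (offMass ρ ν K).toReal) * D ≤ ε' / (C₀ + 1) * D := by gcongr; linarith
      _ ≤ ε' / (C₀ + 1) * (C₀ * tail H y) := by gcongr
      _ = ε' * (C₀ / (C₀ + 1)) * tail H y := by ring
      _ ≤ ε' * 1 * tail H y := by
          gcongr
          rw [div_le_one (by positivity)]; linarith
      _ = _ := by ring
  have h17 : (Γ + ε') * tail H (y - K) ≤ (Γ + 2 * ε') * tail H y := by
    calc (Γ + ε') * tail H (y - K) ≤ (Γ + ε') * ((1 + ε' / (Γ + ε')) * tail H y) := by gcongr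
      _ = _ := by field_simp; ring
  have h18 := mul_le_mul_of_nonneg_left (h12.trans h13) hm0
  rw [mul_add] at h18
  rw [sub_mul] at h16
  linarith

end CycleTail

end ModulatedWalk

namespace ModulatedWalk

/-! ### The initial cycle is negligible -/

section InitialCycle

variable {F H ν : Measure ℝ} [IsProbabilityMeasure F] [IsProbabilityMeasure H]
  [IsProbabilityMeasure ν] {b : ℝ}

/-- A law on `ℝ` whose tail is negligible, and a family of probabilities with negligible tail, have
a negligible convolution. -/
theorem HeavyTail.eventually_convolution_le (hH : HeavyTail H) {Λ : Measure ℝ} [IsProbabilityMeasure Λ]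
    {f : ℝ → ℝ} (hf : Antitone f) (hf0 : ∀ t, 0 ≤ f t) (hf1 : ∀ t, f t ≤ 1)
    (hΛ : ∀ ε, 0 < ε → ∀ᶠ y in atTop, Λ.real (Ioi y) ≤ ε * tail H y)
    (hfH : ∀ ε, 0 < ε → ∀ᶠ y in atTop, f y ≤ ε * tail H y) {ε : ℝ} (hε : 0 < ε) :
    ∀ᶠ y in atTop, ∫⁻ s, ENNReal.ofReal (f (y - s)) ∂Λ ≤ ENNReal.ofReal (ε * tail H y) := by
  obtain ⟨C, hC0, hC⟩ := hH.exists_bound (g := fun t => Λ.real (Ioi t)) (fun t => measureReal_le_one)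
    (hΛ 1 one_pos)
  obtain ⟨R, hR0, hR⟩ := hH.exists_bound hf1 (hfH 1 one_pos)
  obtain ⟨B, hB, y₀, hconv⟩ := hH.lintegral_shift_le (by positivity : (0 : ℝ) < ε / (2 * (C * R + 1)))
  have hsh : Tendsto (fun y : ℝ => y - B) atTop atTop := tendsto_atTop_add_const_right atTop (-B) tendsto_id
  filter_upwards [eventually_ge_atTop y₀, hsh.eventually (hΛ (ε / 8) (by positivity)),
    hsh.eventually (hfH (ε / 8) (by positivity)), hH.eventually_shift_le B one_lt_two] with y h1 h2 h3 h4
  refine (hconv Λ f C R hC0 hR0 hf hf1 hC hf0 hR y h1).trans (ENNReal.ofReal_le_ofReal ?_)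
  have h6 : ε / (2 * (C * R + 1)) * C * R ≤ ε / 2 := by
    have h7 : 0 ≤ C * R := by positivity
    rw [div_mul_eq_mul_div, div_mul_eq_mul_div, div_le_div_iff₀ (by positivity) (by positivity)]
    nlinarith
  rw [probReal_univ, one_mul]
  have h8 := mul_le_mul_of_nonneg_right h6 (tail_nonneg H y)
  have h9 := mul_le_mul_of_nonneg_left h4 (by positivity : 0 ≤ ε / 8)
  linarith

/-- Since `tail ν` is negligible against `tail H`, adding one summand at a time preserves
negligibility. Positive parts are taken so that a sum of `k` terms bounds all shorter partial sums.
-/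
theorem eventually_unifSeq_sum_le (hH : HeavyTail H) (hν : tail ν =o[atTop] tail H) (k : ℕ) {ε : ℝ}
    (hε : 0 < ε) : ∀ᶠ y in atTop,
      unifSeq.real {u | y < ∑ i ∈ Finset.range k, max (quantile ν (u i)) 0} ≤ ε * tail H y := by
  have hq := measurable_quantile ν
  induction k generalizing ε with
  | zero =>
    filter_upwards [eventually_ge_atTop 0] with y hy
    have : {u : ℕ → ℝ | y < ∑ i ∈ Finset.range 0, max (quantile ν (u i)) 0} = ∅ := by
      ext u; simp [hy]
    rw [this, measureReal_empty]
    exact mul_nonneg hε.le (tail_nonneg _ _)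
  | succ k ih =>
    set Λ := unifSeq.map fun u => max (quantile ν (u k)) 0 with hΛ
    have hYm : Measurable fun u : ℕ → ℝ => max (quantile ν (u k)) 0 := by fun_prop
    have hSm : Measurable fun u : ℕ → ℝ => ∑ i ∈ Finset.range k, max (quantile ν (u i)) 0 := by fun_prop
    have : IsProbabilityMeasure Λ := Measure.isProbabilityMeasure_map hYm.aemeasurable
    have hΛtail : ∀ y, 0 ≤ y → Λ.real (Ioi y) = tail ν y := by
      intro y hy
      rw [hΛ, map_measureReal_apply hYm measurableSet_Ioi, tail, measureReal_def, measureReal_def,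
        ← unif_quantile_Ioi ν, ← unifSeq_map_eval k, Measure.map_apply (measurable_pi_apply k)
          (measurableSet_lt measurable_const hq)]
      congr 2
      ext u
      simp [not_lt.2 hy]
    have hind : iIndepFun (fun (i : ℕ) (z : ℕ → ℝ) => z i) unifSeq :=
      iIndepFun_infinitePi (X := fun _ x => x) fun _ => measurable_id
    have hpair := indepFun_of_dependsOn hind (fun i => measurable_pi_apply i) (S := {k})
      (T := Iio k) (by simp) hYm hSm (fun x y hxy => by simp only [hxy k rfl])
      (fun x y hxy => Finset.sum_congr rfl fun i hi => by
        rw [hxy i (by simpa using hi)])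
    have key := hH.eventually_convolution_le (Λ := Λ)
      (f := fun y => unifSeq.real {u | y < ∑ i ∈ Finset.range k, max (quantile ν (u i)) 0})
      (fun s t hst => measureReal_mono fun u (hu : t < _) => lt_of_le_of_lt hst hu)
      (fun t => measureReal_nonneg) (fun t => measureReal_le_one)
      (fun ε hε => by
        filter_upwards [hν.bound hε, eventually_ge_atTop 0] with y h1 h2
        rw [Real.norm_of_nonneg (tail_nonneg _ _), Real.norm_of_nonneg (tail_nonneg _ _)] at h1
        rwa [hΛtail y h2]) (fun ε hε => ih hε) hε
    filter_upwards [key] with y hy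
    refine ENNReal.toReal_le_of_le_ofReal (mul_nonneg hε.le (tail_nonneg _ _)) (le_trans (le_of_eq ?_) hy)
    have hW : MeasurableSet {p : ℝ × ℝ | y < p.2 + p.1} :=
      measurableSet_lt measurable_const (by fun_prop)
    have h1 := measure_eq_lintegral_of_indepFun hYm hSm hpair hW
    have hanti : Antitone fun y => ENNReal.ofReal
        (unifSeq.real {u | y < ∑ i ∈ Finset.range k, max (quantile ν (u i)) 0}) := fun s t hst =>
      ENNReal.ofReal_le_ofReal (measureReal_mono fun u (hu : t < _) => lt_of_le_of_lt hst hu)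
    rw [hΛ, lintegral_map (f := fun s => ENNReal.ofReal
      (unifSeq.real {u | y - s < ∑ i ∈ Finset.range k, max (quantile ν (u i)) 0}))
      (hanti.measurable.comp (measurable_const.sub measurable_id)) hYm]
    calc _ = unifSeq {u | (max (quantile ν (u k)) 0, ∑ i ∈ Finset.range k, max (quantile ν (u i)) 0) ∈
          {p : ℝ × ℝ | y < p.2 + p.1}} := by
          congr 1; ext u; simp [Finset.sum_range_succ]
      _ = _ := by
          rw [h1]
          refine lintegral_congr fun u => ?_
          rw [ofReal_measureReal]
          congr 1; ext v
          simp [sub_lt_iff_lt_add]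

variable {𝒳 : Type*} [MeasurableSpace 𝒳] {ρ : Measure (ℕ × (ℕ → 𝒳))} [IsProbabilityMeasure ρ]

/-- Lowering each of the `j` steps taken by `b` costs `b j`, which is at most `max (b τ) 0` for
either sign of `b`. -/
theorem mem_walkExceed_of_lt_cycleMax {a : ℕ × (ℕ → 𝒳)} {u : ℕ → ℝ} {y : ℝ}
    (h : y < cycleMax (fun _ => quantile ν) (a, u)) :
    u ∈ walkExceed ν b (y - max (b * a.1) 0) := by
  obtain ⟨j, hj, hlt⟩ := lt_cycleMax_iff.1 h
  refine Or.inr ⟨j, ?_⟩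
  simp only [partSum] at hlt
  simp only [Finset.sum_sub_distrib, Finset.sum_const, Finset.card_range, nsmul_eq_mul]
  have hj' : (j : ℝ) ≤ a.1 := by exact_mod_cast hj
  have : b * j ≤ max (b * a.1) 0 := by
    rcases le_total 0 b with hb | hb
    · exact (mul_le_mul_of_nonneg_left hj' hb).trans (le_max_left _ _)
    · exact (mul_nonpos_of_nonpos_of_nonneg hb (by positivity)).trans (le_max_right _ _)
  linarith

theorem cycleMax_le_sum_max {a : ℕ × (ℕ → 𝒳)} {u : ℕ → ℝ} {k : ℕ} (ha : a.1 ≤ k) :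
    cycleMax (fun _ => quantile ν) (a, u) ≤ ∑ i ∈ Finset.range k, max (quantile ν (u i)) 0 := by
  by_contra hlt
  obtain ⟨j, hj, hlt⟩ := lt_cycleMax_iff.1 (not_le.1 hlt)
  refine absurd hlt (not_lt.2 ?_)
  simp only [partSum]
  refine (Finset.sum_le_sum fun i _ => le_max_left _ (0 : ℝ)).trans
    (Finset.sum_le_sum_of_subset_of_nonneg (fun i hi => ?_) fun _ _ _ => le_max_right _ _)
  simp only [Finset.mem_range] at hi ⊢
  exact hi.trans_le (hj.trans ha)

theorem tendsto_measure_length_gt :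
    Tendsto (fun k : ℕ => ρ.real {a | k < a.1}) atTop (𝓝 0) := by
  have h := tendsto_measure_compl_of_ae_exists (μ := ρ) (G := fun k : ℕ => {a | a.1 ≤ k})
    (fun k => measurableSet_le measurable_fst measurable_const)
    (fun k l hkl a (ha : a.1 ≤ k) => ha.trans hkl) (ae_of_all _ fun a => ⟨a.1, le_refl a.1⟩)
  refine h.congr fun k => ?_
  congr 1; ext a; simp

/-- The maximum within a cycle is negligible if the length of the cycle is. -/
theorem eventually_cycleMax_le_of_length (hFH : IsSecondTail F H) (hν : Integrable (fun t : ℝ => t) ν)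
    (hνF : tail ν =O[atTop] tail F) {C : ℝ}
    (hC : ∀ᶠ y in atTop, (integratedTail ν y).toReal ≤ C * tail H y) (hb : ∫ t, t ∂ν < b)
    (hτ : (fun y => ρ.real {a | y < b * (a.1 : ℝ)}) =o[atTop] tail H) {ε : ℝ} (hε : 0 < ε) :
    ∀ᶠ y in atTop, (ρ.prod unifSeq).real {z | y < cycleMax (fun _ => quantile ν) z} ≤ ε * tail H y := by
  obtain ⟨R, hR0, hR⟩ := exists_walkExceed_bound hFH.heavy hν hC hb
  have hτ' : ∀ ε, 0 < ε → ∀ᶠ y in atTop, ρ.real {a | y < b * (a.1 : ℝ)} ≤ ε * tail H y := by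
    intro ε hε
    filter_upwards [hτ.bound hε] with y hy
    rwa [Real.norm_of_nonneg measureReal_nonneg, Real.norm_of_nonneg (tail_nonneg _ _)] at hy
  obtain ⟨C', hC'0, hC'⟩ := hFH.heavy.exists_bound (g := fun t => ρ.real {a | t < b * (a.1 : ℝ)})
    (fun t => measureReal_le_one) (hτ' 1 one_pos)
  obtain ⟨B, hB, y₀, hconv⟩ := hFH.heavy.lintegral_shift_le
    (by positivity : (0 : ℝ) < ε / (4 * (C' * R + 1)))
  -- The bound available for the i.i.d. walk is only of order `tail H`, so it must be multiplied by
  -- a small probability. It is applied to cycles longer than `k`; a shorter cycle is bounded by `k`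
  -- positive parts.
  obtain ⟨k, hk⟩ := ((tendsto_measure_length_gt (ρ := ρ)).eventually
    (gt_mem_nhds (by positivity : 0 < ε / (8 * (R + 1))))).exists
  have hgm : Measurable fun a : ℕ × (ℕ → 𝒳) => max (b * (a.1 : ℝ)) 0 := by fun_prop
  set Λ := (ρ.restrict {a | k < a.1}).map fun a => max (b * (a.1 : ℝ)) 0 with hΛ
  have hkm : MeasurableSet {a : ℕ × (ℕ → 𝒳) | k < a.1} := measurableSet_lt measurable_const measurable_fst
  have hΛuniv : Λ.real univ = ρ.real {a | k < a.1} := by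
    rw [hΛ, map_measureReal_apply hgm MeasurableSet.univ, preimage_univ,
      measureReal_restrict_apply MeasurableSet.univ, univ_inter]
  have hΛtail : ∀ t, 0 ≤ t → Λ.real (Ioi t) ≤ ρ.real {a | t < b * (a.1 : ℝ)} := by
    intro t ht
    rw [hΛ, map_measureReal_apply hgm measurableSet_Ioi,
      measureReal_restrict_apply (hgm measurableSet_Ioi)]
    refine measureReal_mono ?_
    rintro a ⟨ha, _⟩
    have ha' : t < max (b * (a.1 : ℝ)) 0 := ha
    rcases lt_max_iff.1 ha' with h | h
    · exact h
    · linarith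
  have hq : Measurable fun p : 𝒳 × ℝ => (fun _ => quantile ν : 𝒳 → ℝ → ℝ) p.1 p.2 :=
    (measurable_quantile ν).comp measurable_snd
  have hVm := measurable_cycleMax (q := fun _ => quantile ν) hq
  have hsh : Tendsto (fun y : ℝ => y - B) atTop atTop := tendsto_atTop_add_const_right atTop (-B) tendsto_id
  filter_upwards [eventually_ge_atTop y₀, eventually_ge_atTop B,
    eventually_unifSeq_sum_le hFH.heavy (hνF.trans_isLittleO hFH.little) k (by positivity : 0 < ε / 4),
    hsh.eventually (hτ' (ε / 8) (by positivity)), hFH.heavy.eventually_shift_le B one_lt_two]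
    with y h1 h2 h3 h4 h5
  have hpos := tail_nonneg H y
  have hsplit : (ρ.prod unifSeq) {z | y < cycleMax (fun _ => quantile ν) z} ≤
      unifSeq {u | y < ∑ i ∈ Finset.range k, max (quantile ν (u i)) 0} +
        ∫⁻ s, ENNReal.ofReal (unifSeq.real (walkExceed ν b (y - s))) ∂Λ := by
    have hmz : MeasurableSet {z : (ℕ × (ℕ → 𝒳)) × (ℕ → ℝ) | y < cycleMax (fun _ => quantile ν) z} :=
      hVm measurableSet_Ioi
    rw [Measure.prod_apply hmz, ← lintegral_add_compl _ hkm, add_comm]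
    gcongr ?_ + ?_
    · calc _ ≤ ∫⁻ _ in {a : ℕ × (ℕ → 𝒳) | k < a.1}ᶜ,
            unifSeq {u | y < ∑ i ∈ Finset.range k, max (quantile ν (u i)) 0} ∂ρ := by
            refine setLIntegral_mono' hkm.compl fun a ha => measure_mono fun u hu => ?_
            have hu' : y < cycleMax (fun _ => quantile ν) (a, u) := hu
            have ha' : a.1 ≤ k := not_lt.1 ha
            exact hu'.trans_le (cycleMax_le_sum_max ha')
        _ ≤ _ := by
            rw [setLIntegral_const]
            exact mul_le_of_le_one_right' prob_le_one
    · have hanti : Antitone fun t => ENNReal.ofReal (unifSeq.real (walkExceed ν b t)) := fun s t hst =>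
        ENNReal.ofReal_le_ofReal (measureReal_mono (antitone_walkExceed ν b hst))
      rw [hΛ, lintegral_map (f := fun s => ENNReal.ofReal (unifSeq.real (walkExceed ν b (y - s))))
        (hanti.measurable.comp (measurable_const.sub measurable_id)) hgm]
      refine lintegral_mono fun a => ?_
      rw [ofReal_measureReal]
      exact measure_mono fun u hu => mem_walkExceed_of_lt_cycleMax hu
  have h6 := hconv Λ (fun t => unifSeq.real (walkExceed ν b t)) C' R hC'0 hR0
    (fun s t hst => measureReal_mono (antitone_walkExceed ν b hst)) (fun t => measureReal_le_one)
    (fun t ht => (hΛtail t ht).trans (hC' t ht)) (fun t => measureReal_nonneg) hR y h1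
  have hbound : Λ.real (Ioi (y - B)) + Λ.real univ * unifSeq.real (walkExceed ν b (y - B)) +
      ε / (4 * (C' * R + 1)) * C' * R * tail H y ≤ 3 * (ε / 4) * tail H y := by
    have e1 := (hΛtail (y - B) (by linarith)).trans h4
    have e2 := mul_le_mul_of_nonneg_left h5 (by positivity : 0 ≤ ε / 8)
    have e3 : Λ.real univ * unifSeq.real (walkExceed ν b (y - B)) ≤ ε / 4 * tail H y := by
      rw [hΛuniv]
      calc _ ≤ ε / (8 * (R + 1)) * (R * (2 * tail H y)) := by
            gcongr
            exact (hR _ (by linarith)).trans (by gcongr)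
        _ = ε / 4 * (R / (R + 1)) * tail H y := by field_simp; ring
        _ ≤ ε / 4 * 1 * tail H y := by
            gcongr
            rw [div_le_one (by positivity)]; linarith
        _ = _ := by ring
    have e4 : ε / (4 * (C' * R + 1)) * C' * R ≤ ε / 4 := by
      have h7 : 0 ≤ C' * R := by positivity
      rw [div_mul_eq_mul_div, div_mul_eq_mul_div, div_le_div_iff₀ (by positivity) (by positivity)]
      nlinarith
    have e5 := mul_le_mul_of_nonneg_right e4 hpos
    linarith
  have h7 : (ρ.prod unifSeq) {z | y < cycleMax (fun _ => quantile ν) z} ≤ ENNReal.ofReal (ε * tail H y) := by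
    refine hsplit.trans ?_
    calc _ ≤ ENNReal.ofReal (ε / 4 * tail H y) + ENNReal.ofReal (3 * (ε / 4) * tail H y) := by
          refine add_le_add ?_ (h6.trans (ENNReal.ofReal_le_ofReal hbound))
          rw [← ofReal_measureReal]
          exact ENNReal.ofReal_le_ofReal h3
      _ = _ := by
          rw [← ENNReal.ofReal_add (by positivity) (by positivity)]
          congr 1; ring
  exact ENNReal.toReal_le_of_le_ofReal (by positivity) h7

end InitialCycle

end ModulatedWalk

namespace ModulatedWalk

/-! ### The coupled walk and its upper bound -/

section CoupledWalk

variable {Ω 𝒳 : Type*} [MeasurableSpace Ω] [MeasurableSpace 𝒳] {μ : Measure Ω} [IsProbabilityMeasure μ]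
  {X : ℕ → Ω → 𝒳} {T : ℕ → Ω → ℕ}

/-- The walk with increments `quantile (P (X j)) (u_j)`, where the marks `u_j` are read off cycle by
cycle from a double array. -/
noncomputable def coupledWalk (X : ℕ → Ω → 𝒳) (T : ℕ → Ω → ℕ) (P : Kernel 𝒳 ℝ)
    (p : Ω × (ℕ → ℕ → ℝ)) (m : ℕ) : ℝ :=
  ∑ j ∈ Finset.range m, quantile (P (X j p.1)) (concat (fun n => cycleLength T n p.1) p.2 j)

/-- The marked cycle number `n`. -/
noncomputable def markedCycle (X : ℕ → Ω → 𝒳) (T : ℕ → Ω → ℕ) (x₀ : 𝒳) (n : ℕ)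
    (p : Ω × (ℕ → ℕ → ℝ)) : (ℕ × (ℕ → 𝒳)) × (ℕ → ℝ) := (cycleWord X T x₀ n p.1, p.2 n)

theorem coupledWalk_blockStart_add {P : Kernel 𝒳 ℝ} (x₀ : 𝒳) {p : Ω × (ℕ → ℕ → ℝ)}
    (hT : StrictMono fun n => T n p.1) (n : ℕ) {j : ℕ} (hj : j ≤ cycleLength T n p.1) :
    coupledWalk X T P p (blockStart (fun n => cycleLength T n p.1) n + j) =
      (∑ i ∈ Finset.range n, cycleSum (fun x => quantile (P x)) (markedCycle X T x₀ i p)) +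
        partSum (fun x => quantile (P x)) (markedCycle X T x₀ n p) j := by
  unfold coupledWalk
  rw [sum_range_blockStart_add (ℓ := fun n => cycleLength T n p.1)
    (Y := fun j => quantile (P (X j p.1)) (concat (fun n => cycleLength T n p.1) p.2 j))
    (y := fun n i => quantile (P ((cycleWord X T x₀ n p.1).2 i)) (p.2 n i)) (fun n i hi => ?_) n hj]
  · rfl
  · rw [concat_apply (one_le_cycleLength hT) p.2 hi, cycleWord_snd X T x₀ hi,
      cycleStart_eq_blockStart hT]

theorem IsRegenerative.measurable_markedCycle (hX : IsRegenerative μ X T) (x₀ : 𝒳) (n : ℕ) :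
    Measurable (markedCycle X T x₀ n) :=
  ((hX.measurable_cycleWord x₀ n).comp measurable_fst).prodMk
    ((measurable_pi_apply n).comp measurable_snd)

theorem IsRegenerative.isProbabilityMeasure_map (hX : IsRegenerative μ X T) (x₀ : 𝒳) (n : ℕ) :
    IsProbabilityMeasure (μ.map (cycleWord X T x₀ n)) :=
  Measure.isProbabilityMeasure_map (hX.measurable_cycleWord x₀ n).aemeasurable

theorem IsRegenerative.iIndepFun_markedCycle (hX : IsRegenerative μ X T) (x₀ : 𝒳) :
    iIndepFun (markedCycle X T x₀) (μ.prod unifArray) :=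
  iIndepFun_pair (hX.iIndepFun_cycleWord x₀) (fun n => hX.measurable_cycleWord x₀ n) unifSeq

theorem IsRegenerative.map_markedCycle (hX : IsRegenerative μ X T) (x₀ : 𝒳) (n : ℕ) :
    (μ.prod unifArray).map (markedCycle X T x₀ n) = (μ.map (cycleWord X T x₀ n)).prod unifSeq :=
  map_pair_eval (fun n => hX.measurable_cycleWord x₀ n) unifSeq n

/-- The initial cycle is independent of the later ones, which are independent and identically
distributed. -/
theorem IsRegenerative.measure_markedCycle (hX : IsRegenerative μ X T) (x₀ : 𝒳)
    {W : Set (((ℕ × (ℕ → 𝒳)) × (ℕ → ℝ)) × (ℕ → (ℕ × (ℕ → 𝒳)) × (ℕ → ℝ)))} (hW : MeasurableSet W) :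
    (μ.prod unifArray) {p | (markedCycle X T x₀ 0 p, fun n => markedCycle X T x₀ (n + 1) p) ∈ W} =
      ∫⁻ z, Measure.infinitePi (fun _ : ℕ => (μ.map (cycleWord X T x₀ 1)).prod unifSeq)
        {v | (z, v) ∈ W} ∂((μ.map (cycleWord X T x₀ 0)).prod unifSeq) := by
  have hm := fun n => hX.measurable_markedCycle x₀ n
  have hi := hX.iIndepFun_markedCycle x₀
  have : IsProbabilityMeasure (μ.map (cycleWord X T x₀ 1)) := hX.isProbabilityMeasure_map x₀ 1
  have : Nonempty ((ℕ × (ℕ → 𝒳)) × (ℕ → ℝ)) := ⟨((0, fun _ => x₀), fun _ => 0)⟩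
  have hm1 : Measurable fun p n => markedCycle X T x₀ (n + 1) p := measurable_pi_iff.2 fun n => hm (n + 1)
  have hind : IndepFun (markedCycle X T x₀ 0) (fun p n => markedCycle X T x₀ (n + 1) p)
      (μ.prod unifArray) :=
    indepFun_of_dependsOn hi hm (S := {0}) (T := {0}ᶜ) disjoint_compl_right
      (g := fun v => v 0) (k := fun v n => v (n + 1)) (measurable_pi_apply 0)
      (measurable_pi_iff.2 fun n => measurable_pi_apply (n + 1)) (fun x y hxy => hxy 0 rfl)
      (fun x y hxy => funext fun n => hxy (n + 1) (by simp))
  have hlaw : (μ.prod unifArray).map (fun p n => markedCycle X T x₀ (n + 1) p) =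
      Measure.infinitePi fun _ : ℕ => (μ.map (cycleWord X T x₀ 1)).prod unifSeq := by
    have h := (hi.precomp (g := fun n : ℕ => n + 1) (add_left_injective 1)).map_fun_eq_infinitePi_map
      fun n => hm (n + 1)
    refine h.trans ?_
    congr 1
    funext n
    rw [← hX.map_cycleWord x₀ (Nat.le_add_left 1 n)]
    exact hX.map_markedCycle x₀ (n + 1)
  have hmap := (indepFun_iff_map_prod_eq_prod_map_map (hm 0).aemeasurable hm1.aemeasurable).1 hind
  have h1 := Measure.map_apply (μ := μ.prod unifArray) ((hm 0).prodMk hm1) hW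
  rw [hmap, hX.map_markedCycle x₀ 0, hlaw, Measure.prod_apply hW] at h1
  exact h1.symm

theorem IsRegenerative.ae_one_le_cycleWord (hX : IsRegenerative μ X T) (x₀ : 𝒳) :
    ∀ᵐ a ∂(μ.map (cycleWord X T x₀ 1)), 1 ≤ a.1 := by
  have hS : MeasurableSet {a : ℕ × (ℕ → 𝒳) | 1 ≤ a.1} := measurableSet_le measurable_const measurable_fst
  refine (ae_map_iff (hX.measurable_cycleWord x₀ 1).aemeasurable hS).2 ?_
  filter_upwards [hX.strictMono] with ω hω
  exact one_le_cycleLength hω 1 le_rfl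

theorem IsRegenerative.map_cycleWord_real_length (hX : IsRegenerative μ X T) (x₀ : 𝒳) (n : ℕ) (b y : ℝ) :
    (μ.map (cycleWord X T x₀ n)).real {a | y < b * (a.1 : ℝ)} =
      μ.real {ω | y < b * (cycleLength T n ω : ℝ)} := by
  have hS : MeasurableSet {a : ℕ × (ℕ → 𝒳) | y < b * (a.1 : ℝ)} :=
    measurableSet_lt measurable_const (by fun_prop)
  rw [map_measureReal_apply (hX.measurable_cycleWord x₀ n) hS]
  rfl

/-- The time `m` is located in its cycle. If this is a later cycle, the increment over cycle `0` is
bounded by the maximum there, which acts as an additive head start for the later cycles. -/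
theorem exists_cycle_of_lt_coupledWalk {P : Kernel 𝒳 ℝ} (x₀ : 𝒳) {p : Ω × (ℕ → ℕ → ℝ)}
    (hT : StrictMono fun n => T n p.1) {y : ℝ} {m : ℕ} (h : y < coupledWalk X T P p m) :
    y < cycleMax (fun x => quantile (P x)) (markedCycle X T x₀ 0 p) ∨
      ∃ n, y - cycleMax (fun x => quantile (P x)) (markedCycle X T x₀ 0 p) <
        peak (fun n => cyclePair (fun x => quantile (P x)) 0 (markedCycle X T x₀ (n + 1) p)) n := by
  set ℓ : ℕ → ℕ := fun n => cycleLength T n p.1 with hℓ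
  have hoff := blockOffset_lt (one_le_cycleLength hT) m
  rw [← blockStart_add_blockOffset ℓ m, coupledWalk_blockStart_add x₀ hT _ hoff.le] at h
  have hle := partSum_le_cycleMax (q := fun x => quantile (P x))
    (markedCycle X T x₀ (blockIndex ℓ m) p) (j := blockOffset ℓ m) hoff.le
  rcases hb : blockIndex ℓ m with _ | n
  · left
    rw [hb] at h hle
    simp only [Finset.range_zero, Finset.sum_empty, zero_add] at h
    exact h.trans_le hle
  · right
    rw [hb] at h hle
    refine ⟨n, ?_⟩
    rw [Finset.sum_range_succ'] at h
    have h0 := cycleSum_le_cycleMax (q := fun x => quantile (P x)) (markedCycle X T x₀ 0 p)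
    simp only [peak, cyclePair, zero_mul, sub_zero]
    linarith

variable {F H ν : Measure ℝ} [IsProbabilityMeasure F] [IsProbabilityMeasure H] [IsProbabilityMeasure ν]
  {P : Kernel 𝒳 ℝ} [IsMarkovKernel P] {b : ℝ} {c : 𝒳 → ℝ} {L : ℝ}

/-- The initial cycle is independent of the others, so its maximum and the maximum of the later walk
are convolved. Passage within the initial cycle falls under the clause `y < 0` of `exceed`. -/
theorem coupledWalk_exceed_le (hX : IsRegenerative μ X T) (x₀ : 𝒳) (y : ℝ) :
    (μ.prod unifArray) {p | ∃ m, y < coupledWalk X T P p m} ≤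
      ∫⁻ s, ENNReal.ofReal ((seqLaw (pairLaw (μ.map (cycleWord X T x₀ 1))
        (fun x => quantile (P x)) 0)).real (exceed (y - s)))
        ∂(((μ.map (cycleWord X T x₀ 0)).prod unifSeq).map (cycleMax fun x => quantile (P x))) := by
  have hq := measurable_quantile_uncurry P
  have : IsProbabilityMeasure (μ.map (cycleWord X T x₀ 1)) := hX.isProbabilityMeasure_map x₀ 1
  have hVm := measurable_cycleMax (q := fun x => quantile (P x)) hq
  have hpm := measurable_cyclePair (q := fun x => quantile (P x)) hq 0
  have hfm : Measurable fun (v : ℕ → (ℕ × (ℕ → 𝒳)) × (ℕ → ℝ)) n =>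
      cyclePair (fun x => quantile (P x)) 0 (v n) :=
    measurable_pi_iff.2 fun n => hpm.comp (measurable_pi_apply n)
  set W : Set (((ℕ × (ℕ → 𝒳)) × (ℕ → ℝ)) × (ℕ → (ℕ × (ℕ → 𝒳)) × (ℕ → ℝ))) :=
    {r | (fun n => cyclePair (fun x => quantile (P x)) 0 (r.2 n)) ∈
      exceed (y - cycleMax (fun x => quantile (P x)) r.1)} with hWdef
  have hW : MeasurableSet W := by
    have : W = {r | y - cycleMax (fun x => quantile (P x)) r.1 < 0} ∪ ⋃ n : ℕ,
        {r | y - cycleMax (fun x => quantile (P x)) r.1 <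
          peak (fun n => cyclePair (fun x => quantile (P x)) 0 (r.2 n)) n} := by
      ext r; simp [hWdef, exceed]
    rw [this]
    have h1 : Measurable fun r : ((ℕ × (ℕ → 𝒳)) × (ℕ → ℝ)) × (ℕ → (ℕ × (ℕ → 𝒳)) × (ℕ → ℝ)) =>
        y - cycleMax (fun x => quantile (P x)) r.1 := (hVm.comp measurable_fst).const_sub y
    exact (measurableSet_lt h1 measurable_const).union (MeasurableSet.iUnion fun n =>
      measurableSet_lt h1 ((measurable_peak n).comp (hfm.comp measurable_snd)))
  have hanti : Antitone fun t => ENNReal.ofReal ((seqLaw (pairLaw (μ.map (cycleWord X T x₀ 1))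
      (fun x => quantile (P x)) 0)).real (exceed t)) := by
    have := isProbabilityMeasure_pairLaw (ρ := μ.map (cycleWord X T x₀ 1)) (d := 0)
      (q := fun x => quantile (P x)) hq
    exact fun s t hst => ENNReal.ofReal_le_ofReal (measureReal_mono (antitone_exceed hst))
  rw [lintegral_map (f := fun s => ENNReal.ofReal ((seqLaw (pairLaw (μ.map (cycleWord X T x₀ 1))
      (fun x => quantile (P x)) 0)).real (exceed (y - s))))
      (hanti.measurable.comp (measurable_const.sub measurable_id)) hVm]
  calc _ ≤ (μ.prod unifArray)
        {p | (markedCycle X T x₀ 0 p, fun n => markedCycle X T x₀ (n + 1) p) ∈ W} := by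
        refine measure_mono_ae ?_
        have ha : ∀ᵐ p ∂(μ.prod unifArray), StrictMono fun n => T n p.1 :=
          Measure.quasiMeasurePreserving_fst.ae hX.strictMono
        filter_upwards [ha] with p hp hpy
        obtain ⟨m, hm⟩ := hpy
        rcases exists_cycle_of_lt_coupledWalk x₀ hp hm with h | h
        · exact Or.inl (by simpa using h)
        · exact Or.inr h
    _ = _ := by
        rw [hX.measure_markedCycle x₀ hW]
        refine lintegral_congr fun z => ?_
        have := isProbabilityMeasure_pairLaw (ρ := μ.map (cycleWord X T x₀ 1)) (d := 0)
          (q := fun x => quantile (P x)) hq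
        rw [ofReal_measureReal, seqLaw, pairLaw,
          ← Measure.infinitePi_map_pi (μ := fun _ : ℕ => (μ.map (cycleWord X T x₀ 1)).prod unifSeq)
            (f := fun _ => cyclePair (fun x => quantile (P x)) 0) (fun _ => hpm),
          Measure.map_apply hfm (measurableSet_exceed _)]
        rfl

/-- At `ε = 0` the expression is `Γ / α`, and continuity does the rest. The term `5 ε` is the sum of
two errors doubled by a shift and one convolution remainder in the estimate that follows. -/
theorem exists_upper_ratio {α Γ c' : ℝ} (hα : 0 < α) (h : Γ / α < c') :
    ∃ ε, 0 < ε ∧ ε < α ∧ (α - ε)⁻¹ * ((Γ + ε) * (1 + ε)) + 5 * ε ≤ c' := by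
  have h1 : ContinuousAt (fun ε : ℝ => (α - ε)⁻¹ * ((Γ + ε) * (1 + ε)) + 5 * ε) 0 :=
    ((ContinuousAt.inv₀ (by fun_prop) (by simpa using hα.ne')).mul (by fun_prop)).add (by fun_prop)
  have h2 : (α - 0)⁻¹ * ((Γ + 0) * (1 + 0)) + 5 * 0 < c' := by
    rw [sub_zero, add_zero, add_zero, mul_one, mul_zero, add_zero, ← div_eq_inv_mul]; exact h
  have h3 := (h1.eventually (gt_mem_nhds h2)).filter_mono (nhdsWithin_le_nhds (s := Ioi 0))
  have h4 : ∀ᶠ ε in 𝓝[>] (0 : ℝ), ε < α := (eventually_lt_nhds hα).filter_mono nhdsWithin_le_nhds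
  obtain ⟨ε, hε1, hε2, hε3⟩ := (h3.and (h4.and self_mem_nhdsWithin)).exists
  exact ⟨ε, hε3, hε2, hε1.le⟩

/-- The asymptotic upper bound for the maximum of the coupled walk. -/
theorem eventually_coupledWalk_le (hX : IsRegenerative μ X T) (x₀ : 𝒳) (hFH : IsSecondTail F H)
    (hPν : ∀ x y, tail (P x) y ≤ tail ν y) (hP : ∀ x, Integrable (fun t : ℝ => t) (P x))
    (hc : ∀ x, Tendsto (fun y => tail (P x) y / tail F y) atTop (𝓝 (c x)))
    (hL : ∀ x, ∀ y, 0 ≤ y → tail (P x) y ≤ L * tail F y)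
    (hρ : ∫⁻ a, (a.1 : ℝ≥0∞) ∂(μ.map (cycleWord X T x₀ 1)) < ∞)
    (hint : ∫⁻ x, ∫⁻ u, ‖quantile (P x) u‖ₑ ∂unif ∂(intensity (μ.map (cycleWord X T x₀ 1))) < ∞)
    {α : ℝ} (hα : 0 < α)
    (hdrift : ∫ x, ∫ u, quantile (P x) u ∂unif ∂(intensity (μ.map (cycleWord X T x₀ 1))) = -α)
    (hτ0 : (fun y => μ.real {ω | y < b * (cycleLength T 0 ω : ℝ)}) =o[atTop] tail H)
    (hτ1 : (fun y => μ.real {ω | y < b * (cycleLength T 1 ω : ℝ)}) =o[atTop] tail F)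
    (hν : Integrable (fun t : ℝ => t) ν) (hνF : tail ν =O[atTop] tail F) {C : ℝ}
    (hC : ∀ᶠ y in atTop, (integratedTail ν y).toReal ≤ C * tail H y) (hb : ∫ t, t ∂ν < b)
    {c' : ℝ} (hc' : (weightedLimit c (μ.map (cycleWord X T x₀ 1)) fun _ _ => 1).toReal / α < c') :
    ∀ᶠ y in atTop, (μ.prod unifArray).real {p | ∃ m, y < coupledWalk X T P p m} ≤ c' * tail H y := by
  set ρ := μ.map (cycleWord X T x₀ 1) with hρdef
  have : IsProbabilityMeasure ρ := hX.isProbabilityMeasure_map x₀ 1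
  have : IsProbabilityMeasure (μ.map (cycleWord X T x₀ 0)) := hX.isProbabilityMeasure_map x₀ 0
  have hq := measurable_quantile_uncurry P
  have hVm := measurable_cycleMax (q := fun x => quantile (P x)) hq
  have := isProbabilityMeasure_pairLaw (ρ := ρ) (d := 0) (q := fun x => quantile (P x)) hq
  set Γ := (weightedLimit c ρ fun _ _ => 1).toReal with hΓ
  have hΓ0 : 0 ≤ Γ := ENNReal.toReal_nonneg
  obtain ⟨ε, hε, hεα, hεc⟩ := exists_upper_ratio hα hc'
  have hτρ : (fun y => ρ.real {a | y < b * (a.1 : ℝ)}) =o[atTop] tail F := by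
    simpa only [hρdef, hX.map_cycleWord_real_length] using hτ1
  have hQ := fun {ε : ℝ} (hε : 0 < ε) => eventually_integratedTail_cycleMax_kernel_le hFH hPν hc hL
    (hX.ae_one_le_cycleWord x₀) hρ hτρ hν hνF hC hb hε
  have hpk : ∀ᶠ y in atTop, (peakTail (pairLaw ρ (fun x => quantile (P x)) 0) y).toReal ≤
      (Γ + 1) * tail H y := by
    filter_upwards [hQ one_pos] with y hy
    rwa [peakTail_pairLaw (q := fun x => quantile (P x)) hq]
  have hmean : ∫ p, p.1 ∂(pairLaw ρ (fun x => quantile (P x)) 0) = -α := by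
    rw [integral_pairLaw_fst (q := fun x => quantile (P x)) hq hρ (fun x => integrable_quantile (hP x))
      hint, hdrift, zero_mul, sub_zero]
  have hle := pairLaw_le (ρ := ρ) (q := fun x => quantile (P x)) hq le_rfl
  have hfst := integrable_pairLaw_fst (ρ := ρ) (d := 0) (q := fun x => quantile (P x)) hq hρ hint
  have hsnd := integrable_pairLaw_snd (ρ := ρ) (d := 0) (q := fun x => quantile (P x)) hq hint
  obtain ⟨R, hR0, hR⟩ := exists_exceed_bound hFH.heavy hle hfst hsnd (by rw [hmean]; linarith) hpk
  obtain ⟨K, hK⟩ := eventually_exceed_le hFH.heavy hle hfst hsnd hpk (h := α - ε) (by linarith)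
    (by rw [hmean]; linarith) hε
  set Λ := ((μ.map (cycleWord X T x₀ 0)).prod unifSeq).map (cycleMax fun x => quantile (P x)) with hΛ
  have : IsProbabilityMeasure Λ := Measure.isProbabilityMeasure_map hVm.aemeasurable
  have hΛtail : ∀ ε, 0 < ε → ∀ᶠ y in atTop, Λ.real (Ioi y) ≤ ε * tail H y := by
    intro ε hε
    have hτ0' : (fun y => (μ.map (cycleWord X T x₀ 0)).real {a | y < b * (a.1 : ℝ)}) =o[atTop] tail H := by
      simpa only [hX.map_cycleWord_real_length] using hτ0
    filter_upwards [eventually_cycleMax_le_of_length hFH hν hνF hC hb hτ0' hε] with y hy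
    refine le_trans ?_ hy
    rw [hΛ, map_measureReal_apply hVm measurableSet_Ioi]
    exact measureReal_mono fun z (hz : y < _) =>
      lt_of_lt_of_le hz (cycleMax_mono (fun x v => quantile_mono (hPν x) v) z)
  obtain ⟨C', hC'0, hC'⟩ := hFH.heavy.exists_bound (g := fun t => Λ.real (Ioi t))
    (fun t => measureReal_le_one) (hΛtail 1 one_pos)
  obtain ⟨B, hB, y₀, hconv⟩ := hFH.heavy.lintegral_shift_le (by positivity : (0 : ℝ) < ε / (C' * R + 1))
  have shift : ∀ k : ℝ, Tendsto (fun y : ℝ => y - k) atTop atTop := fun k =>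
    tendsto_atTop_add_const_right atTop (-k) tendsto_id
  filter_upwards [eventually_ge_atTop y₀, hFH.heavy.eventually_shift_le B one_lt_two,
    (shift B).eventually (hΛtail ε hε), (shift B).eventually hK, (shift (B + K)).eventually (hQ hε),
    hFH.heavy.eventually_shift_le (B + K) (by linarith : 1 < 1 + ε)] with y h1 h2 h3 h4 h5 h6
  have hpos := tail_nonneg H y
  -- The initial maximum has a negligible tail, so the convolution returns the walk after the
  -- initial cycle, to which Veraverbeke's upper bound applies.
  have h7 := (coupledWalk_exceed_le (P := P) hX x₀ y).trans (hconv Λ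
    (fun t => (seqLaw (pairLaw ρ (fun x => quantile (P x)) 0)).real (exceed t)) C' R hC'0 hR0
    (fun s t hst => measureReal_mono (antitone_exceed hst)) (fun t => measureReal_le_one) hC'
    (fun t => measureReal_nonneg) hR y h1)
  have h8 : ε / (C' * R + 1) * C' * R ≤ ε := by
    have : 0 ≤ C' * R := by positivity
    rw [div_mul_eq_mul_div, div_mul_eq_mul_div, div_le_iff₀ (by positivity)]
    nlinarith
  have hneg : 0 ≤ (seqLaw (pairLaw ρ (fun x => quantile (P x)) 0)).real (exceed (y - B)) :=
    measureReal_nonneg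
  refine (ENNReal.toReal_le_of_le_ofReal (by positivity) h7).trans ?_
  rw [probReal_univ, one_mul]
  rw [peakTail_pairLaw (q := fun x => quantile (P x)) hq, sub_sub y B K] at h4
  have hinv : 0 ≤ (α - ε)⁻¹ := inv_nonneg.2 (by linarith)
  have h9 : (α - ε)⁻¹ * (integratedTail ((ρ.prod unifSeq).map
      (cycleMax fun x => quantile (P x))) (y - (B + K))).toReal ≤
      (α - ε)⁻¹ * ((Γ + ε) * (1 + ε)) * tail H y := by
    rw [mul_assoc]
    refine mul_le_mul_of_nonneg_left (h5.trans ?_) hinv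
    rw [mul_assoc]
    exact mul_le_mul_of_nonneg_left h6 (by positivity)
  have h10 := mul_le_mul_of_nonneg_right h8 hpos
  have h11 := mul_le_mul_of_nonneg_left h2 hε.le
  have h12 := mul_le_mul_of_nonneg_right hεc hpos
  linarith

end CoupledWalk

end ModulatedWalk

namespace ModulatedWalk

/-! ### Big jumps in `B` within a cycle -/

section JumpSets

variable {𝒳 : Type*} [MeasurableSpace 𝒳] {q : 𝒳 → ℝ → ℝ}

/-- The event that the walk within a cycle is bounded by `K` up to the position `i`. -/
def boundedUpTo (q : 𝒳 → ℝ → ℝ) (K : ℝ) (i : ℕ) : Set ((ℕ × (ℕ → 𝒳)) × (ℕ → ℝ)) :=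
  {z | ∀ j ≤ i, |partSum q z j| ≤ K}

/-- The event that a cycle visits `B`, with an increment above `t` there and a walk bounded by `K`
before. -/
def jumpSet (q : 𝒳 → ℝ → ℝ) (K : ℝ) (B : Set 𝒳) (t : ℝ) : Set ((ℕ × (ℕ → 𝒳)) × (ℕ → ℝ)) :=
  {z | ∃ i < z.1.1, z.1.2 i ∈ B ∧ z ∈ boundedUpTo q K i ∧ t < q (z.1.2 i) (z.2 i)}

variable (hq : Measurable fun p : 𝒳 × ℝ => q p.1 p.2) {B : Set 𝒳} (hB : MeasurableSet B) {K : ℝ}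
include hq

theorem measurableSet_boundedUpTo (i : ℕ) : MeasurableSet (boundedUpTo q K i) := by
  have : boundedUpTo q K i = ⋂ j ∈ Finset.range (i + 1), {z | |partSum q z j| ≤ K} := by
    ext z; simp [boundedUpTo]
  rw [this]
  refine Finset.measurableSet_biInter _ fun j _ => measurableSet_le ?_ measurable_const
  simpa only [Real.norm_eq_abs] using (measurable_partSum hq j).norm

include hB

theorem measurableSet_jumpSet (t : ℝ) : MeasurableSet (jumpSet q K B t) := by
  have : jumpSet q K B t = ⋃ i : ℕ, ({z | i < z.1.1} ∩ {z | z.1.2 i ∈ B}) ∩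
      (boundedUpTo q K i ∩ {z | t < q (z.1.2 i) (z.2 i)}) := by
    ext z; simp [jumpSet, and_assoc]
  rw [this]
  refine MeasurableSet.iUnion fun i => ((measurableSet_lt measurable_const
    (measurable_fst.comp measurable_fst)).inter ?_).inter
      ((measurableSet_boundedUpTo hq i).inter (measurableSet_lt measurable_const ?_))
  · exact (by fun_prop : Measurable fun z : (ℕ × (ℕ → 𝒳)) × (ℕ → ℝ) => z.1.2 i) hB
  · exact hq.comp (by fun_prop : Measurable fun z : (ℕ × (ℕ → 𝒳)) × (ℕ → ℝ) => (z.1.2 i, z.2 i))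

omit hq hB

theorem antitone_jumpSet (q : 𝒳 → ℝ → ℝ) (K : ℝ) (B : Set 𝒳) : Antitone (jumpSet q K B) := by
  rintro s t hst z ⟨i, hi, hiB, hb, hlt⟩
  exact ⟨i, hi, hiB, hb, hst.trans_lt hlt⟩

theorem partSum_succ (z : (ℕ × (ℕ → 𝒳)) × (ℕ → ℝ)) (i : ℕ) :
    partSum q z (i + 1) = partSum q z i + q (z.1.2 i) (z.2 i) := Finset.sum_range_succ _ _

theorem lt_cycleMax_of_mem_jumpSet {t : ℝ} {z : (ℕ × (ℕ → 𝒳)) × (ℕ → ℝ)} (hz : z ∈ jumpSet q K B t) :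
    t - K < cycleMax q z := by
  obtain ⟨i, hi, _, hb, hlt⟩ := hz
  refine lt_cycleMax_iff.2 ⟨i + 1, hi, ?_⟩
  rw [partSum_succ]
  have := (abs_le.1 (hb i le_rfl)).1
  linarith

/-- The probability that the position `i` is in `B` and the walk is bounded by `K` up to it. -/
noncomputable def jumpWeight (q : 𝒳 → ℝ → ℝ) (K : ℝ) (B : Set 𝒳) (i : ℕ) (a : ℕ × (ℕ → 𝒳)) : ℝ≥0∞ :=
  B.indicator (fun _ => unifSeq {u | (a, u) ∈ boundedUpTo q K i}) (a.2 i)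

theorem jumpWeight_le_one (q : 𝒳 → ℝ → ℝ) (K : ℝ) (B : Set 𝒳) (i : ℕ) (a : ℕ × (ℕ → 𝒳)) :
    jumpWeight q K B i a ≤ 1 := by
  unfold jumpWeight
  by_cases h : a.2 i ∈ B
  · rw [indicator_of_mem h]; exact prob_le_one
  · rw [indicator_of_notMem h]; exact zero_le

include hq hB in
theorem measurable_jumpWeight (i : ℕ) : Measurable (jumpWeight q K B i) := by
  have h1 : Measurable fun a : ℕ × (ℕ → 𝒳) => unifSeq {u | (a, u) ∈ boundedUpTo q K i} :=
    measurable_measure_prodMk_left (measurableSet_boundedUpTo hq i)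
  have h2 : MeasurableSet {a : ℕ × (ℕ → 𝒳) | a.2 i ∈ B} :=
    (by fun_prop : Measurable fun a : ℕ × (ℕ → 𝒳) => a.2 i) hB
  have : jumpWeight q K B i = {a : ℕ × (ℕ → 𝒳) | a.2 i ∈ B}.indicator
      fun a => unifSeq {u | (a, u) ∈ boundedUpTo q K i} := by
    ext a
    by_cases h : a.2 i ∈ B <;> simp [jumpWeight, h]
  rw [this]
  exact h1.indicator h2

theorem tendsto_jumpWeight (q : 𝒳 → ℝ → ℝ) (B : Set 𝒳) (i : ℕ) (a : ℕ × (ℕ → 𝒳)) :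
    Tendsto (fun K : ℕ => jumpWeight q K B i a) atTop (𝓝 (B.indicator (fun _ => 1) (a.2 i))) := by
  unfold jumpWeight
  by_cases h : a.2 i ∈ B
  swap
  · simp only [indicator_of_notMem h]; exact tendsto_const_nhds
  simp only [indicator_of_mem h]
  have hU : (⋃ K : ℕ, {u : ℕ → ℝ | (a, u) ∈ boundedUpTo q K i}) = univ := by
    refine eq_univ_of_forall fun u => mem_iUnion.2 ?_
    obtain ⟨K, hK⟩ := exists_nat_ge (∑ j ∈ Finset.range (i + 1), |partSum q (a, u) j|)
    exact ⟨K, fun j hj => (Finset.single_le_sum (f := fun j => |partSum q (a, u) j|)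
      (fun _ _ => abs_nonneg _) (Finset.mem_range.2 (by omega))).trans hK⟩
  have hmono : Monotone fun K : ℕ => {u : ℕ → ℝ | (a, u) ∈ boundedUpTo q K i} :=
    fun K K' h u hu j hj => (hu j hj).trans (by exact_mod_cast h)
  have h := tendsto_measure_iUnion_atTop (μ := unifSeq) hmono
  rwa [hU, measure_univ] at h

variable {P : Kernel 𝒳 ℝ} [IsMarkovKernel P] {ρ : Measure (ℕ × (ℕ → 𝒳))} [IsProbabilityMeasure ρ]

include hB in
/-- The probability of a big jump in `B` within a cycle. -/
theorem weightedTail_le_jumpSet {t : ℝ} (ht : 2 * K ≤ t) :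
    weightedTail P ρ (jumpWeight (fun x => quantile (P x)) K B) t ≤
      (ρ.prod unifSeq) (jumpSet (fun x => quantile (P x)) K B t) := by
  have hqP := measurable_quantile_uncurry P
  rw [Measure.prod_apply (measurableSet_jumpSet (q := fun x => quantile (P x)) hqP hB t), weightedTail]
  refine lintegral_mono fun a => ?_
  set q : 𝒳 → ℝ → ℝ := fun x => quantile (P x) with hqdef
  classical
  set A : ℕ → Set (ℕ → ℝ) := fun i => {u | (a, u) ∈ boundedUpTo q K i} ∩
    {u | u i ∈ {v | t < q (a.2 i) v}} with hA
  have hS : ∀ i, MeasurableSet {v | t < q (a.2 i) v} := fun i =>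
    measurableSet_lt measurable_const (measurable_quantile (P (a.2 i)))
  have hbm : ∀ i, MeasurableSet {u : ℕ → ℝ | (a, u) ∈ boundedUpTo q K i} := fun i =>
    measurable_prodMk_left (measurableSet_boundedUpTo (q := q) hqP i)
  have hAm : ∀ i, MeasurableSet (A i) := fun i => (hbm i).inter (measurable_pi_apply i (hS i))
  -- A jump above `t ≥ 2 K` from a height of at least `-K` carries the walk above `K`, so no later
  -- position has a past bounded by `K`.
  have hdisj : Pairwise fun i m => Disjoint (A i) (A m) := by
    have key : ∀ i m, i < m → Disjoint (A i) (A m) := by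
      intro i m him
      rw [Set.disjoint_left]
      rintro u ⟨_, h1⟩ ⟨h2, _⟩
      have h3 : t < q (a.2 i) (u i) := h1
      have h4 := (abs_le.1 (h2 (i + 1) him)).2
      have h5 := (abs_le.1 (h2 i him.le)).1
      rw [partSum_succ] at h4
      simp only at h4
      linarith
    intro i m him
    rcases lt_or_gt_of_ne him with h | h
    · exact key i m h
    · exact (key m i h).symm
  have hmul : ∀ i, unifSeq (A i) = unifSeq {u | (a, u) ∈ boundedUpTo q K i} * P (a.2 i) (Ioi t) := by
    intro i
    rw [hA, unifSeq_inter_eq_mul (hbm i) (S := Iio i) ?_ (by simp) (hS i), hqdef, unif_quantile_Ioi]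
    intro u u' huu hu j hj
    have h : partSum q (a, u') j = partSum q (a, u) j := Finset.sum_congr rfl fun l hl => by
      simp only
      rw [huu l (mem_Iio.2 ((Finset.mem_range.1 hl).trans_le hj))]
    rw [h]
    exact hu j hj
  calc ∑ i ∈ Finset.range a.1, jumpWeight q K B i a * P (a.2 i) (Ioi t)
      = ∑ i ∈ (Finset.range a.1).filter (fun i => a.2 i ∈ B), unifSeq (A i) := by
        rw [Finset.sum_filter]
        refine Finset.sum_congr rfl fun i _ => ?_
        unfold jumpWeight
        by_cases h : a.2 i ∈ B
        · rw [indicator_of_mem h, if_pos h, hmul]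
        · rw [indicator_of_notMem h, if_neg h, zero_mul]
    _ = unifSeq (⋃ i ∈ (Finset.range a.1).filter (fun i => a.2 i ∈ B), A i) :=
        (measure_biUnion_finset (fun i _ m _ him => hdisj him) fun i _ => hAm i).symm
    _ ≤ _ := by
        refine measure_mono (iUnion₂_subset fun i hi u hu => ?_)
        rw [Finset.mem_filter, Finset.mem_range] at hi
        exact ⟨i, hi.1, hi.2, hu.1, hu.2⟩

end JumpSets

/-! ### From a first big jump to a passage in `B` -/

section CoupledLower

variable {Ω 𝒳 : Type*} [MeasurableSpace Ω] [MeasurableSpace 𝒳] {μ : Measure Ω} [IsProbabilityMeasure μ]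
  {X : ℕ → Ω → 𝒳} {T : ℕ → Ω → ℕ} {P : Kernel 𝒳 ℝ}

/-- The event that the walk exceeds `y` and is in a state of `B` when it does so for the first time. -/
def passageEvent (B : Set 𝒳) (y : ℝ) : Set ((ℕ → 𝒳) × (ℕ → ℝ)) :=
  {r | ∃ n, (∀ k ≤ n, ∑ j ∈ Finset.range k, r.2 j ≤ y) ∧ y < ∑ j ∈ Finset.range (n + 1), r.2 j ∧
    r.1 n ∈ B}

/-- Before the jump, the initial cycle adds at most `K₀` and the unfinished cycle at most `K₁`, so
earlier peaks below `y - K₀ - K₁` keep the walk at or below `y`. At the jump, the losses `K + h n`,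
`K₀` and `K₁` together with the lowering of the level by `K₀ + K₁` are compensated by the terms
added to the jump size. So the level is passed exactly there, in a state of `B`. -/
theorem exists_passage_of_firstJump (x₀ : 𝒳) {p : Ω × (ℕ → ℕ → ℝ)}
    (hT : StrictMono fun n => T n p.1) {B : Set 𝒳} {K₀ K₁ K h y : ℝ} {n : ℕ}
    (hK₁ : 0 ≤ K₁) (hy : K₀ + K₁ ≤ y)
    (h0 : cycleMax (fun x => quantile (P x)) (markedCycle X T x₀ 0 p) ≤ K₀)
    (h0' : -K₀ ≤ cycleSum (fun x => quantile (P x)) (markedCycle X T x₀ 0 p))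
    (hj : (fun n => markedCycle X T x₀ (n + 1) p) ∈ firstJump
      (cyclePair (fun x => quantile (P x)) 0) h K (y - K₀ - K₁) n
      (jumpSet (fun x => quantile (P x)) K₁ B (y - K₀ - K₁ + K + h * n + (2 * K₀ + 2 * K₁)))) :
    ∃ N, (∀ k ≤ N, coupledWalk X T P p k ≤ y) ∧ y < coupledWalk X T P p (N + 1) ∧ X N p.1 ∈ B := by
  set q : 𝒳 → ℝ → ℝ := fun x => quantile (P x) with hq
  set ℓ : ℕ → ℕ := fun n => cycleLength T n p.1 with hℓ
  obtain ⟨⟨h1, h2⟩, i, hi, hiB, hb, hlt⟩ := hj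
  simp only [cyclePair, zero_mul, sub_zero] at h1 h2
  have hi' : i < ℓ (n + 1) := hi
  have h0sum := cycleSum_le_cycleMax (q := q) (markedCycle X T x₀ 0 p)
  have hsum : ∀ m, ∑ l ∈ Finset.range (m + 1), cycleSum q (markedCycle X T x₀ l p) =
      cycleSum q (markedCycle X T x₀ 0 p) + ∑ l ∈ Finset.range m, cycleSum q (markedCycle X T x₀ (l + 1) p) := by
    intro m; rw [Finset.sum_range_succ', add_comm]
  refine ⟨blockStart ℓ (n + 1) + i, fun k hk => ?_, ?_, ?_⟩
  · have hoff := blockOffset_lt (one_le_cycleLength hT) k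
    have hk2 := blockStart_add_blockOffset ℓ k
    have hle := partSum_le_cycleMax (q := q)
      (markedCycle X T x₀ (blockIndex ℓ k) p) (j := blockOffset ℓ k) hoff.le
    have hidx : blockIndex ℓ k ≤ n + 1 := by
      by_contra hgt
      have h3 := blockStart_mono ℓ (by omega : n + 1 + 1 ≤ blockIndex ℓ k)
      rw [blockStart_succ] at h3
      omega
    rw [← hk2, coupledWalk_blockStart_add x₀ hT _ hoff.le]
    rcases hb' : blockIndex ℓ k with _ | m
    · rw [hb'] at hle
      simp only [Finset.range_zero, Finset.sum_empty, zero_add]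
      exact (hle.trans h0).trans (by linarith)
    · rw [hb'] at hle hidx hk2
      rw [hsum]
      rcases Nat.lt_or_ge m n with hmn | hmn
      · have h3 := h2 m hmn
        simp only [peak] at h3
        linarith
      · obtain rfl : m = n := by omega
        have h4 := (abs_le.1 (hb (blockOffset ℓ k) (by omega))).2
        rcases m with _ | m
        · simp only [Finset.range_zero, Finset.sum_empty, add_zero]
          linarith
        · have h3 := h2 m (by omega)
          simp only [peak] at h3
          have h5 := cycleSum_le_cycleMax (q := q) (markedCycle X T x₀ (m + 1) p)
          rw [Finset.sum_range_succ]
          linarith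
  · rw [add_assoc, coupledWalk_blockStart_add x₀ hT _ (by exact hi'), hsum, partSum_succ]
    have h4 := (abs_le.1 (hb i le_rfl)).1
    linarith
  · have h3 : (markedCycle X T x₀ (n + 1) p).1.2 i = X (blockStart ℓ (n + 1) + i) p.1 := by
      rw [← cycleStart_eq_blockStart hT]
      exact cycleWord_snd X T x₀ hi'
    rwa [h3] at hiB

/-- At `ε = 0` the expression is `Γ / α`. The factors `1 - ε` account for the initial cycle, the
past of the jump and a shift of the tail; `2 ε` pays for truncating the weights and for their tail
asymptotics; `α + ε` is the slope of the line. -/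
theorem exists_lower_ratio {α Γ c' : ℝ} (hα : 0 < α) (h : c' < Γ / α) :
    ∃ ε, 0 < ε ∧ ε < 1 ∧ c' ≤ (1 - ε) * ((1 - ε) * ((α + ε)⁻¹ * ((Γ - 2 * ε) * (1 - ε)))) := by
  have h1 : ContinuousAt
      (fun ε : ℝ => (1 - ε) * ((1 - ε) * ((α + ε)⁻¹ * ((Γ - 2 * ε) * (1 - ε))))) 0 :=
    ContinuousAt.mul (by fun_prop) (ContinuousAt.mul (by fun_prop)
      ((ContinuousAt.inv₀ (by fun_prop) (by simpa using hα.ne')).mul (by fun_prop)))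
  have h2 : c' < (1 - 0) * ((1 - 0) * ((α + 0)⁻¹ * ((Γ - 2 * 0) * (1 - 0)))) := by
    rw [sub_zero, add_zero, mul_zero, sub_zero, mul_one, one_mul, one_mul, ← div_eq_inv_mul]; exact h
  have h3 := (h1.eventually (lt_mem_nhds h2)).filter_mono (nhdsWithin_le_nhds (s := Ioi 0))
  have h4 : ∀ᶠ ε in 𝓝[>] (0 : ℝ), ε < 1 := (eventually_lt_nhds one_pos).filter_mono nhdsWithin_le_nhds
  obtain ⟨ε, hε1, hε2, hε3⟩ := (h3.and (h4.and self_mem_nhdsWithin)).exists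
  exact ⟨ε, hε3, hε2, hε1.le⟩

end CoupledLower

end ModulatedWalk

namespace ModulatedWalk

section CoupledLowerBound

variable {Ω 𝒳 : Type*} [MeasurableSpace Ω] [MeasurableSpace 𝒳] {μ : Measure Ω} [IsProbabilityMeasure μ]
  {X : ℕ → Ω → 𝒳} {T : ℕ → Ω → ℕ} {F H : Measure ℝ} [IsProbabilityMeasure F] [IsProbabilityMeasure H]
  {P : Kernel 𝒳 ℝ} [IsMarkovKernel P] {c : 𝒳 → ℝ} {L : ℝ}

theorem exists_initialBound {ρ : Measure (ℕ × (ℕ → 𝒳))} [IsProbabilityMeasure ρ] {q : 𝒳 → ℝ → ℝ}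
    (hq : Measurable fun p : 𝒳 × ℝ => q p.1 p.2) {ε : ℝ} (hε : 0 < ε) :
    ∃ K : ℕ, 1 - ε ≤ (ρ.prod unifSeq).real {z | cycleMax q z ≤ K ∧ -(K : ℝ) ≤ cycleSum q z} := by
  have hm : ∀ K : ℕ, MeasurableSet {z | cycleMax q z ≤ K ∧ -(K : ℝ) ≤ cycleSum q z} := fun K =>
    (measurableSet_le (measurable_cycleMax hq) measurable_const).inter
      (measurableSet_le measurable_const (measurable_cycleSum hq))
  have h := tendsto_measure_compl_of_ae_exists (μ := ρ.prod unifSeq) hm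
    (fun K K' hK z hz => by
      have hK' : (K : ℝ) ≤ K' := by exact_mod_cast hK
      exact ⟨hz.1.trans hK', by linarith [hz.2]⟩)
    (ae_of_all _ fun z => by
      obtain ⟨K, hK⟩ := exists_nat_ge (max (cycleMax q z) (-cycleSum q z))
      exact ⟨K, (le_max_left _ _).trans hK, by linarith [(le_max_right _ _).trans hK]⟩)
  obtain ⟨K, hK⟩ := (h.eventually (gt_mem_nhds hε)).exists
  rw [probReal_compl_eq_one_sub (hm K)] at hK
  exact ⟨K, by linarith⟩

/-- The asymptotic lower bound for the first passage of the coupled walk in a state of `B`. -/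
theorem eventually_le_coupledWalk (hX : IsRegenerative μ X T) (x₀ : 𝒳) (hFH : IsSecondTail F H)
    (hP : ∀ x, Integrable (fun t : ℝ => t) (P x))
    (hc : ∀ x, Tendsto (fun y => tail (P x) y / tail F y) atTop (𝓝 (c x))) (hcm : Measurable c)
    (hL : ∀ x, ∀ y, 0 ≤ y → tail (P x) y ≤ L * tail F y)
    (hρ : ∫⁻ a, (a.1 : ℝ≥0∞) ∂(μ.map (cycleWord X T x₀ 1)) < ∞)
    (hint : ∫⁻ x, ∫⁻ u, ‖quantile (P x) u‖ₑ ∂unif ∂(intensity (μ.map (cycleWord X T x₀ 1))) < ∞)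
    {α : ℝ} (hα : 0 < α)
    (hdrift : ∫ x, ∫ u, quantile (P x) u ∂unif ∂(intensity (μ.map (cycleWord X T x₀ 1))) = -α)
    {B : Set 𝒳} (hB : MeasurableSet B) {c' : ℝ}
    (hc' : c' < (weightedLimit c (μ.map (cycleWord X T x₀ 1))
      fun i a => B.indicator (fun _ => 1) (a.2 i)).toReal / α) :
    ∀ᶠ y in atTop, c' * tail H y ≤ (μ.prod unifArray).real
      {p | ∃ n, (∀ k ≤ n, coupledWalk X T P p k ≤ y) ∧ y < coupledWalk X T P p (n + 1) ∧ X n p.1 ∈ B} := by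
  rcases le_or_gt c' 0 with hneg | hc'0
  · exact Eventually.of_forall fun y =>
      (mul_nonpos_of_nonpos_of_nonneg hneg (tail_nonneg _ _)).trans measureReal_nonneg
  set ρ := μ.map (cycleWord X T x₀ 1) with hρdef
  have : IsProbabilityMeasure ρ := hX.isProbabilityMeasure_map x₀ 1
  have : IsProbabilityMeasure (μ.map (cycleWord X T x₀ 0)) := hX.isProbabilityMeasure_map x₀ 0
  set q : 𝒳 → ℝ → ℝ := fun x => quantile (P x) with hqdef
  have hq : Measurable fun p : 𝒳 × ℝ => q p.1 p.2 := measurable_quantile_uncurry P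
  set Γ := (weightedLimit c ρ fun i a => B.indicator (fun _ => 1) (a.2 i)).toReal with hΓ
  obtain ⟨ε, hε, hε1, hεc⟩ := exists_lower_ratio hα hc'
  have hΓε : 0 < Γ - 2 * ε := by
    by_contra hle
    have h1 : (1 - ε) * ((1 - ε) * ((α + ε)⁻¹ * ((Γ - 2 * ε) * (1 - ε)))) ≤ 0 :=
      mul_nonpos_of_nonneg_of_nonpos (by linarith) (mul_nonpos_of_nonneg_of_nonpos (by linarith)
        (mul_nonpos_of_nonneg_of_nonpos (by positivity)
          (mul_nonpos_of_nonpos_of_nonneg (not_lt.1 hle) (by linarith))))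
    linarith
  -- `K₀` tames the initial cycle, `K₁` the part of a cycle before its jump, `K` the fluctuations of
  -- the earlier cycles. None depends on `y`, so long-tailedness absorbs the total shift.
  obtain ⟨K₀, hK₀⟩ := exists_initialBound (ρ := μ.map (cycleWord X T x₀ 0)) hq hε
  have hlim := tendsto_weightedLimit (ρ := ρ) hFH hc hL hcm hρ
    (h := fun K i => jumpWeight q K B i) (w := fun i a => B.indicator (fun _ => 1) (a.2 i))
    (fun K i => measurable_jumpWeight hq hB i) (fun K i a => jumpWeight_le_one _ _ _ _ _)
    (fun i a => tendsto_jumpWeight q B i a)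
  have hfin := weightedLimit_lt_top (ρ := ρ) (w := fun i a => B.indicator (fun _ => 1) (a.2 i)) hFH hc hL hρ
    (fun i a => indicator_le_self' (fun _ _ => zero_le) (a.2 i))
  obtain ⟨K₁, hK₁⟩ := (((ENNReal.tendsto_toReal hfin.ne).comp hlim).eventually
    (lt_mem_nhds (by linarith : Γ - ε < Γ))).exists
  simp only [Function.comp] at hK₁
  have hW := eventually_le_setLIntegral_weightedTail (w := jumpWeight q K₁ B) hFH hc hL hρ
    (fun i => measurable_jumpWeight hq hB i) (fun i a => jumpWeight_le_one _ _ _ _ _) hε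
  have hfst := (integrable_cycleSum (ρ := ρ) hq hint)
  have hmean : ∫ z, (cyclePair q 0 z).1 ∂(ρ.prod unifSeq) = -α := by
    simp only [cyclePair, zero_mul, sub_zero]
    rw [integral_cycleSum hq (fun x => integrable_quantile (hP x)) hint, hdrift]
  obtain ⟨K, hK, y₀, hy₀⟩ := exists_le_iUnion_firstJump (ρ := ρ.prod unifSeq) (f := cyclePair q 0)
    (measurable_cyclePair hq 0) (by simpa [cyclePair] using hfst)
    (integrable_cycleMax hq hint) (by rw [hmean]; linarith) (h := α + ε) (by rw [hmean]; linarith) hε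
  have hK₀0 : (0 : ℝ) ≤ K₀ := Nat.cast_nonneg _
  have hK₁0 : (0 : ℝ) ≤ K₁ := Nat.cast_nonneg _
  have hshift : Tendsto (fun y : ℝ => y + (K + K₀ + K₁)) atTop atTop :=
    tendsto_atTop_add_const_right atTop _ tendsto_id
  filter_upwards [eventually_ge_atTop (y₀ + K₀ + K₁), eventually_ge_atTop (K₀ + K₁ : ℝ),
    hshift.eventually hW, hFH.heavy.eventually_le_shift (K + K₀ + K₁) (by linarith : 1 - ε < 1)]
    with y h1 h2 h3 h4
  set A : ℝ → Set ((ℕ × (ℕ → 𝒳)) × (ℕ → ℝ)) := fun t => jumpSet q K₁ B (t + (2 * K₀ + 2 * K₁)) with hA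
  set U := ⋃ n : ℕ, firstJump (cyclePair q 0) (α + ε) K (y - K₀ - K₁) n
    (A (y - K₀ - K₁ + K + (α + ε) * n)) with hU
  have hAm : ∀ t, MeasurableSet (A t) := fun t => measurableSet_jumpSet hq hB _
  have hUm : MeasurableSet U := MeasurableSet.iUnion fun n =>
    measurableSet_firstJump (measurable_cyclePair hq 0) _ _ _ _ (hAm _)
  have h5 := hy₀ (y - K₀ - K₁) (by linarith) A
    (fun s t hst => antitone_jumpSet q K₁ B (by linarith)) hAm (fun t z hz => by
      have h6 := lt_cycleMax_of_mem_jumpSet hz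
      simp only [cyclePair]
      linarith)
  have h6 : ENNReal.ofReal ((Γ - 2 * ε) * ((1 - ε) * tail H y)) ≤
      ∫⁻ t in Ioi (y - K₀ - K₁ + K), (ρ.prod unifSeq) (A t) := by
    calc _ ≤ ∫⁻ t in Ioi (y + (K + K₀ + K₁)), weightedTail P ρ (jumpWeight q K₁ B) t := by
          refine le_trans (ENNReal.ofReal_le_ofReal ?_) h3
          have := tail_nonneg H (y + (K + K₀ + K₁))
          exact (mul_le_mul_of_nonneg_left h4 hΓε.le).trans
            (mul_le_mul_of_nonneg_right (by linarith) this)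
      _ = ∫⁻ t in Ioi (y - K₀ - K₁ + K + (2 * K₀ + 2 * K₁)), weightedTail P ρ (jumpWeight q K₁ B) t := by
          congr 3; ring
      _ ≤ _ := by
          rw [setLIntegral_Ioi_add]
          refine setLIntegral_mono' measurableSet_Ioi fun t ht => ?_
          have ht' : y - K₀ - K₁ + K < t := ht
          exact weightedTail_le_jumpSet hB (by linarith)
  have h7 := (mul_le_mul_right h6 _).trans h5
  have h8 := ENNReal.toReal_mono (ENNReal.mul_ne_top ENNReal.ofReal_ne_top (measure_ne_top _ _)) h7
  have hposy := tail_nonneg H y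
  have hnn : 0 ≤ (Γ - 2 * ε) * ((1 - ε) * tail H y) :=
    mul_nonneg hΓε.le (mul_nonneg (by linarith) hposy)
  rw [ENNReal.toReal_mul, ENNReal.toReal_mul, ENNReal.toReal_ofReal (by linarith),
    ENNReal.toReal_ofReal hnn, ENNReal.toReal_ofReal (by linarith)] at h8
  set G₀ := {z : (ℕ × (ℕ → 𝒳)) × (ℕ → ℝ) | cycleMax q z ≤ K₀ ∧ -(K₀ : ℝ) ≤ cycleSum q z} with hG₀
  have hG₀m : MeasurableSet G₀ :=
    (measurableSet_le (measurable_cycleMax hq) measurable_const).inter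
      (measurableSet_le measurable_const (measurable_cycleSum hq))
  have h9 : ((μ.map (cycleWord X T x₀ 0)).prod unifSeq) G₀ *
      (Measure.infinitePi fun _ : ℕ => ρ.prod unifSeq) U ≤ (μ.prod unifArray)
      {p | ∃ n, (∀ k ≤ n, coupledWalk X T P p k ≤ y) ∧ y < coupledWalk X T P p (n + 1) ∧ X n p.1 ∈ B} := by
    have h10 := hX.measure_markedCycle x₀ (hG₀m.prod hUm)
    have h11 : ∫⁻ z, (Measure.infinitePi fun _ : ℕ => ρ.prod unifSeq) {v | (z, v) ∈ G₀ ×ˢ U}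
        ∂((μ.map (cycleWord X T x₀ 0)).prod unifSeq) = ((μ.map (cycleWord X T x₀ 0)).prod unifSeq) G₀ *
      (Measure.infinitePi fun _ : ℕ => ρ.prod unifSeq) U := by
      rw [← Measure.prod_prod, Measure.prod_apply (hG₀m.prod hUm)]
      rfl
    rw [← h11, ← h10]
    refine measure_mono_ae ?_
    have ha : ∀ᵐ p ∂(μ.prod unifArray), StrictMono fun n => T n p.1 :=
      Measure.quasiMeasurePreserving_fst.ae hX.strictMono
    filter_upwards [ha] with p hp hpG
    obtain ⟨hp0, hpU⟩ := hpG
    obtain ⟨n, hn⟩ := mem_iUnion.1 hpU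
    exact exists_passage_of_firstJump x₀ hp hK₁0 h2 hp0.1 hp0.2 hn
  have h12 := ENNReal.toReal_mono (measure_ne_top _ _) h9
  rw [ENNReal.toReal_mul, ← measureReal_def, ← measureReal_def, ← measureReal_def] at h12
  refine le_trans ?_ h12
  rw [← measureReal_def] at h8
  set u := (Measure.infinitePi fun _ : ℕ => ρ.prod unifSeq).real U
  have h13 : (1 - ε) * ((α + ε)⁻¹ * ((Γ - 2 * ε) * (1 - ε))) * tail H y ≤ u := by
    rw [← mul_le_mul_iff_right₀ (by linarith : 0 < α + ε)]
    refine le_trans (le_of_eq ?_) h8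
    have : α + ε ≠ 0 := by positivity
    field_simp
  calc c' * tail H y ≤ (1 - ε) * ((1 - ε) * ((α + ε)⁻¹ * ((Γ - 2 * ε) * (1 - ε)))) * tail H y := by gcongr
    _ = (1 - ε) * ((1 - ε) * ((α + ε)⁻¹ * ((Γ - 2 * ε) * (1 - ε))) * tail H y) := by ring
    _ ≤ (1 - ε) * u := mul_le_mul_of_nonneg_left h13 (by linarith)
    _ ≤ _ := mul_le_mul_of_nonneg_right hK₀ measureReal_nonneg

end CoupledLowerBound

end ModulatedWalk

namespace ModulatedWalk

/-! ### Preparing the hypotheses -/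

section Hypotheses

theorem tail_differenceLaw_le {ν β : Measure ℝ} [IsProbabilityMeasure ν] [IsProbabilityMeasure β]
    (hβ : β (Iio 0) = 0) (y : ℝ) : tail (differenceLaw ν β) y ≤ tail ν y := by
  unfold tail differenceLaw
  rw [map_measureReal_apply (by fun_prop) measurableSet_Ioi]
  have h : (ν.prod β).real (Prod.fst ⁻¹' Ioi y) = ν.real (Ioi y) := by
    rw [← map_measureReal_apply measurable_fst measurableSet_Ioi]
    congr 1
    simp
  rw [← h, measureReal_def, measureReal_def]
  refine ENNReal.toReal_mono (measure_ne_top _ _) (measure_mono_ae ?_)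
  have hae : ∀ᵐ p ∂(ν.prod β), 0 ≤ p.2 := by
    refine Measure.quasiMeasurePreserving_snd.ae (p := fun t : ℝ => 0 ≤ t) ?_
    rw [ae_iff]
    simpa [not_le, Iio_def] using hβ
  filter_upwards [hae] with p hp hpy
  have h1 : y < p.1 - p.2 := hpy
  change y < p.1
  linarith

variable {F ν : Measure ℝ} [IsProbabilityMeasure F] [IsProbabilityMeasure ν]

theorem exists_integratedTail_le (hν : tail ν =O[atTop] tail F) :
    ∃ C, 0 ≤ C ∧ ∀ᶠ y in atTop, integratedTail ν y ≤ ENNReal.ofReal C * integratedTail F y := by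
  obtain ⟨C, hC0, hC⟩ := hν.exists_nonneg
  obtain ⟨y₀, hy₀⟩ := eventually_atTop.1 hC.bound
  refine ⟨C, hC0, ?_⟩
  filter_upwards [eventually_ge_atTop y₀] with y hy
  unfold integratedTail
  rw [← lintegral_const_mul _ (measurable_measure_Ioi F)]
  refine setLIntegral_mono' measurableSet_Ioi fun t ht => ?_
  have h1 := hy₀ t (hy.trans (le_of_lt ht))
  rw [Real.norm_of_nonneg (tail_nonneg _ _), Real.norm_of_nonneg (tail_nonneg _ _)] at h1
  have h2 := ENNReal.ofReal_le_ofReal h1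
  rwa [ENNReal.ofReal_mul hC0, ofReal_tail, ofReal_tail] at h2

/-- A law with a tail dominated by that of `F`, which dominates a law with finite mean, has a finite
mean. -/
theorem integrable_of_isBigO_tail (hF : Integrable (fun t : ℝ => t) F) (hν : tail ν =O[atTop] tail F)
    {Q : Measure ℝ} [IsProbabilityMeasure Q] (hQ : Integrable (fun t : ℝ => t) Q)
    (hQν : ∀ y, tail Q y ≤ tail ν y) : Integrable (fun t : ℝ => t) ν := by
  obtain ⟨C, _, hC⟩ := exists_integratedTail_le hν
  obtain ⟨y₀, hy₀, hy₀0⟩ := (hC.and (eventually_ge_atTop 0)).exists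
  have h0 : integratedTail ν 0 < ∞ := by
    rw [integratedTail_add ν hy₀0]
    refine ENNReal.add_lt_top.2 ⟨?_, hy₀.trans_lt
      (ENNReal.mul_lt_top ENNReal.ofReal_lt_top (integratedTail_lt_top F hF y₀))⟩
    calc ∫⁻ t in Ioc 0 y₀, ν (Ioi t) ≤ ∫⁻ _ in Ioc 0 y₀, 1 := lintegral_mono fun t => prob_le_one
      _ < ∞ := by rw [setLIntegral_one, Real.volume_Ioc]; exact ENNReal.ofReal_lt_top
  rw [← lintegral_ofReal_sub_eq] at h0
  simp only [sub_zero] at h0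
  have hqν := measurable_quantile ν
  have hpos : Integrable (fun u => max (quantile ν u) 0) unif := by
    refine ⟨by fun_prop, ?_⟩
    rw [hasFiniteIntegral_iff_ofReal (f := fun u => max (quantile ν u) 0)
      (ae_of_all _ fun u => le_max_right _ _)]
    rw [← unif_map_quantile ν, lintegral_map (by fun_prop) hqν] at h0
    refine lt_of_le_of_lt (lintegral_mono fun u => ?_) h0
    rcases le_total 0 (quantile ν u) with h | h
    · rw [max_eq_left h]
    · rw [max_eq_right h, ENNReal.ofReal_zero]; exact zero_le
  rw [← unif_map_quantile ν, integrable_map_measure (by fun_prop) hqν.aemeasurable]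
  -- A negative quantile of `ν` lies between the corresponding quantile of `Q` and `0`, so the
  -- integrable law `Q` controls the negative part.
  refine ((integrable_quantile hQ).abs.add hpos).mono' (by fun_prop) (ae_of_all _ fun u => ?_)
  have h1 := quantile_mono hQν u
  simp only [Function.comp, Real.norm_eq_abs, Pi.add_apply]
  rcases le_total 0 (quantile ν u) with h | h
  · rw [abs_of_nonneg h, max_eq_left h]
    linarith [abs_nonneg (quantile Q u)]
  · rw [abs_of_nonpos h, max_eq_right h]
    linarith [neg_abs_le (quantile Q u)]

end Hypotheses

section Regenerative

variable {Ω 𝒳 : Type*} [MeasurableSpace Ω] [MeasurableSpace 𝒳] {μ : Measure Ω} [IsProbabilityMeasure μ]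
  {X : ℕ → Ω → 𝒳} {T : ℕ → Ω → ℕ}

theorem IsRegenerative.lintegral_length (hX : IsRegenerative μ X T) (x₀ : 𝒳) :
    ∫⁻ a, (a.1 : ℝ≥0∞) ∂(μ.map (cycleWord X T x₀ 1)) = ∫⁻ ω, (cycleLength T 1 ω : ℝ≥0∞) ∂μ := by
  rw [lintegral_map (by fun_prop) (hX.measurable_cycleWord x₀ 1)]
  rfl

theorem lintegral_cycleLength_lt_top (hτ : Integrable (fun ω => (cycleLength T 1 ω : ℝ)) μ) :
    ∫⁻ ω, (cycleLength T 1 ω : ℝ≥0∞) ∂μ < ∞ := by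
  have h := (hasFiniteIntegral_iff_ofReal (ae_of_all _ fun ω => Nat.cast_nonneg _)).1 hτ.2
  simpa using h

theorem IsRegenerative.one_le_lintegral_length (hX : IsRegenerative μ X T) :
    1 ≤ ∫⁻ ω, (cycleLength T 1 ω : ℝ≥0∞) ∂μ := by
  calc (1 : ℝ≥0∞) = ∫⁻ _, 1 ∂μ := by simp
    _ ≤ _ := by
        refine lintegral_mono_ae ?_
        filter_upwards [hX.strictMono] with ω hω
        exact_mod_cast one_le_cycleLength hω 1 le_rfl

theorem intensity_eq_smul_cycleLaw (hX : IsRegenerative μ X T)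
    (hτ : Integrable (fun ω => (cycleLength T 1 ω : ℝ)) μ) (x₀ : 𝒳) :
    intensity (μ.map (cycleWord X T x₀ 1)) =
      (∫⁻ ω, (cycleLength T 1 ω : ℝ≥0∞) ∂μ) • cycleLaw μ X T := by
  rw [cycleLaw_eq hX x₀, smul_smul, ENNReal.mul_inv_cancel, one_smul]
  · exact (zero_lt_one.trans_le hX.one_le_lintegral_length).ne'
  · exact (lintegral_cycleLength_lt_top hτ).ne

theorem lintegral_enorm_quantile (P : Kernel 𝒳 ℝ) [IsMarkovKernel P] (x : 𝒳) :
    ∫⁻ u, ‖quantile (P x) u‖ₑ ∂unif = ∫⁻ t, ‖t‖ₑ ∂(P x) := by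
  conv_rhs => rw [← unif_map_quantile (P x)]
  rw [lintegral_map (by fun_prop) (measurable_quantile (P x))]

theorem weightedLimit_indicator {ρ : Measure (ℕ × (ℕ → 𝒳))} {c : 𝒳 → ℝ} (hcm : Measurable c) {B : Set 𝒳}
    (hB : MeasurableSet B) :
    (weightedLimit c ρ fun i a => B.indicator (fun _ => 1) (a.2 i)) =
      ∫⁻ x in B, ENNReal.ofReal (c x) ∂(intensity ρ) := by
  rw [← lintegral_indicator hB, lintegral_intensity (hcm.ennreal_ofReal.indicator hB), weightedLimit]
  refine lintegral_congr fun a => Finset.sum_congr rfl fun i _ => ?_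
  by_cases h : a.2 i ∈ B <;> simp [h]

end Regenerative

/-! ### First passage as an event on paths -/

section Passage

variable {Ω 𝒳 : Type*} [MeasurableSpace Ω] [MeasurableSpace 𝒳]

theorem measurableSet_passageEvent {B : Set 𝒳} (hB : MeasurableSet B) (y : ℝ) :
    MeasurableSet (passageEvent B y) := by
  have hs : ∀ k, Measurable fun r : (ℕ → 𝒳) × (ℕ → ℝ) => ∑ j ∈ Finset.range k, r.2 j := fun k => by
    fun_prop
  have : passageEvent B y = ⋃ n : ℕ, (⋂ k ∈ Finset.range (n + 1),
      {r | ∑ j ∈ Finset.range k, r.2 j ≤ y}) ∩ ({r | y < ∑ j ∈ Finset.range (n + 1), r.2 j} ∩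
        {r | r.1 n ∈ B}) := by
    ext r; simp [passageEvent]
  rw [this]
  refine MeasurableSet.iUnion fun n => (Finset.measurableSet_biInter _ fun k _ =>
    measurableSet_le (hs k) measurable_const).inter ((measurableSet_lt measurable_const (hs _)).inter ?_)
  exact (by fun_prop : Measurable fun r : (ℕ → 𝒳) × (ℕ → ℝ) => r.1 n) hB

theorem mem_passageEvent_univ {y : ℝ} (hy : 0 ≤ y) (r : (ℕ → 𝒳) × (ℕ → ℝ)) :
    r ∈ passageEvent univ y ↔ ∃ m, y < ∑ j ∈ Finset.range m, r.2 j := by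
  constructor
  · rintro ⟨n, _, h, _⟩
    exact ⟨n + 1, h⟩
  · intro h
    classical
    have h1 := Nat.find_spec h
    have h2 : Nat.find h ≠ 0 := by
      intro h0
      rw [h0, Finset.range_zero, Finset.sum_empty] at h1
      linarith
    obtain ⟨n, hn⟩ := Nat.exists_eq_succ_of_ne_zero h2
    refine ⟨n, fun k hk => not_lt.1 (Nat.find_min h (by omega)), ?_, mem_univ _⟩
    rw [hn] at h1
    exact h1

theorem passageEvent_union (B : Set 𝒳) (y : ℝ) :
    passageEvent B y ∪ passageEvent Bᶜ y = passageEvent univ y := by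
  ext r
  constructor
  · rintro (⟨n, h1, h2, _⟩ | ⟨n, h1, h2, _⟩) <;> exact ⟨n, h1, h2, mem_univ _⟩
  · rintro ⟨n, h1, h2, _⟩
    by_cases h : r.1 n ∈ B
    · exact Or.inl ⟨n, h1, h2, h⟩
    · exact Or.inr ⟨n, h1, h2, h⟩

theorem disjoint_passageEvent (B : Set 𝒳) (y : ℝ) : Disjoint (passageEvent B y) (passageEvent Bᶜ y) := by
  rw [Set.disjoint_left]
  rintro r ⟨n, h1, h2, h3⟩ ⟨m, h4, h5, h6⟩
  rcases lt_trichotomy n m with h | h | h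
  · exact absurd h2 (not_lt.2 (h4 (n + 1) h))
  · subst h; exact h6 h3
  · exact absurd h5 (not_lt.2 (h1 (m + 1) h))

/-- For `y ≥ 0` the value `S_0 = 0` is not above `y`, so a first passage takes at least one step. It
happens at time `n + 1` when the increment with index `n` is added in the state with index `n`,
whence the `- 1` in `passageState`. The default value of `passageTime` plays no role, since both
sides force a passage. -/
theorem walkSup_passageState_iff {X : ℕ → Ω → 𝒳} {ξ : ℕ → 𝒳 → Ω → ℝ} {y : ℝ} (hy : 0 ≤ y) (B : Set 𝒳)
    (ω : Ω) : ((y : EReal) < walkSup X ξ ω ∧ passageState X ξ y ω ∈ B) ↔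
      ((fun n => X n ω), fun n => ξ n (X n ω) ω) ∈ passageEvent B y := by
  have hsup : (y : EReal) < walkSup X ξ ω ↔ ∃ n, y < walk X ξ n ω := by
    unfold walkSup
    simp only [lt_iSup_iff, EReal.coe_lt_coe_iff]
  have h0 : walk X ξ 0 ω = 0 := by simp [walk]
  rw [hsup]
  constructor
  · rintro ⟨⟨m, hm⟩, hB⟩
    have hm1 : 1 ≤ m := by
      rcases Nat.eq_zero_or_pos m with h | h
      · rw [h, h0] at hm; linarith
      · exact h
    have hne : {n : ℕ | 1 ≤ n ∧ y < walk X ξ n ω}.Nonempty := ⟨m, hm1, hm⟩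
    obtain ⟨h1, h2⟩ := Nat.sInf_mem hne
    have hp : sInf {n : ℕ | 1 ≤ n ∧ y < walk X ξ n ω} = passageTime X ξ y ω := rfl
    rw [hp] at h1 h2
    refine ⟨passageTime X ξ y ω - 1, fun k hk => ?_, ?_, hB⟩
    · rcases Nat.eq_zero_or_pos k with h | h
      · rw [h, Finset.range_zero, Finset.sum_empty]; exact hy
      · have h3 : k ∉ {n : ℕ | 1 ≤ n ∧ y < walk X ξ n ω} := Nat.notMem_of_lt_sInf (by rw [hp]; omega)
        by_contra hlt
        exact h3 ⟨h, not_le.1 hlt⟩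
    · rw [Nat.sub_add_cancel h1]; exact h2
  · rintro ⟨n, h1, h2, h3⟩
    refine ⟨⟨n + 1, h2⟩, ?_⟩
    have hp : passageTime X ξ y ω = n + 1 := by
      refine le_antisymm (Nat.sInf_le ⟨Nat.le_add_left 1 n, h2⟩) ?_
      refine le_csInf ⟨n + 1, Nat.le_add_left 1 n, h2⟩ ?_
      rintro k ⟨_, hk⟩
      by_contra hlt
      exact absurd hk (not_lt.2 (h1 k (by omega)))
    unfold passageState
    rw [hp]
    exact h3

variable {μ : Measure Ω} [IsProbabilityMeasure μ] {X : ℕ → Ω → 𝒳} {T : ℕ → Ω → ℕ} {P : Kernel 𝒳 ℝ}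
  [IsMarkovKernel P] {ξ : ℕ → 𝒳 → Ω → ℝ}

/-- The modulated walk and the coupled walk have the same law. -/
theorem measure_passage_eq (hX : IsRegenerative μ X T) (hξ : IsModulatedFamily μ X P ξ)
    {E : Set ((ℕ → 𝒳) × (ℕ → ℝ))} (hE : MeasurableSet E) :
    μ {ω | ((fun n => X n ω), fun n => ξ n (X n ω) ω) ∈ E} = (μ.prod unifArray)
      {p | ((fun n => X n p.1), fun j => quantile (P (X j p.1))
        (concat (fun n => cycleLength T n p.1) p.2 j)) ∈ E} := by
  rw [measure_modulated_eq_lintegral hX.measurable_process hξ hE]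
  exact (measure_quantile_eq_lintegral hX.measurable_process P
    (measurable_pi_iff.2 fun n => hX.measurable_cycleLength n) hE).symm

end Passage

end ModulatedWalk

/-! ### The asymptotics of the maximum and of the passage state -/

theorem theorem4 {Ω 𝒳 : Type*} [MeasurableSpace Ω] [MeasurableSpace 𝒳]
    (μ : Measure Ω) [IsProbabilityMeasure μ]
    -- the modulating process, regenerative with integrable cycles, and its law `π`
    (X : ℕ → Ω → 𝒳) (T : ℕ → Ω → ℕ) (hX : IsRegenerative μ X T)
    (hτ : Integrable (fun ω => (cycleLength T 1 ω : ℝ)) μ)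
    (π : Measure 𝒳) (hπ : π = cycleLaw μ X T)
    -- the increments, with laws `F_x = P x` of finite mean
    (P : Kernel 𝒳 ℝ) [IsMarkovKernel P] (ξ : ℕ → 𝒳 → Ω → ℝ)
    (hξ : IsModulatedFamily μ X P ξ)
    (hP : ∀ x, Integrable (fun t : ℝ => t) (P x))
    -- the reference law `F` on `[0, ∞)` of finite mean, and tail comparison
    (F : Measure ℝ) [IsProbabilityMeasure F] (hF_nonneg : F (Iio 0) = 0)
    (hF_mean : Integrable (fun t : ℝ => t) F)
    (c : 𝒳 → ℝ) (hc_meas : Measurable c) (hc_nonneg : ∀ x, 0 ≤ c x)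
    (hc : ∀ x, Tendsto (fun y => tail (P x) y / tail F y) atTop (𝓝 (c x)))
    (L : ℝ) (hL : ∀ x, ∀ y, 0 ≤ y → tail (P x) y ≤ L * tail F y)
    (hFs : Subexponential (secondTailLaw F))
    -- integrable increments and negative drift under `π`
    (hdrift_abs : ∫⁻ x, ∫⁻ t, ‖t‖ₑ ∂(P x) ∂π < ∞)
    (a : ℝ) (ha : 0 < a) (hdrift : ∫ x, ∫ t, t ∂(P x) ∂π = -a)
    -- domination by the laws `G_x` of `ζ - b^x`; `ν` is the law of `ζ`, `β x` that of `b^x`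
    (ν : Measure ℝ) [IsProbabilityMeasure ν]
    (β : 𝒳 → Measure ℝ) [∀ x, IsProbabilityMeasure (β x)] (hβ : ∀ x, β x (Iio 0) = 0)
    (G : 𝒳 → Measure ℝ) (hG : ∀ x, G x = differenceLaw ν (β x))
    (hG_meas : ∀ y : ℝ, Measurable fun x => G x (Iic y))
    (hFG : ∀ x y, tail (P x) y ≤ tail (G x) y)
    (hν : tail ν =O[atTop] tail F)
    (hβν : ∫ t, t ∂ν < ∫ x, ∫ t, t ∂(β x) ∂π)
    -- the cycle-length tails, for some `b > E ζ`
    (b : ℝ) (hb : ∫ t, t ∂ν < b)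
    (hτ0 : (fun y => μ.real {ω | y < b * (cycleLength T 0 ω : ℝ)}) =o[atTop] secondTail F)
    (hτ1 : (fun y => μ.real {ω | y < b * (cycleLength T 1 ω : ℝ)}) =o[atTop] tail F) :
    ∀ B : Set 𝒳, MeasurableSet B →
      Tendsto
        (fun y : ℝ =>
          μ.real {ω | (y : EReal) < walkSup X ξ ω ∧ passageState X ξ y ω ∈ B} / secondTail F y)
        atTop (𝓝 ((∫ x in B, c x ∂π) / a)) := by
  have hΩ : Nonempty Ω := by
    by_contra hE
    rw [not_nonempty_iff] at hE
    have h1 := measure_univ (μ := μ)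
    rw [univ_eq_empty_iff.2 hE, measure_empty] at h1
    exact zero_ne_one h1
  obtain ⟨ω₀⟩ := hΩ
  -- The state `x₀` pads the words; its law `P x₀` also gives the integrability of the negative part
  -- of `ζ`.
  set x₀ : 𝒳 := X 0 ω₀
  obtain ⟨H, hHprob, hHheavy, hHeq, hHlittle⟩ := exists_heavyTail hF_nonneg hF_mean hFs
  have hFH : IsSecondTail F H := by
    refine ⟨hHheavy, ?_, hHlittle⟩
    filter_upwards [eventually_ofReal_secondTail hF_mean, eventually_ge_atTop 0] with y h1 h2
    rw [hHeq y h2]; exact h1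
  have hPν : ∀ x y, tail (P x) y ≤ tail ν y := fun x y => by
    refine (hFG x y).trans ?_
    rw [hG x]
    exact tail_differenceLaw_le (hβ x) y
  have hνint : Integrable (fun t : ℝ => t) ν := integrable_of_isBigO_tail hF_mean hν (hP x₀) (hPν x₀)
  obtain ⟨C, hC0, hC⟩ := exists_integratedTail_le hν
  have hCH : ∀ᶠ y in atTop, (integratedTail ν y).toReal ≤ C * tail H y := by
    filter_upwards [hC, hFH.eq] with y h1 h2
    rw [← h2, ← ENNReal.ofReal_mul hC0] at h1
    exact ENNReal.toReal_le_of_le_ofReal (mul_nonneg hC0 (tail_nonneg _ _)) h1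
  set ρ := μ.map (cycleWord X T x₀ 1) with hρdef
  set E := ∫⁻ ω, (cycleLength T 1 ω : ℝ≥0∞) ∂μ with hEdef
  have hEtop : E < ∞ := lintegral_cycleLength_lt_top hτ
  have hE1 : 1 ≤ E := hX.one_le_lintegral_length
  have hE0 : 0 < E.toReal := ENNReal.toReal_pos (zero_lt_one.trans_le hE1).ne' hEtop.ne
  have hρlen : ∫⁻ w, (w.1 : ℝ≥0∞) ∂ρ < ∞ := by rw [hX.lintegral_length x₀]; exact hEtop
  have hint_eq : intensity ρ = E • π := by rw [hπ]; exact intensity_eq_smul_cycleLaw hX hτ x₀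
  have hint : ∫⁻ x, ∫⁻ u, ‖quantile (P x) u‖ₑ ∂unif ∂(intensity ρ) < ∞ := by
    simp_rw [lintegral_enorm_quantile P]
    rw [hint_eq, lintegral_smul_measure]
    exact ENNReal.mul_lt_top hEtop hdrift_abs
  -- The occupation measure of a cycle is `E τ` times `π`, so the mean loss per cycle is `E τ` times
  -- `a`. The factor `E τ` cancels in `hlimit`.
  have hα : 0 < E.toReal * a := mul_pos hE0 ha
  have hdrift' : ∫ x, ∫ u, quantile (P x) u ∂unif ∂(intensity ρ) = -(E.toReal * a) := by
    simp_rw [integral_quantile]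
    rw [hint_eq, integral_smul_measure, hdrift, smul_eq_mul, mul_neg]
  have hπfin : IsFiniteMeasure π := by
    refine ⟨?_⟩
    have h1 : intensity ρ univ < ∞ := by rw [intensity_univ]; exact hρlen
    rw [hint_eq, Measure.smul_apply, smul_eq_mul] at h1
    exact lt_of_le_of_lt (le_mul_of_one_le_left' hE1) h1
  have hcint : Integrable c π := by
    refine (integrable_const L).mono' hc_meas.aestronglyMeasurable (ae_of_all _ fun x => ?_)
    rw [Real.norm_of_nonneg (hc_nonneg x)]
    exact tailConstant_le hFH.tail_pos hc hL x
  have hlimit : ∀ B : Set 𝒳, MeasurableSet B →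
      (weightedLimit c ρ fun i w => B.indicator (fun _ => 1) (w.2 i)).toReal / (E.toReal * a) =
        (∫ x in B, c x ∂π) / a := by
    intro B hB
    rw [weightedLimit_indicator hc_meas hB, hint_eq, Measure.restrict_smul, lintegral_smul_measure,
      smul_eq_mul, ENNReal.toReal_mul, ← integral_eq_lintegral_of_nonneg_ae
        (ae_of_all _ hc_nonneg) hc_meas.aestronglyMeasurable, mul_div_mul_left _ _ hE0.ne']
  have hτ0' : (fun y => μ.real {ω | y < b * (cycleLength T 0 ω : ℝ)}) =o[atTop] tail H :=
    hτ0.congr' EventuallyEq.rfl (by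
      filter_upwards [eventually_ge_atTop 0] with y hy
      exact (hHeq y hy).symm)
  have hupper : ∀ c', (∫ x, c x ∂π) / a < c' → ∀ᶠ y in atTop,
      (μ.prod unifArray).real {p | ∃ m, y < coupledWalk X T P p m} ≤ c' * tail H y := by
    intro c' hc'
    refine eventually_coupledWalk_le hX x₀ hFH hPν hP hc hL hρlen hint hα hdrift' hτ0' hτ1 hνint hν hCH
      hb ?_
    have h1 := hlimit univ MeasurableSet.univ
    simp only [indicator_univ, setIntegral_univ] at h1
    rw [h1]; exact hc'
  have hlower : ∀ B : Set 𝒳, MeasurableSet B → ∀ c', c' < (∫ x in B, c x ∂π) / a → ∀ᶠ y in atTop,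
      c' * tail H y ≤ μ.real
        {ω | ((fun n => X n ω), fun n => ξ n (X n ω) ω) ∈ passageEvent B y} := by
    intro B hB c' hc'
    filter_upwards [eventually_le_coupledWalk hX x₀ hFH hP hc hc_meas hL hρlen hint hα hdrift' hB
      (by rw [hlimit B hB]; exact hc')] with y hy
    rw [measureReal_def, measure_passage_eq hX hξ (measurableSet_passageEvent hB y)]
    exact hy
  intro B hB
  have hset : ∀ y : ℝ, 0 ≤ y → {ω | (y : EReal) < walkSup X ξ ω ∧ passageState X ξ y ω ∈ B} =
      {ω | ((fun n => X n ω), fun n => ξ n (X n ω) ω) ∈ passageEvent B y} := fun y hy => by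
    ext ω; exact walkSup_passageState_iff hy B ω
  have hsplit : ∫ x, c x ∂π = ∫ x in B, c x ∂π + ∫ x in Bᶜ, c x ∂π := (integral_add_compl hB hcint).symm
  rw [tendsto_order]
  constructor
  · intro c' hc'
    obtain ⟨c'', h1, h2⟩ := exists_between hc'
    filter_upwards [hlower B hB c'' h2, eventually_ge_atTop 0] with y hy hy0
    rw [hset y hy0, ← hHeq y hy0, lt_div_iff₀ (hFH.heavy.pos y)]
    exact lt_of_lt_of_le (mul_lt_mul_of_pos_right h1 (hFH.heavy.pos y)) hy
  -- The passage occurs in exactly one of `B` and its complement, so the probability for `B` is the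
  -- total one minus that for the complement. Bounding these above and below costs `δ` each, and a
  -- third `δ` keeps the final inequality strict.
  · intro c' hc'
    set δ := (c' - (∫ x in B, c x ∂π) / a) / 3 with hδ
    have hδ0 : 0 < δ := by rw [hδ]; linarith
    filter_upwards [hupper ((∫ x, c x ∂π) / a + δ) (by linarith),
      hlower Bᶜ hB.compl ((∫ x in Bᶜ, c x ∂π) / a - δ) (by linarith), eventually_ge_atTop 0]
      with y h1 h2 hy0
    rw [hset y hy0, ← hHeq y hy0, div_lt_iff₀ (hFH.heavy.pos y)]
    have hpath : ∀ s, MeasurableSet s → μ.real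
        {ω | ((fun n => X n ω), fun n => ξ n (X n ω) ω) ∈ passageEvent s y} =
        (μ.prod unifArray).real {p | ((fun n => X n p.1), fun j => quantile (P (X j p.1))
          (concat (fun n => cycleLength T n p.1) p.2 j)) ∈ passageEvent s y} := fun s hs => by
      rw [measureReal_def, measure_passage_eq hX hξ (measurableSet_passageEvent hs y)]
      rfl
    have hm : Measurable fun p : Ω × (ℕ → ℕ → ℝ) => ((fun n => X n p.1),
        fun j => quantile (P (X j p.1)) (concat (fun n => cycleLength T n p.1) p.2 j)) := by
      refine (measurable_pi_iff.2 fun n => (hX.measurable_process n).comp measurable_fst).prodMk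
        (measurable_pi_iff.2 fun j => ?_)
      have hℓ : Measurable fun ω n => cycleLength T n ω :=
        measurable_pi_iff.2 fun n => hX.measurable_cycleLength n
      have hcj : Measurable fun p : Ω × (ℕ → ℕ → ℝ) =>
          concat (fun n => cycleLength T n p.1) p.2 j :=
        (measurable_pi_apply j).comp (measurable_concat.comp
          ((hℓ.comp measurable_fst).prodMk measurable_snd))
      exact (measurable_quantile_uncurry P).comp
        (((hX.measurable_process j).comp measurable_fst).prodMk hcj)
    have hadd := measureReal_union (μ := μ.prod unifArray)
      ((disjoint_passageEvent B y).preimage fun p : Ω × (ℕ → ℕ → ℝ) => ((fun n => X n p.1),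
        fun j => quantile (P (X j p.1)) (concat (fun n => cycleLength T n p.1) p.2 j)))
      (hm (measurableSet_passageEvent hB.compl y))
    rw [← preimage_union, passageEvent_union] at hadd
    have huniv : (fun p : Ω × (ℕ → ℕ → ℝ) => ((fun n => X n p.1),
        fun j => quantile (P (X j p.1)) (concat (fun n => cycleLength T n p.1) p.2 j))) ⁻¹'
        passageEvent univ y = {p | ∃ m, y < coupledWalk X T P p m} := by
      ext p; exact mem_passageEvent_univ hy0 _
    rw [huniv] at hadd
    rw [hpath Bᶜ hB.compl] at h2
    rw [hpath B hB]
    have hadd' : (μ.prod unifArray).real {p | ∃ m, y < coupledWalk X T P p m} =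
        (μ.prod unifArray).real {p | ((fun n => X n p.1), fun j => quantile (P (X j p.1))
          (concat (fun n => cycleLength T n p.1) p.2 j)) ∈ passageEvent B y} +
        (μ.prod unifArray).real {p | ((fun n => X n p.1), fun j => quantile (P (X j p.1))
          (concat (fun n => cycleLength T n p.1) p.2 j)) ∈ passageEvent Bᶜ y} := hadd
    have hpos := hFH.heavy.pos y
    rw [hsplit, add_div] at h1
    have h3 : c' = (∫ x in B, c x ∂π) / a + 3 * δ := by rw [hδ]; ring
    have h4 : 0 < δ * tail H y := mul_pos hδ0 hpos
    rw [h3]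
    nlinarith
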